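/- Setting. There are three experiments $X,Y,Z$. An observation of experiment $W\in\{X,Y,Z\}$ has density $f_0^W$ before the change point $\nu\in\{1,2,\dots\}\cup\{\infty\}$ and $f_1^W$ at times $n\ge\nu$; all observations are independent. $P_\nu,E_\nu$ denote probability and expectation with change point $\nu$ ($\nu=\infty$: no change), and $\ell_W=\log(f_1^W/f_0^W)\in[-\infty,\infty]$. Exactly one experiment is performed at each time. CUSUM. For a threshold $h$, $\tau_C^W(h)=\inf\{n\ge1: C_n>h\}$, where $C_0=0$ and $C_{n+1}=\max\{C_n+\ell_W(W_{n+1}),0\}$. Truncation limits. Let $a_Y,a_Z,N_X,N_Y>0$ be real. Whenever a limit $N$ with $l<N<l+1$, $l\ge0$ an integer, is put into use, an independent random integer limit is drawn, equal to $l$ with probability $l+1-N$ and to $l+1$ with probability $N-l$; an integer $N$ is used as it is. Truncated 2E-CUSUM $\Psi_{2E}(b,0,a_Y,N_X,N_Y)$, $b<0$. Draw the limit on the number of $Y$-observations. Start with $D=b$ and use $Y$, adding $\ell_Y$ to $D$ at each observation. Stop as soon as $D>0$ or the limit on $Y$-observations is reached (immediately if it is $0$). If, without stopping, $D$ falls below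 $b$, say $D=b+U$ with $U<0$, then draw a limit for $X$ and run the CUSUM for $X$ with zero level $b+a_YU$, starting at that level, i.e. $D\leftarrow\max\{D+\ell_X,\,b+a_YU\}$, until $D>b$ or the drawn number of $X$-observations has been used; then reset $D$ to $b$ and go on with $Y$. $\tau_{2E}(b,0,a_Y,N_X,N_Y)$ is the total number of observations used. (If $b$ or $b+a_YU$ is $-\infty$, the statistic is measured by its height above that level.) 3E-CUSUM $\Psi_{3E}(A,a_Y,a_Z,N_X,N_Y)$. Start with $D_0=0$ and use $Z$, adding $\ell_Z$ to $D$. When $D$ falls below $0$, to the value $D_\sigma$, execute $\Psi_{2E}(a_ZD_\sigma,0,a_Y,N_X,N_Y)$; when it stops, reset $D$ to $0$ and go on with $Z$. The change is declared at $\tau_{3E}=\inf\{n\ge1:D_n>A\}$. Performance. For a policy $\Psi$ with stopping time $\tau$, $I_n$ is the information consisting of the experiments performed at the times $1,\dots,n$ and their observations. Put $\mathrm{ARLFA}(\Psi)=E_\infty[\tau]$ and $\mathrm{WADD}(\Psi)=\sup_{\nu\ge1}\operatorname{ess\,sup}E_\nu[(\tau-\nu+1)^+\mid I_{\nu-1}]$.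 For an experiment $W$, $\mathrm{POR}_W(\Psi)=\limsup_{n\to\infty}E_\infty\big[\frac1n\sum_{k=1}^{n-1}\mathbf 1\{W\text{ is performed at time }k\}\big]$, computed for the policy that continues forever without stopping. Let $\sigma^Z=\inf\{n\ge1:\sum_{i=1}^n\ell_Z(Z_i)<0\}$ and $D_{\sigma^Z}=\sum_{i=1}^{\sigma^Z}\ell_Z(Z_i)$. Theorem. Suppose $0<D(f_1^X\Vert f_0^X)\le D(f_1^Y\Vert f_0^Y)\le D(f_1^Z\Vert f_0^Z)<\infty$. (1) For all $a_Y,a_Z,N_X,N_Y>0$ and $\gamma>0$, if $A=\log\gamma$ then $\mathrm{ARLFA}(\Psi_{3E}(A,a_Y,a_Z,N_X,N_Y))\ge\gamma$. (2) For all $A,a_Y,a_Z,N_X,N_Y>0$, the expectations $E_\infty[\sigma^Z]$ and $E_\infty[\tau_{2E}(a_ZD_{\sigma^Z},0,a_Y,N_X,N_Y)]$ are finite and $$\mathrm{POR}_Z(\Psi_{3E})=\frac{E_\infty[\sigma^Z]}{E_\infty[\sigma^Z]+E_\infty[\tau_{2E}(a_ZD_{\sigma^Z},0,a_Y,N_X,N_Y)]},$$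 $$\mathrm{POR}_Y(\Psi_{3E})=\frac{E_\infty[\min\{\tau_C^Y(|a_ZD_{\sigma^Z}|),N_Y\}]}{E_\infty[\sigma^Z]+E_\infty[\tau_{2E}(a_ZD_{\sigma^Z},0,a_Y,N_X,N_Y)]},$$ where $\tau_C^Y$, the truncated 2E-CUSUM and its limits use data independent of $(\sigma^Z,D_{\sigma^Z})$. These expressions do not depend on $A$. Moreover, for all $\beta_Y,\beta_Z\in(0,1)$ there are $a_Y,a_Z,N_X,N_Y>0$ such that for every $A>0$, $\mathrm{POR}_Z(\Psi_{3E})\le\beta_Z$ and $\mathrm{POR}_Y(\Psi_{3E})\le\beta_Y$. (3) For all $a_Y,a_Z,N_X,N_Y>0$ and every $A>0$, $$\mathrm{WADD}(\Psi_{3E})\le E_1[\tau_{3E}]+N_Y+N_YN_X .$$ Consequently there is a constant $K_3<\infty$ that does not depend on $A$ such that for every $A>0$, with $\tau_C^Z(A)$ the CUSUM algorithm that always performs $Z$, $$\mathrm{WADD}(\Psi_{3E})\le E_1[\tau_{3E}]+N_Y+N_YN_X\le\mathrm{WADD}(\tau_C^Z(A))+K_3 .$$ -/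

import Mathlib

open MeasureTheory Filter
open scoped ENNReal NNReal

noncomputable section

namespace QCD

/-- An experiment: observations in `𝓧` whose density with respect to a σ-finite reference measure
is `f₀` before the change and `f₁` from the change point on. -/
structure Experiment (𝓧 : Type*) [MeasurableSpace 𝓧] where
  ref : Measure 𝓧
  f₀ : 𝓧 → ℝ≥0
  f₁ : 𝓧 → ℝ≥0
  sigmaFinite_ref : SigmaFinite ref
  measurable_f₀ : Measurable f₀
  measurable_f₁ : Measurable f₁
  lintegral_f₀ : ∫⁻ x, (f₀ x : ℝ≥0∞) ∂ref = 1
  lintegral_f₁ : ∫⁻ x, (f₁ x : ℝ≥0∞) ∂ref = 1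

namespace Experiment

variable {𝓧 : Type*} [MeasurableSpace 𝓧] (E : Experiment 𝓧)

/-- The pre-change law of one observation. -/
def pre : Measure 𝓧 := E.ref.withDensity fun x => (E.f₀ x : ℝ≥0∞)

/-- The post-change law of one observation. -/
def post : Measure 𝓧 := E.ref.withDensity fun x => (E.f₁ x : ℝ≥0∞)

instance : IsProbabilityMeasure E.pre :=
  ⟨by rw [pre, withDensity_apply _ MeasurableSet.univ, Measure.restrict_univ, E.lintegral_f₀]⟩

instance : IsProbabilityMeasure E.post :=
  ⟨by rw [post, withDensity_apply _ MeasurableSet.univ, Measure.restrict_univ, E.lintegral_f₁]⟩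

/-- The information quality `D(f₁ ‖ f₀)`. -/
def kl : ℝ≥0∞ := InformationTheory.klDiv E.post E.pre

/-- The log-likelihood ratio `log (f₁ x / f₀ x)`, an extended real number: it is `-∞` where
`f₁ x = 0`. -/
def llr (x : 𝓧) : EReal := ENNReal.log ((E.f₁ x : ℝ≥0∞) / (E.f₀ x : ℝ≥0∞))

end Experiment

/-- The three experiments. -/
inductive Label
  | X
  | Y
  | Z
  deriving DecidableEq

/-- Everything that is drawn at one instant: one potential observation of each experiment, and two
uniform variables, used to draw integer truncation limits with mean `N_X` and `N_Y`. -/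
abbrev Datum (𝓧 𝓨 𝓩 : Type*) := 𝓧 × 𝓨 × 𝓩 × unitInterval × unitInterval

/-- Sample paths; `ω n` holds the data of time `n + 1`. -/
abbrev Path (𝓧 𝓨 𝓩 : Type*) := ℕ → Datum 𝓧 𝓨 𝓩

/-- The random integer limit of mean `N ≥ 0`: it is `N` if `N` is an integer, and if
`l < N < l + 1` it is `l + 1` with probability `N - l` and `l` with probability `l + 1 - N`
(`u` is uniform on `[0, 1]`). -/
def randomLimit (N : ℝ) (u : unitInterval) : ℕ :=
  if (u : ℝ) < N - (⌊N⌋₊ : ℝ) then ⌊N⌋₊ + 1 else ⌊N⌋₊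

/-- The first `n ≥ 1` at which `p` holds, `⊤` if there is none. -/
def firstTime (p : ℕ → Prop) : ℕ∞ := ⨅ (n : ℕ) (_ : 1 ≤ n ∧ p n), (n : ℕ∞)

/-! ### Policies and their performance -/

variable {𝓧 𝓨 𝓩 : Type*} [MeasurableSpace 𝓧] [MeasurableSpace 𝓨] [MeasurableSpace 𝓩]

/-- The joint law of the data of one instant, before the change. -/
def preLaw (EX : Experiment 𝓧) (EY : Experiment 𝓨) (EZ : Experiment 𝓩) :
    Measure (Datum 𝓧 𝓨 𝓩) :=
  EX.pre.prod (EY.pre.prod (EZ.pre.prod (volume.prod volume)))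

/-- The joint law of the data of one instant, from the change point on. -/
def postLaw (EX : Experiment 𝓧) (EY : Experiment 𝓨) (EZ : Experiment 𝓩) :
    Measure (Datum 𝓧 𝓨 𝓩) :=
  EX.post.prod (EY.post.prod (EZ.post.prod (volume.prod volume)))

/-- The law of the data of time `n + 1` if the change point is `ν`. -/
def lawAt (EX : Experiment 𝓧) (EY : Experiment 𝓨) (EZ : Experiment 𝓩) (ν : ℕ∞) (n : ℕ) :
    Measure (Datum 𝓧 𝓨 𝓩) :=
  if ((n + 1 : ℕ) : ℕ∞) < ν then preLaw EX EY EZ else postLaw EX EY EZ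

instance (EX : Experiment 𝓧) (EY : Experiment 𝓨) (EZ : Experiment 𝓩) (ν : ℕ∞) (n : ℕ) :
    IsProbabilityMeasure (lawAt EX EY EZ ν n) := by
  unfold lawAt preLaw postLaw
  split_ifs <;> infer_instance

/-- The probability measure `P_ν` under which the change occurs at time `ν`; `P_∞` (no change) is
`ν = ⊤`. The data of different instants are independent. -/
def P (EX : Experiment 𝓧) (EY : Experiment 𝓨) (EZ : Experiment 𝓩) (ν : ℕ∞) :
    Measure (Path 𝓧 𝓨 𝓩) :=
  Measure.infinitePi (lawAt EX EY EZ ν)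

/-- A policy: the experiment `select n` to be performed at time `n + 1` (were the policy never
stopped), and the time at which a change is declared. -/
structure Policy (𝓧 𝓨 𝓩 : Type*) where
  select : ℕ → Path 𝓧 𝓨 𝓩 → Label
  alarm : Path 𝓧 𝓨 𝓩 → ℕ∞

/-- What is seen at time `k + 1`: which experiment is performed, and its observation. -/
def Policy.seen (Ψ : Policy 𝓧 𝓨 𝓩) (k : ℕ) (ω : Path 𝓧 𝓨 𝓩) : 𝓧 ⊕ 𝓨 ⊕ 𝓩 :=
  match Ψ.select k ω with
  | .X => Sum.inl (ω k).1
  | .Y => Sum.inr (Sum.inl (ω k).2.1)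
  | .Z => Sum.inr (Sum.inr (ω k).2.2.1)

/-- The information `I_n`, as a σ-algebra: the experiments performed at the times `1, …, n` and
their observations (and not the randomization). -/
@[reducible] def Policy.info (Ψ : Policy 𝓧 𝓨 𝓩) (n : ℕ) : MeasurableSpace (Path 𝓧 𝓨 𝓩) :=
  MeasurableSpace.comap (fun ω (k : Fin n) => Ψ.seen k ω) inferInstance

/-- `E_ν[τ]`, the mean of the stopping time if the change occurs at time `ν`. -/
def meanAlarm (EX : Experiment 𝓧) (EY : Experiment 𝓨) (EZ : Experiment 𝓩) (ν : ℕ∞)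
    (Ψ : Policy 𝓧 𝓨 𝓩) : ℝ≥0∞ :=
  ∫⁻ ω, (Ψ.alarm ω : ℝ≥0∞) ∂P EX EY EZ ν

/-- The average run length to false alarm. -/
def arlfa (EX : Experiment 𝓧) (EY : Experiment 𝓨) (EZ : Experiment 𝓩)
    (Ψ : Policy 𝓧 𝓨 𝓩) : ℝ≥0∞ :=
  meanAlarm EX EY EZ ⊤ Ψ

/-- The pre-change observation ratio of experiment `i`,
`limsup_n E_∞[(1/n) ∑_{k=1}^{n-1} 1{experiment i is performed at time k}]`, for the policy that
goes on forever without stopping. -/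
def por (EX : Experiment 𝓧) (EY : Experiment 𝓨) (EZ : Experiment 𝓩)
    (Ψ : Policy 𝓧 𝓨 𝓩) (i : Label) : ℝ≥0∞ :=
  limsup (fun n : ℕ => ∫⁻ ω, (∑ k ∈ Finset.range (n - 1), if Ψ.select k ω = i then 1 else 0) /
    (n : ℝ≥0∞) ∂P EX EY EZ ⊤) atTop

/-- Lorden's worst-case average detection delay,
`sup_{ν ≥ 1} ess sup E_ν[(τ - ν + 1)⁺ | I_{ν-1}]`. -/
def wadd (EX : Experiment 𝓧) (EY : Experiment 𝓨) (EZ : Experiment 𝓩)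
    (Ψ : Policy 𝓧 𝓨 𝓩) : ℝ≥0∞ :=
  ⨆ (ν : ℕ) (_ : 1 ≤ ν), essSup
    (condLExp (Ψ.info (ν - 1)) (P EX EY EZ ν) fun ω => (Ψ.alarm ω : ℝ≥0∞) + 1 - (ν : ℝ≥0∞))
    (P EX EY EZ ν)

/-! ### CUSUM -/

/-- The CUSUM statistic of an observation sequence: `C_0 = 0`, `C_{n+1} = max (C_n + ℓ(x)) 0`. -/
def cusumStat {𝓦 : Type*} [MeasurableSpace 𝓦] (E : Experiment 𝓦) (x : ℕ → 𝓦) : ℕ → EReal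
  | 0 => 0
  | n + 1 => max (cusumStat E x n + E.llr (x n)) 0

/-- The CUSUM stopping time `τ_C(A) = inf {n ≥ 1 : C_n > A}`. -/
def cusumTime {𝓦 : Type*} [MeasurableSpace 𝓦] (E : Experiment 𝓦) (A : EReal) (x : ℕ → 𝓦) : ℕ∞ :=
  firstTime fun n => A < cusumStat E x n

/-- The CUSUM algorithm for experiment `Z`. -/
def cusumZ (EZ : Experiment 𝓩) (A : ℝ) : Policy 𝓧 𝓨 𝓩 where
  select _ _ := .Z
  alarm ω := cusumTime EZ A fun n => (ω n).2.2.1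

/-! ### The truncated 2E-CUSUM algorithm for `Y` and `X`

It starts from a level `b` and stops when the statistic `D` exceeds a threshold `A`, or when the
`Y` observations that are allowed are used up. As `b` may be `-∞` (after a log-likelihood ratio
`-∞`), the statistic is stored as its height over the current zero level. -/

/-- States of the truncated 2E-CUSUM algorithm.

* `onY w k`: experiment `Y` is next; the statistic is `b + w`, and `k` observations of `Y` are left.
* `onX v u j k`: experiment `X` is next; the zero level for `X` is `b - u`, the statistic is
  `b - u + v`, `j` observations of `X` are left in this run, and `k` observations of `Y` are left.
* `done`: the algorithm has stopped. -/
inductive TwoE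
  | onY (w : EReal) (k : ℕ)
  | onX (v u : EReal) (j k : ℕ)
  | done

/-- The start at level `b`, when `k` observations of `Y` are allowed. -/
def TwoE.start (k : ℕ) : TwoE := if k = 0 then .done else .onY 0 k

/-- One step of the truncated 2E-CUSUM algorithm; `h = A - b` is the height of the stopping
threshold over the level `b`, and `o` holds the data of the next instant.

With `Y`, the log-likelihood ratio is added; the algorithm stops if the threshold is exceeded or
no observation of `Y` is left. If the statistic falls below `b`, with undershoot `w' < 0`, at most
`randomLimit N_X` observations of `X` follow, in a CUSUM with zero level `b + a_Y w'` that starts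
at its zero level. When this CUSUM goes above `b`, or its observations are used up, the statistic
is reset to `b` and `Y` is used again. -/
def TwoE.step (EX : Experiment 𝓧) (EY : Experiment 𝓨) (aY NX : ℝ) (h : EReal) :
    TwoE → Datum 𝓧 𝓨 𝓩 → TwoE
  | .onY w k, o =>
    let w' := w + EY.llr o.2.1
    let j := randomLimit NX o.2.2.2.1
    if h < w' ∨ k ≤ 1 then .done
    else if w' < 0 then
      if j = 0 then .onY 0 (k - 1) else .onX 0 (-((aY : EReal) * w')) j (k - 1)
    else .onY w' (k - 1)
  | .onX v u j k, o =>
    let v' := max (v + EX.llr o.1) 0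
    if u < v' ∨ j ≤ 1 then .onY 0 k else .onX v' u (j - 1) k
  | .done, _ => .done

/-- The state after `n` steps of `Ψ_2E(b, A, a_Y, N_X, N_Y)` with `h = A - b`, run on its own. -/
def twoEState (EX : Experiment 𝓧) (EY : Experiment 𝓨) (aY NX NY : ℝ) (h : EReal)
    (ω : Path 𝓧 𝓨 𝓩) : ℕ → TwoE
  | 0 => TwoE.start (randomLimit NY (ω 0).2.2.2.2)
  | n + 1 => (twoEState EX EY aY NX NY h ω n).step EX EY aY NX h (ω n)

/-- The stopping time `τ_2E(b, 0, a_Y, N_X, N_Y)` of the truncated 2E-CUSUM algorithm started at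
`b`, with stopping threshold `0`; it is `0` if no observation of `Y` is allowed. -/
def twoETime (EX : Experiment 𝓧) (EY : Experiment 𝓨) (b : EReal) (aY NX NY : ℝ)
    (ω : Path 𝓧 𝓨 𝓩) : ℕ∞ :=
  ⨅ (n : ℕ) (_ : twoEState EX EY aY NX NY (0 - b) ω n = .done), (n : ℕ∞)

/-! ### The 3E-CUSUM algorithm -/

/-- States of the 3E-CUSUM algorithm.

* `onZ d`: experiment `Z` is next, and the statistic is `d`.
* `below h s`: the truncated 2E-CUSUM algorithm started at the level `b = -h`, with stopping
  threshold `0`, is being executed, and is in state `s`. -/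
inductive ThreeE
  | onZ (d : EReal)
  | below (h : EReal) (s : TwoE)

/-- The statistic `D_n`. -/
def ThreeE.stat : ThreeE → EReal
  | .onZ d => d
  | .below h (.onY w _) => -h + w
  | .below h (.onX v u _ _) => -h - u + v
  | .below _ .done => 0

/-- The experiment to be performed next. -/
def ThreeE.label : ThreeE → Label
  | .below _ (.onY _ _) => .Y
  | .below _ (.onX _ _ _ _) => .X
  | _ => .Z

/-- Execution of the truncated 2E-CUSUM algorithm inside the 3E-CUSUM algorithm: when it has
stopped, the statistic is reset to `0` and experiment `Z` is used again. -/
def ThreeE.resume (h : EReal) : TwoE → ThreeE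
  | .done => .onZ 0
  | s => .below h s

/-- One step of the 3E-CUSUM algorithm. With `Z`, the log-likelihood ratio is added; when the
statistic falls below `0`, with undershoot `d' < 0`, the truncated 2E-CUSUM algorithm is started at
the level `a_Z d'`. -/
def ThreeE.step (EX : Experiment 𝓧) (EY : Experiment 𝓨) (EZ : Experiment 𝓩) (aY aZ NX NY : ℝ) :
    ThreeE → Datum 𝓧 𝓨 𝓩 → ThreeE
  | .onZ d, o =>
    let d' := d + EZ.llr o.2.2.1
    if d' < 0 then
      .resume (-((aZ : EReal) * d')) (TwoE.start (randomLimit NY o.2.2.2.2))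
    else .onZ d'
  | .below h s, o => .resume h (s.step EX EY aY NX h o)

/-- The state of the 3E-CUSUM algorithm after `n` observations, if it is never stopped. -/
def threeEState (EX : Experiment 𝓧) (EY : Experiment 𝓨) (EZ : Experiment 𝓩) (aY aZ NX NY : ℝ)
    (ω : Path 𝓧 𝓨 𝓩) : ℕ → ThreeE
  | 0 => .onZ 0
  | n + 1 => (threeEState EX EY EZ aY aZ NX NY ω n).step EX EY EZ aY aZ NX NY (ω n)

/-- The 3E-CUSUM algorithm `Ψ_3E(A, a_Y, a_Z, N_X, N_Y)`, which stops at
`τ_3E = inf {n ≥ 1 : D_n > A}`. -/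
def psi3E (EX : Experiment 𝓧) (EY : Experiment 𝓨) (EZ : Experiment 𝓩) (A aY aZ NX NY : ℝ) :
    Policy 𝓧 𝓨 𝓩 where
  select n ω := (threeEState EX EY EZ aY aZ NX NY ω n).label
  alarm ω := firstTime fun n => (A : EReal) < (threeEState EX EY EZ aY aZ NX NY ω n).stat

/-! ### The quantities in the observation ratios -/

/-- The sum of the first `n` log-likelihood ratios of experiment `Z`. -/
def walkZ (EZ : Experiment 𝓩) (ω : Path 𝓧 𝓨 𝓩) (n : ℕ) : EReal :=
  ∑ i ∈ Finset.range n, EZ.llr (ω i).2.2.1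

/-- `σ^Z = σ^Z(∞)`, the first time at which the statistic with experiment `Z` falls below `0`. -/
def sigmaZ (EZ : Experiment 𝓩) (ω : Path 𝓧 𝓨 𝓩) : ℕ∞ :=
  firstTime fun n => walkZ EZ ω n < 0

/-- The undershoot `D_{σ^Z}` (on the event `σ^Z < ∞`). -/
def undershootZ (EZ : Experiment 𝓩) (ω : Path 𝓧 𝓨 𝓩) : EReal :=
  walkZ EZ ω (sigmaZ EZ ω).toNat

/-- `E_∞[σ^Z]`. -/
def meanSigmaZ (EX : Experiment 𝓧) (EY : Experiment 𝓨) (EZ : Experiment 𝓩) : ℝ≥0∞ :=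
  ∫⁻ ω, (sigmaZ EZ ω : ℝ≥0∞) ∂P EX EY EZ ⊤

/-- `E_∞[τ_2E(a_Z D_{σ^Z}, 0, a_Y, N_X, N_Y)]`. -/
def meanTwoE (EX : Experiment 𝓧) (EY : Experiment 𝓨) (EZ : Experiment 𝓩) (aY aZ NX NY : ℝ) :
    ℝ≥0∞ :=
  ∫⁻ ω, (twoETime EX EY ((aZ : EReal) * undershootZ EZ ω) aY NX NY ω : ℝ≥0∞) ∂P EX EY EZ ⊤

/-- `E_∞[min {τ_C^Y(|a_Z D_{σ^Z}|), N_Y}]`, where `N_Y` is drawn at random if it is no integer. -/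
def meanTruncCusumY (EX : Experiment 𝓧) (EY : Experiment 𝓨) (EZ : Experiment 𝓩) (aZ NY : ℝ) :
    ℝ≥0∞ :=
  ∫⁻ ω, ((min (cusumTime EY (-((aZ : EReal) * undershootZ EZ ω)) fun n => (ω n).2.1)
    (randomLimit NY (ω 0).2.2.2.2 : ℕ∞) : ℕ∞) : ℝ≥0∞) ∂P EX EY EZ ⊤

end QCD

end

open QCD

noncomputable section

namespace QCD

set_option linter.unusedSectionVars false

/-! ### Resampling coordinates of an infinite product -/

/-! The unstopped algorithm is a Markov chain driven by independent data. While `Y` or `X` is used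
the statistic stays at or below zero, so only `Z` can raise an alarm, and the alarm time is the exit
time from `alarmFree`. Mean times thus become potentials of killed chains, handled by one-step
analysis (`potential_eq`, `partialPotential_succ`) and by induction on a finite horizon.

False alarms. Before the change $e^{\ell_Z}$ has mean at most $1$. Let $J$ be the mean time to
alarm, and let $V=e^d-1$ at level $d$ of `Z`, $V=0$ below zero. One step shows that $\gamma\le J+V$
reproduces itself: an alarm comes with $e^{d'}\ge\gamma$, a fall leads to a state with $V=0$, and
the observation just made pays for the $-1$ in $V$. The executions of 2E-CUSUM only add time
(`le_potential_of_excess`, `le_arlfa`).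

Observation ratios. A positive divergence gives Hellinger affinity $\rho=\int\sqrt{f_0^Zf_1^Z}<1$
(`affinity_lt_one`). Before the change $e^{d/2}$ shrinks by the factor $\rho$ per observation of
`Z`, so a descent below zero has finite mean length; an execution of 2E-CUSUM is bounded by its
limits. The path splits into cycles between successive resets to $0$. If $Q$ is the mean reward
until the current cycle ends, its one-step equation telescopes to: mean reward by time $n$, plus
$E\,Q$ at time $n$, equals the reward of a cycle times the mean number of cycles begun
(`sum_lintegral_reward`). The cycle count is the same for the reward of one experiment and for the
reward $1$, and $E\,Q$ stays bounded; dividing gives the ratios without a renewal theorem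
(`limsup_average_eq`, `por_eq_div`). The cycle means are identified with the stated expectations
because the undershoot depends on `Z` alone and the 2E-CUSUM on other coordinates
(`lintegral_decouple`), and because interruptions by `X` do not alter the height with which `Y`
resumes, so that the observations of `Y` form a truncated CUSUM (`meanCountY_onY`).

To meet prescribed ratios, take $N_Y=2$, which bounds the mean use of `Y` by $2$, and make $N_X$ and
then $a_Y$ large: with fixed positive probability the first observation of `Y` starts an `X` run
that with high probability uses its whole allowance (`exists_le_meanBelow`).

Detection delay. From any state the mean time to an alarm is at most that from level $0$ plus the
time needed to finish the current execution of 2E-CUSUM (`partialPotential_alarmFree_mono`,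
`potential_resume_le`). Given the information at time $\nu-1$, that time has mean at most
$N_Y+N_YN_X$; a limit drawn at the last instant is still unseen and may be averaged
(`lintegral_info_duration_le`). For the comparison with CUSUM, both procedures reset to $0$ at a
fall. After the change $e^{-\ell_Z/2}$ has mean $\rho$, so the mean number of falls is at most
$\rho/(1-\rho)$ whatever $A$ is, and each fall costs at most $N_Y+N_YN_X$
(`partialPotential_le_cusum`). -/

theorem indicator_one_congr {α β : Type*} {s : Set α} {t : Set β} {a : α} {b : β}
    (h : a ∈ s ↔ b ∈ t) : s.indicator (1 : α → ℝ≥0∞) a = t.indicator 1 b := by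
  by_cases ha : a ∈ s
  · simp [ha, h.1 ha]
  · rw [Set.indicator_of_notMem ha, Set.indicator_of_notMem fun hb => ha (h.2 hb)]

section Resampling

variable {O : Type*} [MeasurableSpace O]

theorem measurable_update_prod (N : ℕ) :
    Measurable fun p : (ℕ → O) × O => Function.update p.1 N p.2 := by
  refine measurable_pi_lambda _ fun i => ?_
  by_cases h : i = N
  · subst h; simpa using measurable_snd
  · simp only [Function.update_of_ne h]
    exact (measurable_pi_apply i).comp measurable_fst

/-- A product measure is determined by finite boxes. In the preimage of a box the constraint at `N`
falls on the fresh variable alone, so the box probability factors as before. -/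
theorem map_update_infinitePi (μ : ℕ → Measure O) [∀ n, IsProbabilityMeasure (μ n)] (N : ℕ) :
    ((Measure.infinitePi μ).prod (μ N)).map (fun p => Function.update p.1 N p.2) =
      Measure.infinitePi μ := by
  have hm := measurable_update_prod (O := O) N
  refine Measure.eq_infinitePi _ fun s t ht => ?_
  have hs : MeasurableSet (Set.pi (s : Set ℕ) t) :=
    MeasurableSet.pi s.countable_toSet fun i _ => ht i
  rw [Measure.map_apply hm hs]
  have : (fun p : (ℕ → O) × O => Function.update p.1 N p.2) ⁻¹' (Set.pi (s : Set ℕ) t) =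
      (Set.pi ((s.erase N : Finset ℕ) : Set ℕ) t) ×ˢ (if N ∈ s then t N else Set.univ) := by
    ext ⟨ω, o⟩
    simp only [Set.mem_preimage, Set.mem_pi, Set.mem_prod, Finset.coe_erase, Set.mem_sdiff,
      Finset.mem_coe, Set.mem_singleton_iff]
    constructor
    · intro h
      refine ⟨fun i hi => ?_, ?_⟩
      · simpa [Function.update_of_ne hi.2] using h i hi.1
      · split_ifs with hN
        · simpa using h N hN
        · trivial
    · rintro ⟨h1, h2⟩ i hi
      by_cases h : i = N
      · subst h; simpa [hi] using h2
      · simpa [Function.update_of_ne h] using h1 i ⟨hi, h⟩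
  rw [this, Measure.prod_prod, Measure.infinitePi_pi _ fun i _ => ht i]
  split_ifs with hN
  · rw [Finset.prod_erase_mul s (fun i => μ i (t i)) hN]
  · rw [Finset.erase_eq_of_notMem hN, measure_univ, mul_one]

theorem lintegral_resample (μ : ℕ → Measure O) [∀ n, IsProbabilityMeasure (μ n)] (N : ℕ)
    {Φ : (ℕ → O) → ℝ≥0∞} (hΦ : Measurable Φ) :
    ∫⁻ ω, Φ ω ∂Measure.infinitePi μ =
      ∫⁻ ω, ∫⁻ o, Φ (Function.update ω N o) ∂μ N ∂Measure.infinitePi μ := by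
  conv_lhs => rw [← map_update_infinitePi μ N]
  rw [lintegral_map hΦ (measurable_update_prod N),
    lintegral_prod (fun p : (ℕ → O) × O => Φ (Function.update p.1 N p.2))
      (hΦ.comp (measurable_update_prod N)).aemeasurable]

/-- If `Φ (ω, o)` does not depend on the coordinate `N` of `ω`, then that coordinate may be
integrated out first. -/
theorem lintegral_eval (μ : ℕ → Measure O) [∀ n, IsProbabilityMeasure (μ n)] (N : ℕ)
    {Φ : (ℕ → O) → O → ℝ≥0∞} (hΦ : Measurable (Function.uncurry Φ))
    (h : ∀ ω o o', Φ (Function.update ω N o) o' = Φ ω o') :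
    ∫⁻ ω, Φ ω (ω N) ∂Measure.infinitePi μ = ∫⁻ ω, ∫⁻ o, Φ ω o ∂μ N ∂Measure.infinitePi μ := by
  rw [lintegral_resample μ N (Φ := fun ω => Φ ω (ω N))
    (hΦ.comp (measurable_id.prodMk (measurable_pi_apply N)))]
  simp [h]

/-- Two independent copies of an i.i.d. sequence may be combined coordinatewise. -/
theorem map_combine_infinitePi {μ : Measure O} [IsProbabilityMeasure μ] {g : O → O → O}
    (hg : Measurable (Function.uncurry g)) (hμ : (μ.prod μ).map (Function.uncurry g) = μ) :
    ((Measure.infinitePi fun _ : ℕ => μ).prod (Measure.infinitePi fun _ : ℕ => μ)).map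
      (fun p n => g (p.1 n) (p.2 n)) = Measure.infinitePi fun _ : ℕ => μ := by
  set Q := Measure.infinitePi fun _ : ℕ => μ with hQ
  have hm : Measurable fun (p : (ℕ → O) × (ℕ → O)) (n : ℕ) => g (p.1 n) (p.2 n) :=
    measurable_pi_lambda _ fun n => hg.comp (f := fun p : (ℕ → O) × (ℕ → O) => (p.1 n, p.2 n))
      (((measurable_pi_apply n).comp measurable_fst).prodMk
        ((measurable_pi_apply n).comp measurable_snd))
  refine Measure.eq_infinitePi _ fun s t ht => ?_
  -- The newly added coordinate `a` is integrated out of each of the two sequences; the constraints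
  -- at the other coordinates do not involve it.
  induction s using Finset.induction_on with
  | empty =>
    rw [Measure.map_apply hm (by simp)]
    simp
  | insert a s ha ih =>
    have hs : ∀ s : Finset ℕ, MeasurableSet (Set.pi (s : Set ℕ) t) := fun s =>
      MeasurableSet.pi s.countable_toSet fun i _ => ht i
    rw [Finset.prod_insert ha, ← ih]
    rw [Measure.map_apply hm (hs _), Measure.map_apply hm (hs _)]
    set Φ : (ℕ → O) × (ℕ → O) → ℝ≥0∞ :=
      (Set.indicator ((fun (p : (ℕ → O) × (ℕ → O)) (n : ℕ) => g (p.1 n) (p.2 n)) ⁻¹'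
        Set.pi (s : Set ℕ) t) 1) with hΦ
    set Θ : O → O → ℝ≥0∞ := fun o o' => Set.indicator (t a) 1 (g o o') with hΘ
    have mΦ : Measurable Φ := measurable_one.indicator (hm (hs _))
    have mΘ : Measurable (Function.uncurry Θ) := (measurable_one.indicator (ht a)).comp hg
    have key : ∀ p : (ℕ → O) × (ℕ → O), Set.indicator ((fun (p : (ℕ → O) × (ℕ → O)) (n : ℕ) =>
        g (p.1 n) (p.2 n)) ⁻¹' Set.pi ((insert a s : Finset ℕ) : Set ℕ) t) (1 : (ℕ → O) × (ℕ → O) → ℝ≥0∞) p =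
        Φ p * Θ (p.1 a) (p.2 a) := by
      intro p
      by_cases h1 : p ∈ (fun (p : (ℕ → O) × (ℕ → O)) (n : ℕ) => g (p.1 n) (p.2 n)) ⁻¹'
          Set.pi (s : Set ℕ) t
      · rw [hΦ, Set.indicator_of_mem h1, Pi.one_apply, one_mul]
        refine indicator_one_congr ⟨fun h => h a (by simp), fun h i hi => ?_⟩
        rcases Finset.mem_insert.1 hi with rfl | hi
        exacts [h, h1 i hi]
      · rw [hΦ, Set.indicator_of_notMem h1, zero_mul, Set.indicator_of_notMem]
        exact fun h => h1 fun i hi => h i (by simp [Finset.mem_coe.1 hi])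
    have hupd : ∀ (p q : ℕ → O) (o o' : O),
        Φ (Function.update p a o, Function.update q a o') = Φ (p, q) := by
      intro p q o o'
      refine indicator_one_congr (forall₂_congr fun i hi => ?_)
      have : i ≠ a := by rintro rfl; exact ha hi
      simp [Function.update_of_ne this]
    have hΘμ : ∫⁻ o, ∫⁻ o', Θ o o' ∂μ ∂μ = μ (t a) := by
      have := lintegral_prod (μ := μ) (ν := μ) (Function.uncurry Θ) mΘ.aemeasurable
      simp only [Function.uncurry_apply_pair] at this
      rw [← this, ← lintegral_indicator_one (ht a)]
      conv_rhs => rw [← hμ]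
      rw [lintegral_map (measurable_one.indicator (ht a)) hg]
      rfl
    rw [← lintegral_indicator_one (hm (hs _)), ← lintegral_indicator_one (hm (hs _))]
    rw [lintegral_congr key]
    have e1 : Measurable fun p : (ℕ → O) × (ℕ → O) => Φ p * Θ (p.1 a) (p.2 a) :=
      mΦ.mul (mΘ.comp (f := fun p : (ℕ → O) × (ℕ → O) => (p.1 a, p.2 a)) (((measurable_pi_apply a).comp measurable_fst).prodMk
        ((measurable_pi_apply a).comp measurable_snd)))
    rw [lintegral_prod _ e1.aemeasurable, lintegral_prod _ mΦ.aemeasurable]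
    have e2 : ∀ p : ℕ → O, ∫⁻ q, Φ (p, q) * Θ (p a) (q a) ∂Q =
        (∫⁻ q, Φ (p, q) ∂Q) * ∫⁻ o', Θ (p a) o' ∂μ := by
      intro p
      have m1 : Measurable fun q => Φ (p, q) := mΦ.comp measurable_prodMk_left
      rw [hQ, lintegral_eval (fun _ => μ) a (Φ := fun q o' => Φ (p, q) * Θ (p a) o')]
      · have m2 : Measurable fun o' => Θ (p a) o' := mΘ.comp measurable_prodMk_left
        simp_rw [lintegral_const_mul _ m2]
        rw [lintegral_mul_const _ m1]
      · exact (m1.comp measurable_fst).mul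
          (mΘ.comp (measurable_const.prodMk measurable_snd))
      · intro q o o'
        have := hupd p q (p a) o
        rw [Function.update_eq_self] at this
        rw [this]
    simp_rw [e2]
    have m3 : Measurable fun p => ∫⁻ q, Φ (p, q) ∂Q := mΦ.lintegral_prod_right'
    have m4 : Measurable fun o => ∫⁻ o', Θ o o' ∂μ := mΘ.lintegral_prod_right'
    rw [hQ, lintegral_eval (fun _ => μ) a
      (Φ := fun p o => (∫⁻ q, Φ (p, q) ∂Q) * ∫⁻ o', Θ o o' ∂μ)]
    · simp_rw [lintegral_const_mul _ m4, hΘμ]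
      rw [lintegral_mul_const _ m3, mul_comm]
    · exact (m3.comp measurable_fst).mul (m4.comp measurable_snd)
    · intro p o o'
      congr 1
      refine lintegral_congr fun q => ?_
      have := hupd p q o (q a)
      rwa [Function.update_eq_self] at this

end Resampling

/-! ### Killed Markov chains driven by independent data -/

section Chain

variable {S O : Type*} [MeasurableSpace S] [MeasurableSpace O]

/-- The chain with transition function `step` started at `s` and driven by `ω`. -/
def chain (step : S → O → S) (s : S) (ω : ℕ → O) : ℕ → S
  | 0 => s
  | n + 1 => step (chain step s ω n) (ω n)

/-- The transition operator of the chain that is killed on leaving `good`. -/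
def killed (μ : Measure O) (step : S → O → S) (good : Set S) (f : S → ℝ≥0∞) (s : S) : ℝ≥0∞ :=
  ∫⁻ o, good.indicator f (step s o) ∂μ

/-- The expected total reward `f` of the killed chain. -/
def potential (μ : Measure O) (step : S → O → S) (good : Set S) (f : S → ℝ≥0∞) (s : S) : ℝ≥0∞ :=
  ∑' m, (killed μ step good)^[m] f s

/-- The expected reward `f` of the killed chain in the first `M` instants. -/
def partialPotential (μ : Measure O) (step : S → O → S) (good : Set S) (M : ℕ) (f : S → ℝ≥0∞)
    (s : S) : ℝ≥0∞ :=
  ∑ m ∈ Finset.range M, (killed μ step good)^[m] f s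

theorem chain_update (step : S → O → S) (s : S) (ω : ℕ → O) {N m : ℕ} (h : m ≤ N) (o : O) :
    chain step s (Function.update ω N o) m = chain step s ω m := by
  induction m with
  | zero => rfl
  | succ m ih =>
    rw [chain, chain, ih (by omega), Function.update_of_ne (by omega)]

variable {μ : Measure O} {step : S → O → S} {good : Set S} {f g : S → ℝ≥0∞}

theorem measurable_chain (hstep : Measurable (Function.uncurry step)) (s : S) (m : ℕ) :
    Measurable fun ω => chain step s ω m := by
  induction m with
  | zero => exact measurable_const
  | succ m ih => exact hstep.comp (ih.prodMk (measurable_pi_apply m))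

theorem killed_mono (h : ∀ s ∈ good, f s ≤ g s) (s : S) :
    killed μ step good f s ≤ killed μ step good g s := by
  refine lintegral_mono fun o => ?_
  by_cases hs : step s o ∈ good
  · simpa [hs] using h _ hs
  · simp [hs]

theorem killed_add (hstep : Measurable (Function.uncurry step)) (hgood : MeasurableSet good)
    (hf : Measurable f) (s : S) :
    killed μ step good (f + g) s = killed μ step good f s + killed μ step good g s := by
  rw [killed, killed, killed, ← lintegral_add_left]
  · refine lintegral_congr fun o => ?_
    rw [Set.indicator_add']; rfl
  · exact (hf.indicator hgood).comp (hstep.comp measurable_prodMk_left)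

theorem killed_zero (s : S) : killed μ step good 0 s = 0 := by
  simp [killed]

theorem measurable_killed [SFinite μ] (hstep : Measurable (Function.uncurry step))
    (hgood : MeasurableSet good) (hf : Measurable f) : Measurable (killed μ step good f) :=
  ((hf.indicator hgood).comp hstep).lintegral_prod_right'

theorem measurable_iterate_killed [SFinite μ] (hstep : Measurable (Function.uncurry step))
    (hgood : MeasurableSet good) (hf : Measurable f) (m : ℕ) :
    Measurable ((killed μ step good)^[m] f) := by
  induction m with
  | zero => exact hf
  | succ m ih =>
    rw [Function.iterate_succ_apply']
    exact measurable_killed hstep hgood ih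

theorem measurable_potential [SFinite μ] (hstep : Measurable (Function.uncurry step))
    (hgood : MeasurableSet good) (hf : Measurable f) : Measurable (potential μ step good f) :=
  Measurable.tsum fun m => measurable_iterate_killed hstep hgood hf m

theorem measurable_partialPotential [SFinite μ] (hstep : Measurable (Function.uncurry step))
    (hgood : MeasurableSet good) (hf : Measurable f) (M : ℕ) :
    Measurable (partialPotential μ step good M f) :=
  Finset.measurable_fun_sum _ fun m _ => measurable_iterate_killed hstep hgood hf m

@[simp] theorem partialPotential_zero (s : S) : partialPotential μ step good 0 f s = 0 := by
  simp [partialPotential]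

/-- First-step analysis: this recursion in the horizon drives the inductive bounds below, and it
needs no finiteness of the full potential. -/
theorem partialPotential_succ [SFinite μ] (hstep : Measurable (Function.uncurry step))
    (hgood : MeasurableSet good) (hf : Measurable f) (M : ℕ) (s : S) :
    partialPotential μ step good (M + 1) f s =
      f s + killed μ step good (partialPotential μ step good M f) s := by
  rw [partialPotential, Finset.sum_range_succ', add_comm]
  congr 1
  induction M with
  | zero =>
    rw [show partialPotential μ step good 0 f = 0 from funext partialPotential_zero, killed_zero]
    simp
  | succ M ih =>
    rw [Finset.sum_range_succ, ih, Function.iterate_succ_apply']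
    rw [← killed_add hstep hgood (measurable_partialPotential hstep hgood hf M)]
    congr 1
    ext s
    simp [partialPotential, Finset.sum_range_succ]

theorem partialPotential_mono_right {M N : ℕ} (h : M ≤ N) (s : S) :
    partialPotential μ step good M f s ≤ partialPotential μ step good N f s :=
  Finset.sum_le_sum_of_subset (Finset.range_mono h)

theorem potential_eq_iSup (s : S) :
    potential μ step good f s = ⨆ M, partialPotential μ step good M f s :=
  ENNReal.tsum_eq_iSup_nat

theorem potential_le {c : ℝ≥0∞} {s : S} (h : ∀ M, partialPotential μ step good M f s ≤ c) :
    potential μ step good f s ≤ c := by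
  rw [potential_eq_iSup]
  exact iSup_le h

theorem partialPotential_le_potential (M : ℕ) (s : S) :
    partialPotential μ step good M f s ≤ potential μ step good f s := by
  rw [potential_eq_iSup]
  exact le_iSup (fun M => partialPotential μ step good M f s) M

/-- The Poisson equation of the killed chain; sum and integral are exchanged by nonnegativity. -/
theorem potential_eq [SFinite μ] (hstep : Measurable (Function.uncurry step))
    (hgood : MeasurableSet good) (hf : Measurable f) (s : S) :
    potential μ step good f s = f s + killed μ step good (potential μ step good f) s := by
  have h1 : killed μ step good (potential μ step good f) s =
      ∑' m, killed μ step good ((killed μ step good)^[m] f) s := by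
    simp only [killed]
    rw [← lintegral_tsum]
    · refine lintegral_congr fun o => ?_
      by_cases hs : step s o ∈ good
      · simp only [hs, Set.indicator_of_mem, potential]
      · simp [hs]
    · intro m
      exact (((measurable_iterate_killed hstep hgood hf m).indicator hgood).comp
        (hstep.comp measurable_prodMk_left)).aemeasurable
  rw [h1, potential, tsum_eq_zero_add' ENNReal.summable]
  simp [Function.iterate_succ_apply']

/-- A nonnegative supersolution on a set that the killed chain does not leave dominates the
potential. -/
theorem partialPotential_le_of_super [SFinite μ] (hstep : Measurable (Function.uncurry step))
    (hgood : MeasurableSet good) (hf : Measurable f) {T : Set S} {u : S → ℝ≥0∞}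
    (hT : ∀ s ∈ T, ∀ o, step s o ∈ good → step s o ∈ T)
    (hu : ∀ s ∈ T, f s + killed μ step good u s ≤ u s) (M : ℕ) :
    ∀ s ∈ T, partialPotential μ step good M f s ≤ u s := by
  induction M with
  | zero => simp
  | succ M ih =>
    intro s hs
    rw [partialPotential_succ hstep hgood hf]
    refine le_trans (add_le_add_right ?_ _) (hu s hs)
    refine lintegral_mono fun o => ?_
    by_cases ho : step s o ∈ good
    · simpa [ho] using ih _ (hT s hs o ho)
    · simp [ho]

/-- The Markov property at time `n`, tested against a weight `w` that ignores the data from index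
`n` on. Only the laws from `n` on have to be `μ`; earlier ones are arbitrary, as is needed when a
change occurs after time `n`. -/
theorem lintegral_chain_iterate {law : ℕ → Measure O} [∀ n, IsProbabilityMeasure (law n)]
    (hstep : Measurable (Function.uncurry step)) (hgood : MeasurableSet good)
    {n : ℕ} (hlaw : ∀ m, n ≤ m → law m = μ) {w : (ℕ → O) → ℝ≥0∞} (hw : Measurable w)
    (hwn : ∀ ω N o, n ≤ N → w (Function.update ω N o) = w ω) (s : S) (m : ℕ)
    (hf : Measurable f) :
    ∫⁻ ω, w ω * ({ω | ∀ k, n < k → k ≤ n + m → chain step s ω k ∈ good}.indicator 1 ω *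
        f (chain step s ω (n + m))) ∂Measure.infinitePi law =
      ∫⁻ ω, w ω * (killed μ step good)^[m] f (chain step s ω n) ∂Measure.infinitePi law := by
  have : SFinite μ := by rw [← hlaw n le_rfl]; infer_instance
  induction m generalizing f with
  | zero =>
    refine lintegral_congr fun ω => ?_
    have : ω ∈ {ω : ℕ → O | ∀ k, n < k → k ≤ n + 0 → chain step s ω k ∈ good} :=
      fun k h1 h2 => absurd h2 (by omega)
    rw [Set.indicator_of_mem this]
    simp
  | succ m ih =>
    set B : ℕ → Set (ℕ → O) := fun m => {ω | ∀ k, n < k → k ≤ n + m → chain step s ω k ∈ good}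
      with hB
    have mB : ∀ m, MeasurableSet (B m) := fun m => by
      have : B m = ⋂ k, ⋂ (_ : n < k), ⋂ (_ : k ≤ n + m), (fun ω => chain step s ω k) ⁻¹' good := by
        ext ω; simp [hB]
      rw [this]
      exact MeasurableSet.iInter fun k => MeasurableSet.iInter fun _ => MeasurableSet.iInter fun _ =>
        measurable_chain hstep s k hgood
    -- Survival for one more instant is survival so far together with a last step into `good`, and
    -- the datum of that step is independent of everything else in the integrand.
    have key : ∀ ω, w ω * ((B (m + 1)).indicator 1 ω * f (chain step s ω (n + (m + 1)))) =
        w ω * ((B m).indicator 1 ω *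
          good.indicator f (step (chain step s ω (n + m)) (ω (n + m)))) := by
      intro ω
      congr 1
      have hch : chain step s ω (n + (m + 1)) = step (chain step s ω (n + m)) (ω (n + m)) := rfl
      by_cases h1 : ω ∈ B m
      · by_cases h2 : chain step s ω (n + (m + 1)) ∈ good
        · have : ω ∈ B (m + 1) := by
            intro k hk hk'
            rcases Nat.lt_or_ge k (n + (m + 1)) with h | h
            · exact h1 k hk (by omega)
            · obtain rfl : k = n + (m + 1) := by omega
              exact h2
          rw [← hch]
          simp [h1, h2, this]
        · have : ω ∉ B (m + 1) := fun h => h2 (h _ (by omega) le_rfl)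
          rw [← hch]
          simp [h2, this]
      · have : ω ∉ B (m + 1) := fun h => h1 fun k hk hk' => h k hk (by omega)
        simp [h1, this]
    have hBu : ∀ ω o, (B m).indicator (1 : (ℕ → O) → ℝ≥0∞) (Function.update ω (n + m) o) =
        (B m).indicator 1 ω := by
      intro ω o
      have : Function.update ω (n + m) o ∈ B m ↔ ω ∈ B m := by
        simp only [hB, Set.mem_ofPred_eq]
        refine forall_congr' fun k => forall_congr' fun _ => forall_congr' fun hk => ?_
        rw [chain_update step s ω hk]
      exact indicator_one_congr this
    calc _ = ∫⁻ ω, w ω * ((B m).indicator 1 ω *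
          good.indicator f (step (chain step s ω (n + m)) (ω (n + m)))) ∂Measure.infinitePi law :=
          lintegral_congr key
      _ = ∫⁻ ω, ∫⁻ o, w ω * ((B m).indicator 1 ω *
          good.indicator f (step (chain step s ω (n + m)) o)) ∂law (n + m)
            ∂Measure.infinitePi law := by
          refine lintegral_eval law (n + m) (Φ := fun ω o => w ω * ((B m).indicator 1 ω *
            good.indicator f (step (chain step s ω (n + m)) o))) ?_ ?_
          · refine (hw.comp measurable_fst).mul (((measurable_one.indicator (mB m)).comp
              measurable_fst).mul ((hf.indicator hgood).comp (hstep.comp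
                (((measurable_chain hstep s _).comp measurable_fst).prodMk measurable_snd))))
          · intro ω o o'
            simp only [hwn ω _ o (Nat.le_add_right n m), hBu, chain_update step s ω le_rfl]
      _ = ∫⁻ ω, w ω * ((B m).indicator 1 ω * killed μ step good f (chain step s ω (n + m)))
            ∂Measure.infinitePi law := by
          refine lintegral_congr fun ω => ?_
          have hmeas : Measurable fun o => good.indicator f (step (chain step s ω (n + m)) o) :=
            (hf.indicator hgood).comp (hstep.comp measurable_prodMk_left)
          rw [lintegral_const_mul _ (hmeas.const_mul _), lintegral_const_mul _ hmeas,
            hlaw _ (Nat.le_add_right n m)]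
          rfl
      _ = _ := by
          rw [ih (measurable_killed hstep hgood hf)]
          rfl

theorem lintegral_chain_iterate_zero [IsProbabilityMeasure μ]
    (hstep : Measurable (Function.uncurry step)) (hgood : MeasurableSet good) (s : S) (m : ℕ)
    (hf : Measurable f) :
    ∫⁻ ω, {ω | ∀ k, 1 ≤ k → k ≤ m → chain step s ω k ∈ good}.indicator 1 ω *
        f (chain step s ω m) ∂Measure.infinitePi (fun _ => μ) =
      (killed μ step good)^[m] f s := by
  have := lintegral_chain_iterate (law := fun _ => μ) (μ := μ) hstep hgood (n := 0)
    (fun _ _ => rfl) (w := 1) measurable_one (fun _ _ _ _ => rfl) s m hf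
  simp only [zero_add, Pi.one_apply, one_mul, Nat.lt_iff_add_one_le] at this
  simpa [chain] using this

/-- The law of the next state of the chain. -/
theorem lintegral_chain_succ [IsProbabilityMeasure μ]
    (hstep : Measurable (Function.uncurry step)) (s : S) (m : ℕ)
    (hf : Measurable f) :
    ∫⁻ ω, f (chain step s ω (m + 1)) ∂Measure.infinitePi (fun _ => μ) =
      ∫⁻ ω, ∫⁻ o, f (step (chain step s ω m) o) ∂μ ∂Measure.infinitePi (fun _ => μ) := by
  refine lintegral_eval (fun _ => μ) m (Φ := fun ω o => f (step (chain step s ω m) o)) ?_ ?_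
  · exact hf.comp (hstep.comp
      (((measurable_chain hstep s _).comp measurable_fst).prodMk measurable_snd))
  · intro ω o o'
    simp only [chain_update step s ω le_rfl]

end Chain

/-! ### First times -/

/-- The layer-cake sum $\tau=\sum_m \mathbf 1\{\tau>m\}$, valid also for $\tau=\infty$; it turns
mean times into potentials. -/
theorem firstTime_eq_tsum (p : ℕ → Prop) :
    ((firstTime p : ℕ∞) : ℝ≥0∞) =
      ∑' m : ℕ, {m | ∀ k, 1 ≤ k → k ≤ m → ¬ p k}.indicator (1 : ℕ → ℝ≥0∞) m := by
  classical
  by_cases h : ∃ n, 1 ≤ n ∧ p n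
  · set N := Nat.find h with hN
    have hf : firstTime p = (N : ℕ∞) := by
      refine le_antisymm (iInf₂_le N (Nat.find_spec h)) (le_iInf₂ fun n hn => ?_)
      exact_mod_cast Nat.find_min' h hn
    have hs : {m | ∀ k, 1 ≤ k → k ≤ m → ¬ p k} = (Finset.range N : Set ℕ) := by
      ext m
      simp only [Set.mem_ofPred_eq, Finset.coe_range, Set.mem_Iio]
      constructor
      · intro hm
        by_contra hc
        exact hm N (Nat.find_spec h).1 (not_lt.mp hc) (Nat.find_spec h).2
      · intro hm k hk hk' hp
        exact absurd (Nat.find_min' h ⟨hk, hp⟩) (by omega)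
    rw [hf, hs, ← tsum_subtype (Finset.range N : Set ℕ) (1 : ℕ → ℝ≥0∞)]
    rw [Finset.tsum_subtype' (Finset.range N) (1 : ℕ → ℝ≥0∞)]
    simp
  · push Not at h
    have hf : firstTime p = ⊤ := by
      refine iInf₂_eq_top.mpr fun n hn => absurd hn.2 (h n hn.1)
    have hs : {m | ∀ k, 1 ≤ k → k ≤ m → ¬ p k} = Set.univ := by
      ext m; simpa using fun k hk _ => h k hk
    rw [hf, hs]
    simp

/-! ### Likelihood ratios -/

namespace Experiment

variable {𝓧 : Type*} [MeasurableSpace 𝓧] (E : Experiment 𝓧)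

theorem measurable_llr : Measurable E.llr :=
  ((E.measurable_f₁.coe_nnreal_ennreal).div (E.measurable_f₀.coe_nnreal_ennreal)).ennreal_log

theorem exp_llr (x : 𝓧) : (E.llr x).exp = (E.f₁ x : ℝ≥0∞) / (E.f₀ x : ℝ≥0∞) :=
  ENNReal.exp_log _

theorem lintegral_pre {g : 𝓧 → ℝ≥0∞} (hg : Measurable g) :
    ∫⁻ x, g x ∂E.pre = ∫⁻ x, (E.f₀ x : ℝ≥0∞) * g x ∂E.ref :=
  lintegral_withDensity_eq_lintegral_mul _ E.measurable_f₀.coe_nnreal_ennreal hg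

theorem lintegral_post {g : 𝓧 → ℝ≥0∞} (hg : Measurable g) :
    ∫⁻ x, g x ∂E.post = ∫⁻ x, (E.f₁ x : ℝ≥0∞) * g x ∂E.ref :=
  lintegral_withDensity_eq_lintegral_mul _ E.measurable_f₁.coe_nnreal_ennreal hg

/-- The Hellinger affinity `∫ √(f₀ f₁)`. -/
def affinity : ℝ≥0∞ := ∫⁻ x, (NNReal.sqrt (E.f₀ x * E.f₁ x) : ℝ≥0∞) ∂E.ref

theorem measurable_exp_llr : Measurable fun x => (E.llr x).exp := E.measurable_llr.ereal_exp

/-- Equality can fail: the part of $f_1$ carried by $\{f_0=0\}$ is lost. The inequality is all that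
the false alarm bound needs. -/
theorem lintegral_exp_llr_pre_le : ∫⁻ x, (E.llr x).exp ∂E.pre ≤ 1 := by
  rw [E.lintegral_pre E.measurable_exp_llr, ← E.lintegral_f₁]
  refine lintegral_mono fun x => ?_
  rw [exp_llr]
  exact ENNReal.mul_div_le

theorem coe_sqrt_mul (a b : ℝ≥0) :
    (NNReal.sqrt (a * b) : ℝ≥0∞) = (a : ℝ≥0∞) ^ (1 / 2 : ℝ) * (b : ℝ≥0∞) ^ (1 / 2 : ℝ) := by
  rw [← ENNReal.coe_rpow_of_nonneg _ (by norm_num), ← ENNReal.coe_rpow_of_nonneg _ (by norm_num),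
    ← ENNReal.coe_mul, NNReal.sqrt_mul, NNReal.sqrt_eq_rpow, NNReal.sqrt_eq_rpow]

theorem mul_div_rpow_half (a b : ℝ≥0) :
    (a : ℝ≥0∞) * ((b : ℝ≥0∞) / a) ^ (1 / 2 : ℝ) = (a : ℝ≥0∞) ^ (1 / 2 : ℝ) *
      (b : ℝ≥0∞) ^ (1 / 2 : ℝ) := by
  by_cases h0 : a = 0
  · simp [h0]
  · have h0' : (a : ℝ≥0∞) ≠ 0 := by simpa using h0
    have h2 : (a : ℝ≥0∞) ^ (1 / 2 : ℝ) * (a : ℝ≥0∞) ^ (1 / 2 : ℝ) = a := by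
      rw [← ENNReal.rpow_add _ _ h0' ENNReal.coe_ne_top]; norm_num
    have h3 : (a : ℝ≥0∞) ^ (1 / 2 : ℝ) ≠ 0 := by simp [h0]
    have h4 : (a : ℝ≥0∞) ^ (1 / 2 : ℝ) ≠ ∞ := by simp
    rw [ENNReal.div_rpow_of_nonneg _ _ (by norm_num)]
    nth_rw 1 [← h2]
    rw [mul_assoc, ENNReal.mul_div_cancel h3 h4]

theorem lintegral_exp_llr_rpow_pre :
    ∫⁻ x, (E.llr x).exp ^ (1 / 2 : ℝ) ∂E.pre = E.affinity := by
  rw [E.lintegral_pre (E.measurable_exp_llr.pow_const _)]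
  refine lintegral_congr fun x => ?_
  rw [exp_llr, coe_sqrt_mul]
  exact mul_div_rpow_half _ _

/-- The same constant governs the walk after the change, since $f_1(f_1/f_0)^{-1/2}=\sqrt{f_0f_1}$.
Where $f_1=0$ the convention $0\cdot\infty=0$ applies. -/
theorem lintegral_exp_llr_rpow_post :
    ∫⁻ x, (E.llr x).exp ^ (-(1 / 2) : ℝ) ∂E.post = E.affinity := by
  rw [E.lintegral_post (E.measurable_exp_llr.pow_const _)]
  refine lintegral_congr fun x => ?_
  rw [exp_llr, coe_sqrt_mul]
  by_cases h1 : E.f₁ x = 0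
  · simp [h1]
  · rw [ENNReal.rpow_neg, ← ENNReal.inv_rpow, ENNReal.inv_div (Or.inl (by simp))
      (Or.inr (by simpa using h1)), mul_div_rpow_half, mul_comm]

/-- Pointwise $\sqrt{f_0f_1}\le(f_0+f_1)/2$, and the right side integrates to $1$. Equality of the
integrals forces equality almost everywhere, hence $f_0=f_1$ and zero divergence. -/
theorem affinity_lt_one (h : 0 < E.kl) : E.affinity < 1 := by
  have h1 : ∀ x, (NNReal.sqrt (E.f₀ x * E.f₁ x) : ℝ≥0∞) ≤ ((E.f₀ x + E.f₁ x) / 2 : ℝ≥0) := by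
    intro x
    refine ENNReal.coe_le_coe.2 ?_
    rw [NNReal.sqrt_le_iff_le_sq, ← NNReal.coe_le_coe]
    push_cast
    nlinarith [sq_nonneg ((E.f₀ x : ℝ) - E.f₁ x)]
  have h2 : ∫⁻ x, (((E.f₀ x + E.f₁ x) / 2 : ℝ≥0) : ℝ≥0∞) ∂E.ref = 1 := by
    have : ∀ x, (((E.f₀ x + E.f₁ x) / 2 : ℝ≥0) : ℝ≥0∞) =
        ((E.f₀ x : ℝ≥0∞) + (E.f₁ x : ℝ≥0∞)) * 2⁻¹ := by
      intro x
      rw [ENNReal.coe_div (by norm_num), ENNReal.coe_add, div_eq_mul_inv]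
      rfl
    simp_rw [this]
    have hadd : Measurable fun x => (E.f₀ x : ℝ≥0∞) + (E.f₁ x : ℝ≥0∞) :=
      E.measurable_f₀.coe_nnreal_ennreal.add E.measurable_f₁.coe_nnreal_ennreal
    rw [lintegral_mul_const _ hadd, lintegral_add_left E.measurable_f₀.coe_nnreal_ennreal,
      E.lintegral_f₀, E.lintegral_f₁, one_add_one_eq_two]
    exact ENNReal.mul_inv_cancel (by norm_num) (by norm_num)
  have hle : E.affinity ≤ 1 := (lintegral_mono h1).trans h2.le
  refine lt_of_le_of_ne hle fun heq => h.ne' ?_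
  have hae := ae_eq_of_ae_le_of_lintegral_le (ae_of_all E.ref h1)
    (by rw [show ∫⁻ x, (NNReal.sqrt (E.f₀ x * E.f₁ x) : ℝ≥0∞) ∂E.ref = 1 from heq]; simp)
    (((E.measurable_f₀.add E.measurable_f₁).div_const 2).coe_nnreal_ennreal.aemeasurable)
    (h2.le.trans heq.ge)
  have hff : (fun x => (E.f₁ x : ℝ≥0∞)) =ᵐ[E.ref] fun x => (E.f₀ x : ℝ≥0∞) := by
    filter_upwards [hae] with x hx
    have hx' := congrArg (fun t : ℝ≥0 => (t : ℝ) ^ 2) (ENNReal.coe_inj.1 hx)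
    simp only [Real.coe_sqrt, NNReal.coe_mul, NNReal.coe_div, NNReal.coe_add] at hx'
    rw [Real.sq_sqrt (by positivity)] at hx'
    have : ((E.f₁ x : ℝ) - E.f₀ x) ^ 2 = 0 := by push_cast at hx'; nlinarith
    have := sub_eq_zero.1 (pow_eq_zero_iff two_ne_zero |>.1 this)
    exact_mod_cast this
  rw [kl, post, withDensity_congr_ae hff]
  exact InformationTheory.klDiv_self E.pre

theorem ae_post_llr_ne_bot : ∀ᵐ x ∂E.post, E.llr x ≠ ⊥ := by
  rw [post, ae_withDensity_iff E.measurable_f₁.coe_nnreal_ennreal]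
  refine ae_of_all _ fun x hx => ?_
  rw [Ne, ← EReal.exp_eq_zero_iff, exp_llr]
  exact ENNReal.div_ne_zero.2 ⟨hx, ENNReal.coe_ne_top⟩

/-- Otherwise $e^{\ell/2}\ge1$ almost surely before the change, and the affinity would be at least
$1$. -/
theorem pre_llr_neg_pos (h : 0 < E.kl) : 0 < E.pre {x | E.llr x < 0} := by
  rw [pos_iff_ne_zero]
  intro h0
  refine (E.affinity_lt_one h).not_ge ?_
  rw [← E.lintegral_exp_llr_rpow_pre]
  have : ∀ᵐ x ∂E.pre, 1 ≤ (E.llr x).exp ^ (1 / 2 : ℝ) := by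
    have : ∀ᵐ x ∂E.pre, ¬ E.llr x < 0 := by
      rw [ae_iff]; simpa using h0
    filter_upwards [this] with x hx
    exact ENNReal.one_le_rpow (by simpa using hx) (by norm_num)
  calc (1 : ℝ≥0∞) = ∫⁻ _, 1 ∂E.pre := by simp
    _ ≤ _ := lintegral_mono_ae this

end Experiment

/-! ### Random limits -/

theorem measurable_randomLimit (N : ℝ) : Measurable (randomLimit N) := by
  unfold randomLimit
  exact Measurable.ite (measurableSet_lt measurable_subtype_coe measurable_const)
    measurable_const measurable_const

theorem randomLimit_le (N : ℝ) (u : unitInterval) : randomLimit N u ≤ ⌈N⌉₊ := by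
  unfold randomLimit
  split_ifs with h
  · have : (⌊N⌋₊ : ℝ) < N := by linarith [u.2.1]
    exact_mod_cast Nat.lt_ceil.2 this
  · exact Nat.floor_le_ceil N

theorem volume_unitInterval_lt {t : ℝ} (h0 : 0 ≤ t) (h1 : t ≤ 1) :
    volume {u : unitInterval | (u : ℝ) < t} = ENNReal.ofReal t :=
  unitInterval.volume_Iio ⟨t, h0, h1⟩

theorem lintegral_randomLimit {N : ℝ} (hN : 0 ≤ N) :
    ∫⁻ u, (randomLimit N u : ℝ≥0∞) = ENNReal.ofReal N := by
  have hf := Nat.floor_le hN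
  have hm : MeasurableSet {u : unitInterval | (u : ℝ) < N - (⌊N⌋₊ : ℝ)} :=
    measurableSet_lt measurable_subtype_coe measurable_const
  have : ∀ u, (randomLimit N u : ℝ≥0∞) = (⌊N⌋₊ : ℝ≥0∞) +
      {u : unitInterval | (u : ℝ) < N - (⌊N⌋₊ : ℝ)}.indicator 1 u := by
    intro u
    by_cases h : (u : ℝ) < N - (⌊N⌋₊ : ℝ) <;> simp [randomLimit, h]
  simp_rw [this]
  rw [lintegral_add_left measurable_const, lintegral_indicator_one hm,
    volume_unitInterval_lt (by linarith) (by linarith [Nat.lt_floor_add_one N])]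
  simp only [lintegral_const, measure_univ, mul_one]
  rw [← ENNReal.ofReal_natCast, ← ENNReal.ofReal_add (by positivity) (by linarith)]
  congr 1; ring

/-! ### Measurable structure of the states -/

/-- The coordinates of a state. -/
def TwoE.coord : TwoE → ℕ × EReal × EReal × ℕ × ℕ
  | .onY w k => (0, w, 0, 0, k)
  | .onX v u j k => (1, v, u, j, k)
  | .done => (2, 0, 0, 0, 0)

instance : MeasurableSpace TwoE := MeasurableSpace.comap TwoE.coord inferInstance

theorem TwoE.measurable_coord : Measurable TwoE.coord := comap_measurable _

theorem TwoE.measurable_iff {β : Type*} [MeasurableSpace β] {t : β → TwoE} :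
    Measurable t ↔ Measurable fun b => (t b).coord :=
  measurable_comap_iff

section
variable {α β : Type*} [MeasurableSpace α] [MeasurableSpace β]

theorem TwoE.measurable_onY {w : β → EReal} {k : β → ℕ} (hw : Measurable w) (hk : Measurable k) :
    Measurable fun b => TwoE.onY (w b) (k b) :=
  TwoE.measurable_iff.2 (measurable_const.prodMk (hw.prodMk (measurable_const.prodMk
    (measurable_const.prodMk hk))))

theorem TwoE.measurable_onX {v u : β → EReal} {j k : β → ℕ} (hv : Measurable v)
    (hu : Measurable u) (hj : Measurable j) (hk : Measurable k) :
    Measurable fun b => TwoE.onX (v b) (u b) (j b) (k b) :=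
  TwoE.measurable_iff.2 (measurable_const.prodMk (hv.prodMk (hu.prodMk (hj.prodMk hk))))

/-- States carry the σ-algebra pulled back from their coordinates, so a function defined by cases on
the state is measurable as soon as each case is. -/
theorem TwoE.measurable_elim {t : β → TwoE} (ht : Measurable t) {F : β → TwoE → α}
    (hY : Measurable fun p : β × EReal × ℕ => F p.1 (.onY p.2.1 p.2.2))
    (hX : Measurable fun p : β × EReal × EReal × ℕ × ℕ =>
      F p.1 (.onX p.2.1 p.2.2.1 p.2.2.2.1 p.2.2.2.2))
    (hd : Measurable fun b => F b .done) : Measurable fun b => F b (t b) := by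
  have hc : Measurable fun b => (t b).coord := TwoE.measurable_coord.comp ht
  have hYc : Measurable fun b => F b (.onY (t b).coord.2.1 (t b).coord.2.2.2.2) :=
    hY.comp (measurable_id.prodMk (hc.snd.fst.prodMk hc.snd.snd.snd.snd))
  have hXc : Measurable fun b => F b (.onX (t b).coord.2.1 (t b).coord.2.2.1
      (t b).coord.2.2.2.1 (t b).coord.2.2.2.2) :=
    hX.comp (measurable_id.prodMk hc.snd)
  have h0 : MeasurableSet {b | (t b).coord.1 = 0} := hc.fst (measurableSet_singleton 0)
  have h1 : MeasurableSet {b | (t b).coord.1 = 1} := hc.fst (measurableSet_singleton 1)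
  have : Measurable fun b => if (t b).coord.1 = 0 then F b (.onY (t b).coord.2.1 (t b).coord.2.2.2.2)
      else if (t b).coord.1 = 1 then F b (.onX (t b).coord.2.1 (t b).coord.2.2.1
        (t b).coord.2.2.2.1 (t b).coord.2.2.2.2) else F b .done := Measurable.ite h0 hYc (Measurable.ite h1 hXc hd)
  convert this using 2 with b
  cases t b <;> simp [TwoE.coord]

/-- The coordinates of a state. -/
def ThreeE.coord : ThreeE → Bool × EReal × TwoE
  | .onZ d => (true, d, .done)
  | .below h s => (false, h, s)

instance : MeasurableSpace ThreeE := MeasurableSpace.comap ThreeE.coord inferInstance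

theorem ThreeE.measurable_coord : Measurable ThreeE.coord := comap_measurable _

theorem ThreeE.measurable_iff {t : β → ThreeE} :
    Measurable t ↔ Measurable fun b => (t b).coord :=
  measurable_comap_iff

theorem ThreeE.measurable_onZ : Measurable ThreeE.onZ :=
  ThreeE.measurable_iff.2 (measurable_const.prodMk (measurable_id.prodMk measurable_const))

theorem ThreeE.measurable_below {h : β → EReal} {s : β → TwoE} (hh : Measurable h)
    (hs : Measurable s) : Measurable fun b => ThreeE.below (h b) (s b) :=
  ThreeE.measurable_iff.2 (measurable_const.prodMk (hh.prodMk hs))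

theorem ThreeE.measurable_elim {t : β → ThreeE} (ht : Measurable t) {F : β → ThreeE → α}
    (hZ : Measurable fun p : β × EReal => F p.1 (.onZ p.2))
    (hb : Measurable fun p : β × EReal × TwoE => F p.1 (.below p.2.1 p.2.2)) :
    Measurable fun b => F b (t b) := by
  have hc : Measurable fun b => (t b).coord := ThreeE.measurable_coord.comp ht
  have hZc : Measurable fun b => F b (.onZ (t b).coord.2.1) :=
    hZ.comp (measurable_id.prodMk hc.snd.fst)
  have hbc : Measurable fun b => F b (.below (t b).coord.2.1 (t b).coord.2.2) :=
    hb.comp (measurable_id.prodMk hc.snd)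
  have h0 : MeasurableSet {b | (t b).coord.1 = true} := hc.fst (measurableSet_singleton _)
  have : Measurable fun b => if (t b).coord.1 = true then F b (.onZ (t b).coord.2.1)
      else F b (.below (t b).coord.2.1 (t b).coord.2.2) := Measurable.ite h0 hZc hbc
  convert this using 2 with b
  cases t b <;> simp [ThreeE.coord]

theorem TwoE.measurableSet_done : MeasurableSet {s : TwoE | s = .done} := by
  have : {s : TwoE | s = .done} = {s : TwoE | s.coord.1 = 2} := by
    ext s; cases s <;> simp [TwoE.coord]
  rw [this]
  exact TwoE.measurable_coord.fst (measurableSet_singleton 2)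

theorem measurable_start : Measurable TwoE.start := measurable_from_nat

theorem ThreeE.measurable_resume {h : β → EReal} {s : β → TwoE} (hh : Measurable h)
    (hs : Measurable s) : Measurable fun b => ThreeE.resume (h b) (s b) := by
  classical
  have : (fun b => ThreeE.resume (h b) (s b)) = fun b =>
      if s b = .done then ThreeE.onZ 0 else ThreeE.below (h b) (s b) := by
    ext b; cases hb : s b <;> simp [ThreeE.resume]
  rw [this]
  exact Measurable.ite (hs TwoE.measurableSet_done) measurable_const
    (ThreeE.measurable_below hh hs)

end

/-! ### Measurability of the transition functions -/

section Steps

variable {𝓧 𝓨 𝓩 : Type*} [MeasurableSpace 𝓧] [MeasurableSpace 𝓨] [MeasurableSpace 𝓩]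
variable (EX : Experiment 𝓧) (EY : Experiment 𝓨) (EZ : Experiment 𝓩) (aY aZ NX NY : ℝ)

theorem measurable_twoE_step {β : Type*} [MeasurableSpace β] {h : β → EReal} {s : β → TwoE}
    {o : β → Datum 𝓧 𝓨 𝓩} (hh : Measurable h) (hs : Measurable s) (ho : Measurable o) :
    Measurable fun b => (s b).step EX EY aY NX (h b) (o b) := by
  have mX := EX.measurable_llr
  have mY := EY.measurable_llr
  have mr := measurable_randomLimit NX
  refine TwoE.measurable_elim (F := fun b s => s.step EX EY aY NX (h b) (o b)) hs ?_ ?_ ?_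
  · simp only [TwoE.step]
    have m1 : Measurable fun p : β × EReal × ℕ => p.2.1 + EY.llr (o p.1).2.1 := by fun_prop
    have m2 : Measurable fun p : β × EReal × ℕ => randomLimit NX (o p.1).2.2.2.1 := by fun_prop
    have m3 : Measurable fun p : β × EReal × ℕ => p.2.2 - 1 :=
      (measurable_from_nat (f := fun k => k - 1)).comp measurable_snd.snd
    refine Measurable.ite ?_ measurable_const (Measurable.ite ?_ (Measurable.ite ?_ ?_ ?_) ?_)
    · exact (measurableSet_lt (hh.comp measurable_fst) m1).union
        (measurable_snd.snd (measurableSet_Iic (a := 1)))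
    · exact measurableSet_lt m1 measurable_const
    · exact m2 (measurableSet_singleton 0)
    · exact TwoE.measurable_onY measurable_const m3
    · exact TwoE.measurable_onX measurable_const (measurable_const.mul m1).neg m2 m3
    · exact TwoE.measurable_onY m1 m3
  · simp only [TwoE.step]
    have m1 : Measurable fun p : β × EReal × EReal × ℕ × ℕ =>
        max (p.2.1 + EX.llr (o p.1).1) 0 := by fun_prop
    refine Measurable.ite ?_ ?_ ?_
    · exact (measurableSet_lt measurable_snd.snd.fst m1).union
        (measurable_snd.snd.snd.fst (measurableSet_Iic (a := 1)))
    · exact TwoE.measurable_onY measurable_const measurable_snd.snd.snd.snd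
    · exact TwoE.measurable_onX m1 measurable_snd.snd.fst
        ((measurable_from_nat (f := fun k => k - 1)).comp measurable_snd.snd.snd.fst)
        measurable_snd.snd.snd.snd
  · simpa only [TwoE.step] using measurable_const

theorem measurable_threeE_step :
    Measurable (Function.uncurry fun (s : ThreeE) (o : Datum 𝓧 𝓨 𝓩) =>
      s.step EX EY EZ aY aZ NX NY o) := by
  have mZ := EZ.measurable_llr
  have mr := measurable_randomLimit NY
  refine ThreeE.measurable_elim (t := Prod.fst) measurable_fst
    (F := fun (p : ThreeE × Datum 𝓧 𝓨 𝓩) s => s.step EX EY EZ aY aZ NX NY p.2) ?_ ?_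
  · simp only [ThreeE.step]
    have m1 : Measurable fun p : (ThreeE × Datum 𝓧 𝓨 𝓩) × EReal =>
      p.2 + EZ.llr p.1.2.2.2.1 := by fun_prop
    refine Measurable.ite (measurableSet_lt m1 measurable_const) ?_
      (ThreeE.measurable_onZ.comp m1)
    exact ThreeE.measurable_resume (measurable_const.mul m1).neg
      (measurable_start.comp (by fun_prop))
  · simp only [ThreeE.step]
    exact ThreeE.measurable_resume measurable_snd.fst (measurable_twoE_step EX EY aY NX
      measurable_snd.fst measurable_snd.snd measurable_fst.snd)

end Steps

/-! ### First exit times of a chain -/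

section Exit

variable {S O : Type*} [MeasurableSpace S] [MeasurableSpace O]
  {μ : Measure O} {step : S → O → S} {good : Set S}

theorem measurableSet_stay (hstep : Measurable (Function.uncurry step))
    (hgood : MeasurableSet good) (s : S) (n m : ℕ) :
    MeasurableSet {ω | ∀ k, n < k → k ≤ n + m → chain step s ω k ∈ good} := by
  have : {ω | ∀ k, n < k → k ≤ n + m → chain step s ω k ∈ good} =
      ⋂ k, ⋂ (_ : n < k), ⋂ (_ : k ≤ n + m), (fun ω => chain step s ω k) ⁻¹' good := by
    ext ω; simp
  rw [this]
  exact MeasurableSet.iInter fun k => MeasurableSet.iInter fun _ => MeasurableSet.iInter fun _ =>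
    measurable_chain hstep s k hgood

/-- The Markov property at time `n`, for the time spent until the exit from `good`. -/
theorem lintegral_chain_tsum {law : ℕ → Measure O} [∀ n, IsProbabilityMeasure (law n)]
    (hstep : Measurable (Function.uncurry step)) (hgood : MeasurableSet good)
    {n : ℕ} (hlaw : ∀ m, n ≤ m → law m = μ) {w : (ℕ → O) → ℝ≥0∞} (hw : Measurable w)
    (hwn : ∀ ω N o, n ≤ N → w (Function.update ω N o) = w ω) (s : S) :
    ∫⁻ ω, w ω * ∑' m, {ω | ∀ k, n < k → k ≤ n + m → chain step s ω k ∈ good}.indicator 1 ω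
        ∂Measure.infinitePi law =
      ∫⁻ ω, w ω * potential μ step good 1 (chain step s ω n) ∂Measure.infinitePi law := by
  have : SFinite μ := by rw [← hlaw n le_rfl]; infer_instance
  simp only [potential, ← ENNReal.tsum_mul_left]
  rw [lintegral_tsum, lintegral_tsum]
  · congr 1 with m
    rw [← lintegral_chain_iterate hstep hgood hlaw hw hwn s m measurable_one]
    simp
  · intro m
    exact (hw.mul ((measurable_iterate_killed hstep hgood measurable_one m).comp
      (measurable_chain hstep s n))).aemeasurable
  · intro m
    exact (hw.mul (measurable_one.indicator (measurableSet_stay hstep hgood s n m))).aemeasurable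

theorem firstTime_eq_tsum_indicator (s : S) (ω : ℕ → O) {p : ℕ → Prop}
    (hp : ∀ k, p k ↔ chain step s ω k ∉ good) :
    ((firstTime p : ℕ∞) : ℝ≥0∞) =
      ∑' m, {ω | ∀ k, 0 < k → k ≤ 0 + m → chain step s ω k ∈ good}.indicator 1 ω := by
  rw [firstTime_eq_tsum]
  congr 1 with m
  have h : (m ∈ {m | ∀ k, 1 ≤ k → k ≤ m → ¬ p k}) ↔
      ω ∈ {ω | ∀ k, 0 < k → k ≤ 0 + m → chain step s ω k ∈ good} := by
    simp only [Set.mem_ofPred_eq, hp, not_not, zero_add]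
    rfl
  exact indicator_one_congr h

theorem lintegral_firstTime_chain [IsProbabilityMeasure μ]
    (hstep : Measurable (Function.uncurry step)) (hgood : MeasurableSet good) (s : S)
    {p : (ℕ → O) → ℕ → Prop} (hp : ∀ ω k, p ω k ↔ chain step s ω k ∉ good) :
    ∫⁻ ω, (firstTime (p ω) : ℝ≥0∞) ∂Measure.infinitePi (fun _ => μ) =
      potential μ step good 1 s := by
  have := lintegral_chain_tsum (law := fun _ => μ) (μ := μ) hstep hgood (n := 0)
    (fun _ _ => rfl) (w := 1) measurable_one (fun _ _ _ _ => rfl) s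
  simp only [Pi.one_apply, one_mul] at this
  rw [lintegral_congr fun ω => firstTime_eq_tsum_indicator s ω (hp ω), this]
  simp [chain]

end Exit

/-! ### Marginals of the law of one instant -/

section Lift

variable {A R : Type*} [MeasurableSpace A] [MeasurableSpace R]
  {a : Measure A} {r : Measure R} [IsProbabilityMeasure a] [IsProbabilityMeasure r]

theorem measurePreserving_lift_fst {g : R → R → R}
    (hg : MeasurePreserving (Function.uncurry g) (r.prod r) r) :
    MeasurePreserving (Function.uncurry fun p q : A × R => (p.1, g p.2 q.2))
      ((a.prod r).prod (a.prod r)) (a.prod r) := by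
  have h1 := measurePreserving_prodAssoc a r (a.prod r)
  have h2 : MeasurePreserving (Prod.map id (Prod.map id Prod.snd) : A × R × (A × R) → A × R × R)
      (a.prod (r.prod (a.prod r))) (a.prod (r.prod r)) :=
    (MeasurePreserving.id a).prod ((MeasurePreserving.id r).prod measurePreserving_snd)
  have h3 := (MeasurePreserving.id a).prod hg
  exact h3.comp (h2.comp h1)

theorem measurePreserving_lift_snd {g : R → R → R}
    (hg : MeasurePreserving (Function.uncurry g) (r.prod r) r) :
    MeasurePreserving (Function.uncurry fun p q : A × R => (q.1, g p.2 q.2))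
      ((a.prod r).prod (a.prod r)) (a.prod r) := by
  have h1 : MeasurePreserving (Function.uncurry fun p q : R => g q p) (r.prod r) r :=
    hg.comp Measure.measurePreserving_swap
  exact (measurePreserving_lift_fst (a := a) h1).comp Measure.measurePreserving_swap

end Lift

section Laws

variable {𝓧 𝓨 𝓩 : Type*} [MeasurableSpace 𝓧] [MeasurableSpace 𝓨] [MeasurableSpace 𝓩]

/-- The law of the data of one instant if the three observations have laws `α`, `β`, `γ`. -/
def jointLaw (α : Measure 𝓧) (β : Measure 𝓨) (γ : Measure 𝓩) : Measure (Datum 𝓧 𝓨 𝓩) :=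
  α.prod (β.prod (γ.prod (volume.prod volume)))

variable (α : Measure 𝓧) (β : Measure 𝓨) (γ : Measure 𝓩)
  [IsProbabilityMeasure α] [IsProbabilityMeasure β] [IsProbabilityMeasure γ]

instance : IsProbabilityMeasure (jointLaw α β γ) := by
  unfold jointLaw; infer_instance

theorem measurePreserving_obsX : MeasurePreserving (fun o : Datum 𝓧 𝓨 𝓩 => o.1)
    (jointLaw α β γ) α := measurePreserving_fst

theorem measurePreserving_obsY : MeasurePreserving (fun o : Datum 𝓧 𝓨 𝓩 => o.2.1)
    (jointLaw α β γ) β := measurePreserving_fst.comp measurePreserving_snd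

theorem measurePreserving_obsZ : MeasurePreserving (fun o : Datum 𝓧 𝓨 𝓩 => o.2.2.1)
    (jointLaw α β γ) γ :=
  measurePreserving_fst.comp (measurePreserving_snd.comp measurePreserving_snd)

theorem measurePreserving_uniforms : MeasurePreserving (fun o : Datum 𝓧 𝓨 𝓩 => o.2.2.2)
    (jointLaw α β γ) (volume.prod volume) :=
  measurePreserving_snd.comp (measurePreserving_snd.comp measurePreserving_snd)

theorem measurePreserving_obsZ_uniform :
    MeasurePreserving (fun o : Datum 𝓧 𝓨 𝓩 => (o.2.2.1, o.2.2.2.2))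
      (jointLaw α β γ) (γ.prod volume) :=
  ((MeasurePreserving.id γ).prod measurePreserving_snd).comp
    (measurePreserving_snd.comp measurePreserving_snd)

theorem lintegral_obsX {g : 𝓧 → ℝ≥0∞} (hg : Measurable g) :
    ∫⁻ o : Datum 𝓧 𝓨 𝓩, g o.1 ∂jointLaw α β γ = ∫⁻ x, g x ∂α :=
  (measurePreserving_obsX α β γ).lintegral_comp hg

theorem lintegral_obsY {g : 𝓨 → ℝ≥0∞} (hg : Measurable g) :
    ∫⁻ o : Datum 𝓧 𝓨 𝓩, g o.2.1 ∂jointLaw α β γ = ∫⁻ x, g x ∂β :=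
  (measurePreserving_obsY α β γ).lintegral_comp hg

theorem lintegral_obsZ {g : 𝓩 → ℝ≥0∞} (hg : Measurable g) :
    ∫⁻ o : Datum 𝓧 𝓨 𝓩, g o.2.2.1 ∂jointLaw α β γ = ∫⁻ x, g x ∂γ :=
  (measurePreserving_obsZ α β γ).lintegral_comp hg

theorem lintegral_obsZ_uniform {g : 𝓩 → unitInterval → ℝ≥0∞}
    (hg : Measurable (Function.uncurry g)) :
    ∫⁻ o : Datum 𝓧 𝓨 𝓩, g o.2.2.1 o.2.2.2.2 ∂jointLaw α β γ = ∫⁻ z, (∫⁻ v, g z v) ∂γ := by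
  have := (measurePreserving_obsZ_uniform α β γ).lintegral_comp hg
  simp only [Function.uncurry_apply_pair] at this
  rw [this, lintegral_prod _ hg.aemeasurable]
  rfl

theorem lintegral_limitX {N : ℝ} (hN : 0 ≤ N) :
    ∫⁻ o : Datum 𝓧 𝓨 𝓩, (randomLimit N o.2.2.2.1 : ℝ≥0∞) ∂jointLaw α β γ =
      ENNReal.ofReal N := by
  have mr : Measurable fun u => (randomLimit N u : ℝ≥0∞) :=
    (measurable_from_nat (f := fun n : ℕ => (n : ℝ≥0∞))).comp (measurable_randomLimit N)
  have := ((measurePreserving_fst (μ := (volume : Measure unitInterval))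
    (ν := (volume : Measure unitInterval))).comp
      (measurePreserving_uniforms α β γ)).lintegral_comp mr
  rw [← lintegral_randomLimit hN, ← this]
  rfl

theorem lintegral_limitY {N : ℝ} (hN : 0 ≤ N) :
    ∫⁻ o : Datum 𝓧 𝓨 𝓩, (randomLimit N o.2.2.2.2 : ℝ≥0∞) ∂jointLaw α β γ =
      ENNReal.ofReal N := by
  have mr : Measurable fun u => (randomLimit N u : ℝ≥0∞) :=
    (measurable_from_nat (f := fun n : ℕ => (n : ℝ≥0∞))).comp (measurable_randomLimit N)
  have := ((measurePreserving_snd (μ := (volume : Measure unitInterval))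
    (ν := (volume : Measure unitInterval))).comp
      (measurePreserving_uniforms α β γ)).lintegral_comp mr
  rw [← lintegral_randomLimit hN, ← this]
  rfl

/-- The uniform variables are integrated out first. -/
theorem lintegral_le_of_uniforms {Φ : Datum 𝓧 𝓨 𝓩 → ℝ≥0∞} (hΦ : Measurable Φ)
    {b : Datum 𝓧 𝓨 𝓩 → ℝ≥0∞} (hb : Measurable b)
    (hbu : ∀ x y z q q', b (x, y, z, q) = b (x, y, z, q'))
    (h : ∀ x y z, (∫⁻ q, Φ (x, y, z, q)) ≤ b (x, y, z, 0, 0)) :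
    ∫⁻ o, Φ o ∂jointLaw α β γ ≤ ∫⁻ o, b o ∂jointLaw α β γ := by
  unfold jointLaw
  rw [lintegral_prod _ hΦ.aemeasurable, lintegral_prod _ hb.aemeasurable]
  refine lintegral_mono fun x => ?_
  have hΦx := hΦ.comp (measurable_prodMk_left (x := x))
  have hbx := hb.comp (measurable_prodMk_left (x := x))
  rw [lintegral_prod (fun p => Φ (x, p)) hΦx.aemeasurable,
    lintegral_prod (fun p => b (x, p)) hbx.aemeasurable]
  refine lintegral_mono fun y => ?_
  have hΦy := hΦx.comp (measurable_prodMk_left (x := y))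
  have hby := hbx.comp (measurable_prodMk_left (x := y))
  rw [lintegral_prod (fun p => Φ (x, y, p)) hΦy.aemeasurable,
    lintegral_prod (fun p => b (x, y, p)) hby.aemeasurable]
  refine lintegral_mono fun z => (h x y z).trans ?_
  simp only [hbu x y z _ (0, 0)]
  simp

/-- The observation of `Z` is taken from the first copy. -/
theorem map_combine_obsZ :
    ((jointLaw α β γ).prod (jointLaw α β γ)).map (Function.uncurry fun o o' : Datum 𝓧 𝓨 𝓩 =>
      (o'.1, o'.2.1, o.2.2.1, o'.2.2.2)) = jointLaw α β γ := by
  have h0 : MeasurePreserving (Function.uncurry fun p q : 𝓩 × unitInterval × unitInterval =>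
      (p.1, q.2)) ((γ.prod (volume.prod volume)).prod (γ.prod (volume.prod volume)))
      (γ.prod (volume.prod volume)) := measurePreserving_fst.prod measurePreserving_snd
  exact (measurePreserving_lift_snd (a := α) (measurePreserving_lift_snd (a := β) h0)).map_eq

/-- The second uniform variable is taken from the second copy. -/
theorem map_combine_uniform :
    ((jointLaw α β γ).prod (jointLaw α β γ)).map (Function.uncurry fun o o' : Datum 𝓧 𝓨 𝓩 =>
      (o.1, o.2.1, o.2.2.1, o.2.2.2.1, o'.2.2.2.2)) = jointLaw α β γ := by
  have h0 : MeasurePreserving (Function.uncurry fun p q : unitInterval × unitInterval =>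
      (p.1, q.2)) ((volume.prod volume).prod (volume.prod volume))
      (volume.prod volume) := measurePreserving_fst.prod measurePreserving_snd
  exact (measurePreserving_lift_fst (a := α) (measurePreserving_lift_fst (a := β)
    (measurePreserving_lift_fst (a := γ) h0))).map_eq

variable (EX : Experiment 𝓧) (EY : Experiment 𝓨) (EZ : Experiment 𝓩)

theorem preLaw_eq : preLaw EX EY EZ = jointLaw EX.pre EY.pre EZ.pre := rfl

theorem postLaw_eq : postLaw EX EY EZ = jointLaw EX.post EY.post EZ.post := rfl

instance : IsProbabilityMeasure (preLaw EX EY EZ) := by rw [preLaw_eq]; infer_instance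

instance : IsProbabilityMeasure (postLaw EX EY EZ) := by rw [postLaw_eq]; infer_instance

theorem P_top : P EX EY EZ ⊤ = Measure.infinitePi fun _ => preLaw EX EY EZ := by
  unfold P
  exact congrArg _ (funext fun n => if_pos (ENat.natCast_lt_top _))

theorem lawAt_of_le {ν n : ℕ} (h : ν ≤ n + 1) : lawAt EX EY EZ ν n = postLaw EX EY EZ :=
  if_neg (by rw [not_lt]; exact_mod_cast h)

theorem P_one : P EX EY EZ 1 = Measure.infinitePi fun _ => postLaw EX EY EZ := by
  unfold P
  exact congrArg _ (funext fun n => lawAt_of_le (ν := 1) EX EY EZ (by omega))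

instance (ν : ℕ∞) : IsProbabilityMeasure (P EX EY EZ ν) := by unfold P; infer_instance

end Laws

theorem neg_coe_mul_pos {a : ℝ} (ha : 0 < a) {x : EReal} (hx : x < 0) :
    0 < -((a : EReal) * x) := by
  rw [← EReal.neg_lt_neg_iff, neg_neg, neg_zero]
  exact EReal.mul_neg_iff.2 (Or.inl ⟨by exact_mod_cast ha, hx⟩)

theorem neg_coe_mul_anti {a : ℝ} (ha : 0 ≤ a) {x y : EReal} (h : x ≤ y) :
    -((a : EReal) * y) ≤ -((a : EReal) * x) :=
  EReal.neg_le_neg_iff.2 (mul_le_mul_of_nonneg_left h (by exact_mod_cast ha))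

theorem neg_add_nonpos {x y : EReal} (h : y ≤ x) : -x + y ≤ 0 :=
  calc -x + y ≤ -x + x := add_le_add_right h _
    _ = x - x := by rw [add_comm, sub_eq_add_neg]
    _ ≤ 0 := EReal.sub_self_le_zero

/-! ### States that can be reached -/

/-- The states of the truncated 2E-CUSUM algorithm that can be reached. -/
def TwoE.Reachable (NX NY : ℝ) (h : EReal) : TwoE → Prop
  | .onY w k => w ≤ h ∧ 1 ≤ k ∧ k ≤ ⌈NY⌉₊
  | .onX v u j k => v ≤ u ∧ 1 ≤ j ∧ j ≤ ⌈NX⌉₊ ∧ 1 ≤ k ∧ k + 1 ≤ ⌈NY⌉₊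
  | .done => True

/-- The states of the 3E-CUSUM algorithm that can be reached. -/
def ThreeE.Reachable (NX NY : ℝ) : ThreeE → Prop
  | .onZ d => 0 ≤ d
  | .below h s => 0 ≤ h ∧ s.Reachable NX NY h ∧ s ≠ .done

@[simp] theorem ThreeE.resume_done (h : EReal) : ThreeE.resume h .done = .onZ 0 := rfl

theorem ThreeE.resume_of_ne {h : EReal} {s : TwoE} (hs : s ≠ .done) :
    ThreeE.resume h s = .below h s := by
  cases s <;> first | rfl | exact absurd rfl hs

theorem TwoE.reachable_start {NX NY : ℝ} {h : EReal} (hh : 0 ≤ h) {k : ℕ} (hk : k ≤ ⌈NY⌉₊) :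
    (TwoE.start k).Reachable NX NY h := by
  unfold TwoE.start
  split_ifs with h0
  · trivial
  · exact ⟨hh, Nat.one_le_iff_ne_zero.2 h0, hk⟩

section

variable {𝓧 𝓨 𝓩 : Type*} [MeasurableSpace 𝓧] [MeasurableSpace 𝓨] [MeasurableSpace 𝓩]
variable (EX : Experiment 𝓧) (EY : Experiment 𝓨) (EZ : Experiment 𝓩) {aY aZ NX NY : ℝ}

theorem TwoE.reachable_step (haY : 0 < aY) {h : EReal} (hh : 0 ≤ h) {s : TwoE}
    (hs : s.Reachable NX NY h) (o : Datum 𝓧 𝓨 𝓩) :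
    (s.step EX EY aY NX h o).Reachable NX NY h := by
  cases s with
  | onY w k =>
    obtain ⟨hw, hk1, hk⟩ := hs
    simp only [TwoE.step]
    split_ifs with h1 h2 h3
    · trivial
    · exact ⟨hh, by omega, by omega⟩
    · exact ⟨(neg_coe_mul_pos haY h2).le, by omega, randomLimit_le _ _, by omega, by omega⟩
    · exact ⟨not_lt.1 fun h => h1 (Or.inl h), by omega, by omega⟩
  | onX v u j k =>
    obtain ⟨hv, hj1, hj, hk1, hk⟩ := hs
    simp only [TwoE.step]
    split_ifs with h1
    · exact ⟨hh, hk1, by omega⟩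
    · exact ⟨not_lt.1 fun h => h1 (Or.inl h), by omega, by omega, hk1, hk⟩
  | done => trivial

theorem ThreeE.reachable_resume {h : EReal} (hh : 0 ≤ h) {s : TwoE}
    (hs : s.Reachable NX NY h) : (ThreeE.resume h s).Reachable NX NY := by
  by_cases hd : s = .done
  · subst hd; exact le_rfl
  · rw [ThreeE.resume_of_ne hd]; exact ⟨hh, hs, hd⟩

theorem ThreeE.reachable_step (haY : 0 < aY) (haZ : 0 < aZ) {s : ThreeE}
    (hs : s.Reachable NX NY) (o : Datum 𝓧 𝓨 𝓩) :
    (s.step EX EY EZ aY aZ NX NY o).Reachable NX NY := by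
  cases s with
  | onZ d =>
    simp only [ThreeE.step]
    split_ifs with h1
    · exact ThreeE.reachable_resume (neg_coe_mul_pos haZ h1).le
        (TwoE.reachable_start (neg_coe_mul_pos haZ h1).le (randomLimit_le _ _))
    · exact not_lt.1 h1
  | below h s =>
    exact ThreeE.reachable_resume hs.1 (TwoE.reachable_step EX EY haY hs.1 hs.2.1 o)

/-- The states in which no alarm is raised. -/
def alarmFree (A : EReal) : Set ThreeE := {s | ∀ d, s = .onZ d → d ≤ A}

@[simp] theorem onZ_mem_alarmFree {A d : EReal} : ThreeE.onZ d ∈ alarmFree A ↔ d ≤ A := by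
  simp [alarmFree]

@[simp] theorem below_mem_alarmFree {A h : EReal} {s : TwoE} :
    ThreeE.below h s ∈ alarmFree A := by
  simp [alarmFree]

theorem resume_mem_alarmFree {A : EReal} (hA : 0 ≤ A) (h : EReal) (s : TwoE) :
    ThreeE.resume h s ∈ alarmFree A := by
  by_cases hd : s = .done
  · subst hd; simpa using hA
  · rw [ThreeE.resume_of_ne hd]; simp

theorem measurableSet_alarmFree (A : EReal) : MeasurableSet (alarmFree A) := by
  have : alarmFree A = {s : ThreeE | s.coord.1 = false} ∪ {s : ThreeE | s.coord.2.1 ≤ A} := by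
    ext s; cases s <;> simp [ThreeE.coord]
  rw [this]
  exact (ThreeE.measurable_coord.fst (measurableSet_singleton false)).union
    (measurableSet_le ThreeE.measurable_coord.snd.fst measurable_const)

/-- Below zero the invariants `w ≤ h` and `v ≤ u` keep the statistic nonpositive, even with infinite
levels, so exceeding $A\ge0$ is possible only while `Z` is used. -/
theorem lt_stat_iff {A : EReal} (hA : 0 ≤ A) {s : ThreeE} (hs : s.Reachable NX NY) :
    A < s.stat ↔ s ∉ alarmFree A := by
  cases s with
  | onZ d => simp [ThreeE.stat]
  | below h s =>
    have : (ThreeE.below h s).stat ≤ 0 := by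
      obtain ⟨hh, hs, hd⟩ := hs
      cases s with
      | onY w k => exact neg_add_nonpos hs.1
      | onX v u j k =>
        have h1 : -h + (-u + v) ≤ 0 + 0 :=
          add_le_add (EReal.neg_le_zero.2 hh) (neg_add_nonpos hs.1)
        rw [← add_assoc, add_zero] at h1
        exact h1
      | done => exact le_rfl
    simpa using this.trans hA

variable (aY aZ NX NY) in
theorem threeEState_eq_chain (ω : Path 𝓧 𝓨 𝓩) (n : ℕ) :
    threeEState EX EY EZ aY aZ NX NY ω n =
      chain (fun s o => s.step EX EY EZ aY aZ NX NY o) (.onZ 0) ω n := by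
  induction n with
  | zero => rfl
  | succ n ih => rw [threeEState, chain, ih]

theorem reachable_threeEState (haY : 0 < aY) (haZ : 0 < aZ) (ω : Path 𝓧 𝓨 𝓩) (n : ℕ) :
    (threeEState EX EY EZ aY aZ NX NY ω n).Reachable NX NY := by
  induction n with
  | zero => exact le_rfl
  | succ n ih => exact ThreeE.reachable_step EX EY EZ haY haZ ih _

theorem lt_stat_iff_chain (haY : 0 < aY) (haZ : 0 < aZ) {A : EReal} (hA : 0 ≤ A)
    (ω : Path 𝓧 𝓨 𝓩) (n : ℕ) :
    A < (threeEState EX EY EZ aY aZ NX NY ω n).stat ↔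
      chain (fun s o => s.step EX EY EZ aY aZ NX NY o) (.onZ 0) ω n ∉ alarmFree A := by
  rw [lt_stat_iff hA (reachable_threeEState EX EY EZ haY haZ ω n), threeEState_eq_chain]

/-- The mean of `τ_3E` for i.i.d. data, as the potential of a killed chain. -/
theorem lintegral_alarm_eq {μ : Measure (Datum 𝓧 𝓨 𝓩)} [IsProbabilityMeasure μ]
    (haY : 0 < aY) (haZ : 0 < aZ) {A : ℝ} (hA : 0 ≤ A) :
    ∫⁻ ω, ((psi3E EX EY EZ A aY aZ NX NY).alarm ω : ℝ≥0∞) ∂Measure.infinitePi (fun _ => μ) =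
      potential μ (fun s o => s.step EX EY EZ aY aZ NX NY o) (alarmFree A) 1 (.onZ 0) :=
  lintegral_firstTime_chain (measurable_threeE_step EX EY EZ aY aZ NX NY)
    (measurableSet_alarmFree A) _
    (lt_stat_iff_chain EX EY EZ haY haZ (by exact_mod_cast hA))

/-! ### False alarms -/

theorem killed_const_mul {S O : Type*} [MeasurableSpace S] [MeasurableSpace O] {μ : Measure O}
    {step : S → O → S} {good : Set S} (hstep : Measurable (Function.uncurry step))
    (hgood : MeasurableSet good) {f : S → ℝ≥0∞} (hf : Measurable f) (c : ℝ≥0∞) (s : S) :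
    killed μ step good (fun s => c * f s) s = c * killed μ step good f s := by
  rw [killed, killed, ← lintegral_const_mul]
  · refine lintegral_congr fun o => ?_
    by_cases h : step s o ∈ good <;> simp [h]
  · exact (hf.indicator hgood).comp (hstep.comp measurable_prodMk_left)

/-- A lower bound for potentials: `u` is `γ` minus the excess of the killed chain. -/
theorem le_potential_of_excess {S O : Type*} [MeasurableSpace S] [MeasurableSpace O]
    {μ : Measure O} [SFinite μ] {step : S → O → S} {good : Set S}
    (hstep : Measurable (Function.uncurry step)) (hgood : MeasurableSet good)
    {γ : ℝ≥0∞} (hγ : γ ≠ ∞) {V : S → ℝ≥0∞} {T : Set S}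
    (h : ∀ J : S → ℝ≥0∞, Measurable J → (∀ s ∈ T, γ ≤ J s + V s) →
      ∀ s ∈ T, γ ≤ 1 + killed μ step good J s + V s) {s : S} (hs : s ∈ T) :
    γ ≤ potential μ step good 1 s + V s := by
  by_cases hfin : potential μ step good 1 s = ∞
  · simp [hfin]
  -- Survival up to the horizon `M` is credited with `γ`, which makes the case `M = 0` trivial. The
  -- credit vanishes in the limit, since the survival probabilities are the terms of the convergent
  -- series for the potential.
  have key : ∀ M, ∀ s ∈ T, γ ≤ partialPotential μ step good M 1 s +
      γ * (killed μ step good)^[M] 1 s + V s := by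
    intro M
    induction M with
    | zero => intro s _; simp
    | succ M ih =>
      intro s hs
      have m1 := measurable_partialPotential (μ := μ) hstep hgood
        (measurable_one : Measurable (1 : S → ℝ≥0∞)) M
      have m2 := measurable_iterate_killed (μ := μ) hstep hgood
        (measurable_one : Measurable (1 : S → ℝ≥0∞)) M
      have := h (partialPotential μ step good M 1 + fun s => γ * (killed μ step good)^[M] 1 s)
        (m1.add (m2.const_mul γ)) ih s hs
      rw [killed_add hstep hgood m1, killed_const_mul hstep hgood m2, ← add_assoc] at this
      rw [partialPotential_succ hstep hgood measurable_one, Function.iterate_succ_apply']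
      exact this
  have hlim : Tendsto (fun M => potential μ step good 1 s +
      γ * (killed μ step good)^[M] 1 s + V s) atTop
      (nhds (potential μ step good 1 s + γ * 0 + V s)) := by
    have h0 := ENNReal.tendsto_atTop_zero_of_tsum_ne_top hfin
    exact ((tendsto_const_nhds).add (ENNReal.Tendsto.const_mul h0 (Or.inr hγ))).add
      tendsto_const_nhds
  rw [mul_zero, add_zero] at hlim
  refine ge_of_tendsto' hlim fun M => (key M s hs).trans ?_
  gcongr
  exact partialPotential_le_potential M s

theorem lintegral_exp_add_le (d : EReal) :
    ∫⁻ o, (d + EZ.llr o.2.2.1).exp ∂preLaw EX EY EZ ≤ d.exp := by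
  simp_rw [EReal.exp_add]
  have m := EZ.measurable_exp_llr
  have m' : Measurable fun o : Datum 𝓧 𝓨 𝓩 => (EZ.llr o.2.2.1).exp :=
    m.comp measurable_snd.snd.fst
  rw [preLaw_eq, lintegral_const_mul _ m',
    lintegral_obsZ _ _ _ m]
  exact mul_le_of_le_one_right' EZ.lintegral_exp_llr_pre_le

/-- The function `V` below is the excess $e^d-1$ at level $d$ of `Z`, and zero during 2E-CUSUM. The
two facts used are that $e^{d+\ell_Z}$ has mean at most $e^d$ and that it is at least `γ` at an
alarm. -/
theorem le_arlfa (haY : 0 < aY) (haZ : 0 < aZ) {γ : ℝ} (hγ : 1 ≤ γ) :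
    ENNReal.ofReal γ ≤ arlfa EX EY EZ (psi3E EX EY EZ (Real.log γ) aY aZ NX NY) := by
  have hA : 0 ≤ Real.log γ := Real.log_nonneg hγ
  have hA' : (0 : EReal) ≤ (Real.log γ : ℝ) := by exact_mod_cast hA
  have hexp : ∀ d : EReal, ¬ d ≤ (Real.log γ : ℝ) → ENNReal.ofReal γ ≤ d.exp := by
    intro d hd
    have := EReal.exp_monotone (not_le.1 hd).le
    rwa [EReal.exp_coe, Real.exp_log (by linarith)] at this
  rw [arlfa, meanAlarm, P_top, lintegral_alarm_eq EX EY EZ haY haZ hA]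
  have hstep := measurable_threeE_step EX EY EZ aY aZ NX NY
  have hgood := measurableSet_alarmFree (Real.log γ : ℝ)
  let V : ThreeE → ℝ≥0∞ := fun s => match s with
    | .onZ d => d.exp - 1
    | .below _ _ => 0
  let T : Set ThreeE := {s | s ∈ alarmFree (Real.log γ : ℝ) ∧ ∀ d, s = .onZ d → 0 ≤ d}
  have hresume : ∀ h s, ThreeE.resume h s ∈ T ∧ V (ThreeE.resume h s) = 0 := by
    intro h s
    refine ⟨⟨resume_mem_alarmFree hA' h s, ?_⟩, ?_⟩ <;> by_cases hd : s = .done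
    · subst hd; intro d hd; cases hd; exact le_rfl
    · rw [ThreeE.resume_of_ne hd]; intro d hd; cases hd
    · subst hd; simp [V]
    · rw [ThreeE.resume_of_ne hd]
  have := le_potential_of_excess (μ := preLaw EX EY EZ) hstep hgood
    (γ := ENNReal.ofReal γ) ENNReal.ofReal_ne_top (V := V) (T := T) ?_ (s := .onZ 0)
    ⟨by simpa using hA', by rintro d hd; cases hd; exact le_rfl⟩
  · simpa [V] using this
  intro J hJ hT s hs
  have hmJ : ∀ s : ThreeE, Measurable fun o : Datum 𝓧 𝓨 𝓩 =>
      (alarmFree (Real.log γ : ℝ)).indicator J (s.step EX EY EZ aY aZ NX NY o) := fun s =>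
    (hJ.indicator hgood).comp (hstep.comp measurable_prodMk_left)
  have hJresume : ∀ h s, ENNReal.ofReal γ ≤
      (alarmFree (Real.log γ : ℝ)).indicator J (ThreeE.resume h s) := by
    intro h s
    rw [Set.indicator_of_mem (resume_mem_alarmFree hA' h s)]
    simpa [(hresume h s).2] using hT _ (hresume h s).1
  cases s with
  | onZ d =>
    have hd : 0 ≤ d := hs.2 d rfl
    have h1 : 1 ≤ d.exp := by simpa using hd
    calc ENNReal.ofReal γ = ∫⁻ _, ENNReal.ofReal γ ∂preLaw EX EY EZ := by simp
      _ ≤ ∫⁻ o, ((alarmFree (Real.log γ : ℝ)).indicator J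
            ((ThreeE.onZ d).step EX EY EZ aY aZ NX NY o) + (d + EZ.llr o.2.2.1).exp)
            ∂preLaw EX EY EZ := by
          refine lintegral_mono fun o => ?_
          simp only [ThreeE.step]
          split_ifs with h2
          · exact (hJresume _ _).trans le_self_add
          · by_cases h3 : d + EZ.llr o.2.2.1 ≤ (Real.log γ : ℝ)
            · rw [Set.indicator_of_mem (by simpa using h3)]
              refine (hT (.onZ (d + EZ.llr o.2.2.1)) ⟨by simpa using h3, ?_⟩).trans ?_
              · rintro e he; cases he; exact not_lt.1 h2
              · exact add_le_add_right tsub_le_self _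
            · exact (hexp _ h3).trans le_add_self
      _ ≤ killed (preLaw EX EY EZ) (fun s o => s.step EX EY EZ aY aZ NX NY o)
            (alarmFree (Real.log γ : ℝ)) J (.onZ d) + d.exp := by
          rw [lintegral_add_left (hmJ _)]
          exact add_le_add_right (lintegral_exp_add_le EX EY EZ d) _
      _ = _ := by
          -- The observation just made supplies the $1$ by which $e^d$ exceeds `V`; here $d\ge0$
          -- makes the truncated subtraction exact.
          rw [add_comm 1, add_assoc]
          congr 1
          exact (add_tsub_cancel_of_le h1).symm
  | below h s =>
    calc ENNReal.ofReal γ = ∫⁻ _, ENNReal.ofReal γ ∂preLaw EX EY EZ := by simp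
      _ ≤ killed (preLaw EX EY EZ) (fun s o => s.step EX EY EZ aY aZ NX NY o)
            (alarmFree (Real.log γ : ℝ)) J (.below h s) :=
          lintegral_mono fun o => hJresume _ _
      _ ≤ _ := by
          rw [add_assoc, add_left_comm]; exact le_self_add

theorem one_le_firstTime (p : ℕ → Prop) : 1 ≤ firstTime p :=
  le_iInf₂ fun n hn => by exact_mod_cast hn.1

/-- For $\gamma<1$ the threshold is negative and the reduction to `alarmFree` is not available, but
an alarm takes at least one observation. -/
theorem ofReal_le_arlfa (haY : 0 < aY) (haZ : 0 < aZ) {γ : ℝ} :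
    ENNReal.ofReal γ ≤ arlfa EX EY EZ (psi3E EX EY EZ (Real.log γ) aY aZ NX NY) := by
  rcases le_total 1 γ with h | h
  · exact le_arlfa EX EY EZ haY haZ h
  · calc ENNReal.ofReal γ ≤ 1 := by simpa using h
      _ = ∫⁻ _, 1 ∂P EX EY EZ ⊤ := by simp
      _ ≤ _ := lintegral_mono fun ω => by
          have : (1 : ℕ∞) ≤ (psi3E EX EY EZ (Real.log γ) aY aZ NX NY).alarm ω :=
            one_le_firstTime _
          simpa using ENat.toENNReal_le.2 this

end

/-! ### Mean remaining duration of the truncated 2E-CUSUM algorithm -/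

theorem partialPotential_succ_le {S O : Type*} [MeasurableSpace S] [MeasurableSpace O]
    {μ : Measure O} [IsProbabilityMeasure μ] {step : S → O → S} {good : Set S} (M : ℕ) (s : S) :
    partialPotential μ step good (M + 1) 1 s ≤ 1 + partialPotential μ step good M 1 s := by
  have h : ∀ M s, (killed μ step good)^[M] 1 s ≤ 1 := by
    intro M
    induction M with
    | zero => intro s; exact le_rfl
    | succ M ih =>
      intro s
      rw [Function.iterate_succ_apply']
      calc _ ≤ ∫⁻ _, 1 ∂μ := lintegral_mono fun o => by
            by_cases hs : step s o ∈ good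
            · simpa [hs] using ih _
            · simp [hs]
        _ = 1 := by simp
  rw [partialPotential, Finset.sum_range_succ, add_comm]
  exact add_le_add_left (h M s) _

/-- An upper bound for the mean remaining duration of the truncated 2E-CUSUM algorithm, if the
limits for `X` have mean `x`. -/
def TwoE.duration (x : ℝ≥0∞) : TwoE → ℝ≥0∞
  | .onY _ k => ((k - 1 : ℕ) : ℝ≥0∞) + 1 + ((k - 1 : ℕ) : ℝ≥0∞) * x
  | .onX _ _ j k => ((j - 1 : ℕ) : ℝ≥0∞) + 1 + (((k - 1 : ℕ) : ℝ≥0∞) + 1 +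
      ((k - 1 : ℕ) : ℝ≥0∞) * x)
  | .done => 0

theorem measurable_natCast_ennreal : Measurable fun n : ℕ => (n : ℝ≥0∞) := measurable_from_nat

theorem TwoE.measurable_duration (x : ℝ≥0∞) : Measurable (TwoE.duration x) := by
  have hn : ∀ {β : Type} [MeasurableSpace β] {f : β → ℕ}, Measurable f →
      Measurable fun b => ((f b - 1 : ℕ) : ℝ≥0∞) := fun hf =>
    (measurable_from_nat (f := fun n : ℕ => ((n - 1 : ℕ) : ℝ≥0∞))).comp hf
  refine TwoE.measurable_elim (t := id) measurable_id (F := fun _ s => s.duration x) ?_ ?_ ?_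
  · simp only [TwoE.duration]
    exact ((hn (measurable_snd.snd)).add_const _).add ((hn (measurable_snd.snd)).mul_const _)
  · simp only [TwoE.duration]
    exact ((hn (measurable_snd.snd.snd.fst)).add_const _).add
      (((hn (measurable_snd.snd.snd.snd)).add_const _).add
        ((hn (measurable_snd.snd.snd.snd)).mul_const _))
  · exact measurable_const

theorem TwoE.duration_start_le (x : ℝ≥0∞) (k : ℕ) :
    (TwoE.start k).duration x ≤ k + k * x := by
  unfold TwoE.start
  split_ifs with h
  · simp [TwoE.duration]
  · obtain ⟨m, rfl⟩ := Nat.exists_eq_succ_of_ne_zero h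
    simp only [TwoE.duration, Nat.succ_sub_one]
    push_cast
    gcongr
    exact le_self_add

section

variable {𝓧 𝓨 𝓩 : Type*} [MeasurableSpace 𝓧] [MeasurableSpace 𝓨] [MeasurableSpace 𝓩]
variable (EX : Experiment 𝓧) (EY : Experiment 𝓨) (EZ : Experiment 𝓩) {aY aZ NX NY : ℝ}

/-- The last permitted observation of `Y` always ends the execution, so it is never followed by an
`X` run; hence the missing last term for `k ≤ 1`. Otherwise a fresh limit for `X` may come into use,
and it is kept unaveraged here. -/
theorem TwoE.duration_step_onY_le (x : ℝ≥0∞) (h w : EReal) (k : ℕ) (o : Datum 𝓧 𝓨 𝓩) :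
    ((TwoE.onY w k).step EX EY aY NX h o).duration x ≤
      ((k - 1 : ℕ) : ℝ≥0∞) + ((k - 1 - 1 : ℕ) : ℝ≥0∞) * x +
        if k ≤ 1 then 0 else (randomLimit NX o.2.2.2.1 : ℝ≥0∞) := by
  have hc : ¬ k ≤ 1 → ((k - 1 : ℕ) : ℝ≥0∞) = ((k - 1 - 1 : ℕ) : ℝ≥0∞) + 1 := by
    intro hk
    have : k - 1 = (k - 1 - 1) + 1 := by omega
    exact_mod_cast this
  simp only [TwoE.step]
  split_ifs with h1 h2 h3 h4 h5 h6 h7 <;> simp only [TwoE.duration]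
  · exact zero_le
  · exact zero_le
  · exact absurd (Or.inr ‹_›) h1
  · rw [hc ‹_›]
    exact le_self_add
  · exact absurd (Or.inr ‹_›) h1
  · rw [hc ‹_›]
    have : ((randomLimit NX o.2.2.2.1 - 1 : ℕ) : ℝ≥0∞) + 1 = randomLimit NX o.2.2.2.1 := by
      have : randomLimit NX o.2.2.2.1 - 1 + 1 = randomLimit NX o.2.2.2.1 := by omega
      exact_mod_cast this
    rw [this, add_comm]
  · exact absurd (Or.inr ‹_›) h1
  · rw [hc ‹_›]
    exact le_self_add

theorem TwoE.duration_step_onX_le (x : ℝ≥0∞) (h v u : EReal) (j k : ℕ) (o : Datum 𝓧 𝓨 𝓩) :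
    ((TwoE.onX v u j k).step EX EY aY NX h o).duration x ≤
      ((j - 1 : ℕ) : ℝ≥0∞) + (((k - 1 : ℕ) : ℝ≥0∞) + 1 + ((k - 1 : ℕ) : ℝ≥0∞) * x) := by
  simp only [TwoE.step]
  split_ifs with h1 <;> simp only [TwoE.duration]
  · exact le_add_self
  · have : ((j - 1 - 1 : ℕ) : ℝ≥0∞) + 1 = ((j - 1 : ℕ) : ℝ≥0∞) := by
      have : j - 1 - 1 + 1 = j - 1 := by omega
      exact_mod_cast this
    rw [this]

theorem measurable_limitY (N : ℝ) :
    Measurable fun o : Datum 𝓧 𝓨 𝓩 => (randomLimit N o.2.2.2.2 : ℝ≥0∞) :=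
  (measurable_natCast_ennreal.comp (measurable_randomLimit N)).comp measurable_snd.snd.snd.snd

theorem natCast_add_mul_add_ite (x : ℝ≥0∞) (k : ℕ) :
    ((k - 1 : ℕ) : ℝ≥0∞) + ((k - 1 - 1 : ℕ) : ℝ≥0∞) * x + (if k ≤ 1 then 0 else x) =
      ((k - 1 : ℕ) : ℝ≥0∞) + ((k - 1 : ℕ) : ℝ≥0∞) * x := by
  split_ifs with hk
  · have : k - 1 = 0 := by omega
    simp [this]
  · have : ((k - 1 : ℕ) : ℝ≥0∞) = ((k - 1 - 1 : ℕ) : ℝ≥0∞) + 1 := by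
      have : k - 1 = (k - 1 - 1) + 1 := by omega
      exact_mod_cast this
    conv_rhs => rw [this, add_mul, one_mul, ← add_assoc, ← this]

variable (α : Measure 𝓧) (β : Measure 𝓨) (γ : Measure 𝓩)
  [IsProbabilityMeasure α] [IsProbabilityMeasure β] [IsProbabilityMeasure γ]

/-- A fresh limit for `X` has mean exactly $N_X$ despite the rounding, so while the algorithm runs
`TwoE.duration` decreases on average by at least one per observation: it is a supersolution for the
remaining time. -/
theorem TwoE.one_add_lintegral_duration_le (hNX : 0 ≤ NX) (h : EReal) {s : TwoE}
    (hs : s ≠ .done) :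
    1 + ∫⁻ o : Datum 𝓧 𝓨 𝓩, (s.step EX EY aY NX h o).duration (ENNReal.ofReal NX)
      ∂jointLaw α β γ ≤ s.duration (ENNReal.ofReal NX) := by
  set x := ENNReal.ofReal NX with hx
  cases s with
  | onY w k =>
    calc _ ≤ 1 + ∫⁻ o : Datum 𝓧 𝓨 𝓩, (((k - 1 : ℕ) : ℝ≥0∞) + ((k - 1 - 1 : ℕ) : ℝ≥0∞) * x +
            if k ≤ 1 then 0 else (randomLimit NX o.2.2.2.1 : ℝ≥0∞)) ∂jointLaw α β γ :=
          add_le_add_right (lintegral_mono fun o => TwoE.duration_step_onY_le EX EY x h w k o) _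
      _ = 1 + (((k - 1 : ℕ) : ℝ≥0∞) + ((k - 1 - 1 : ℕ) : ℝ≥0∞) * x +
            if k ≤ 1 then 0 else x) := by
          rw [lintegral_add_left measurable_const]
          congr 2
          · simp
          · split_ifs
            · simp
            · exact lintegral_limitX α β γ hNX
      _ = _ := by
          rw [natCast_add_mul_add_ite, TwoE.duration, add_comm _ (1 : ℝ≥0∞), add_assoc]
  | onX v u j k =>
    calc _ ≤ 1 + ∫⁻ o : Datum 𝓧 𝓨 𝓩, (((j - 1 : ℕ) : ℝ≥0∞) + (((k - 1 : ℕ) : ℝ≥0∞) + 1 +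
            ((k - 1 : ℕ) : ℝ≥0∞) * x)) ∂jointLaw α β γ :=
          add_le_add_right
            (lintegral_mono fun o => TwoE.duration_step_onX_le EX EY x h v u j k o) _
      _ = _ := by
          rw [lintegral_const, measure_univ, mul_one, TwoE.duration, ← add_assoc, add_comm 1]
  | done => exact absurd rfl hs

theorem lintegral_duration_start_le (hNY : 0 ≤ NY) (x : ℝ≥0∞) :
    ∫⁻ o : Datum 𝓧 𝓨 𝓩, (TwoE.start (randomLimit NY o.2.2.2.2)).duration x ∂jointLaw α β γ ≤
      ENNReal.ofReal NY + ENNReal.ofReal NY * x := by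
  calc _ ≤ ∫⁻ o : Datum 𝓧 𝓨 𝓩, ((randomLimit NY o.2.2.2.2 : ℝ≥0∞) +
          (randomLimit NY o.2.2.2.2 : ℝ≥0∞) * x) ∂jointLaw α β γ :=
        lintegral_mono fun o => TwoE.duration_start_le _ _
    _ = _ := by
        rw [lintegral_add_left (measurable_limitY NY), lintegral_mul_const _ (measurable_limitY NY),
          lintegral_limitY α β γ hNY]

/-! ### Monotonicity of the mean time to an alarm -/

/-- The threshold enters only the stopping test of `Y`. With the same data, a lower threshold either
stops at once or leads to the same state. -/
theorem TwoE.step_eq_or_done {h h' : EReal} (hh : h ≤ h') (s : TwoE) (o : Datum 𝓧 𝓨 𝓩) :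
    s.step EX EY aY NX h o = .done ∨ s.step EX EY aY NX h o = s.step EX EY aY NX h' o := by
  cases s with
  | onY w k =>
    simp only [TwoE.step]
    by_cases h1 : h < w + EY.llr o.2.1 ∨ k ≤ 1
    · left; rw [if_pos h1]
    · right
      have h2 : ¬ (h' < w + EY.llr o.2.1 ∨ k ≤ 1) := fun hc =>
        h1 (hc.imp_left fun hc => hh.trans_lt hc)
      rw [if_neg h1, if_neg h2]
  | onX v u j k => right; rfl
  | done => left; rfl

variable (μ : Measure (Datum 𝓧 𝓨 𝓩)) [IsProbabilityMeasure μ]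

/-- The mean time to an alarm decreases with the statistic of `Z`, and executing the truncated
2E-CUSUM algorithm only delays the alarm, the more the higher its threshold. -/
theorem partialPotential_alarmFree_mono (haZ : 0 < aZ) {A : EReal} (hA : 0 ≤ A) (M : ℕ) :
    let F := partialPotential μ (fun s o => ThreeE.step EX EY EZ aY aZ NX NY s o)
      (alarmFree A) M 1
    (∀ d d', d ≤ d' → F (.onZ d') ≤ F (.onZ d)) ∧
    (∀ h s, F (.onZ 0) ≤ F (.resume h s)) ∧
    (∀ h h' s, h ≤ h' → F (.resume h s) ≤ F (.resume h' s)) := by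
  have hstep := measurable_threeE_step EX EY EZ aY aZ NX NY
  have hgood := measurableSet_alarmFree A
  have hsucc := partialPotential_succ (μ := μ) hstep hgood
    (measurable_one : Measurable (1 : ThreeE → ℝ≥0∞))
  induction M with
  | zero => simp
  | succ M ih =>
    obtain ⟨i1, i2, i3⟩ := ih
    refine ⟨fun d d' hd => ?_, fun h s => ?_, fun h h' s hh => ?_⟩
    · rw [hsucc, hsucc]
      refine add_le_add_right (lintegral_mono fun o => ?_) _
      have hle : d + EZ.llr o.2.2.1 ≤ d' + EZ.llr o.2.2.1 := add_le_add_left hd _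
      simp only [ThreeE.step]
      by_cases h' : d' + EZ.llr o.2.2.1 < 0
      · rw [if_pos h', if_pos (hle.trans_lt h'),
          Set.indicator_of_mem (resume_mem_alarmFree hA _ _),
          Set.indicator_of_mem (resume_mem_alarmFree hA _ _)]
        exact i3 _ _ _ (neg_coe_mul_anti haZ.le hle)
      · rw [if_neg h']
        by_cases hA' : d' + EZ.llr o.2.2.1 ≤ A
        · rw [Set.indicator_of_mem (by simpa using hA')]
          split_ifs with h2
          · rw [Set.indicator_of_mem (resume_mem_alarmFree hA _ _)]
            -- Only the lower walk falls: level $0$ serves as the intermediate term, from which the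
            -- higher walk gains and which the 2E-CUSUM execution only delays.
            exact (i1 _ _ (not_lt.1 h')).trans (i2 _ _)
          · rw [Set.indicator_of_mem (by simpa using hle.trans hA')]
            exact i1 _ _ hle
        · rw [Set.indicator_of_notMem (by simpa using hA')]
          exact zero_le
    · by_cases hs : s = .done
      · subst hs; exact le_rfl
      · refine (partialPotential_succ_le M _).trans ?_
        rw [hsucc, ThreeE.resume_of_ne hs]
        refine add_le_add_right ?_ _
        calc partialPotential μ (fun s o => ThreeE.step EX EY EZ aY aZ NX NY s o)
              (alarmFree A) M 1 (.onZ 0) = ∫⁻ _, partialPotential μ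
              (fun s o => ThreeE.step EX EY EZ aY aZ NX NY s o) (alarmFree A) M 1 (.onZ 0) ∂μ := by
              simp
          _ ≤ _ := lintegral_mono fun o => by
              simp only [ThreeE.step]
              rw [Set.indicator_of_mem (resume_mem_alarmFree hA _ _)]
              exact i2 _ _
    · by_cases hs : s = .done
      · subst hs; exact le_rfl
      · rw [hsucc, hsucc, ThreeE.resume_of_ne hs, ThreeE.resume_of_ne hs]
        refine add_le_add_right (lintegral_mono fun o => ?_) _
        simp only [ThreeE.step]
        rw [Set.indicator_of_mem (resume_mem_alarmFree hA _ _),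
          Set.indicator_of_mem (resume_mem_alarmFree hA _ _)]
        rcases TwoE.step_eq_or_done EX EY hh s o with h1 | h1
        · rw [h1]; exact i2 _ _
        · rw [h1]; exact i3 _ _ _ hh

/-- No alarm occurs during the execution, and it hands back control at level $0$. Arguing at a
finite horizon avoids a strong Markov property at the random end of the execution. -/
theorem partialPotential_resume_le (hNX : 0 ≤ NX) {A : EReal} (hA : 0 ≤ A) (M : ℕ) :
    ∀ h s, partialPotential (jointLaw α β γ) (fun s o => ThreeE.step EX EY EZ aY aZ NX NY s o)
        (alarmFree A) M 1 (.resume h s) ≤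
      s.duration (ENNReal.ofReal NX) + partialPotential (jointLaw α β γ)
        (fun s o => ThreeE.step EX EY EZ aY aZ NX NY s o) (alarmFree A) M 1 (.onZ 0) := by
  have hstep := measurable_threeE_step EX EY EZ aY aZ NX NY
  have hgood := measurableSet_alarmFree A
  have hsucc := partialPotential_succ (μ := jointLaw α β γ) hstep hgood
    (measurable_one : Measurable (1 : ThreeE → ℝ≥0∞))
  induction M with
  | zero => simp
  | succ M ih =>
    intro h s
    by_cases hs : s = .done
    · subst hs; exact le_add_self
    · have hm : Measurable fun o : Datum 𝓧 𝓨 𝓩 =>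
          (s.step EX EY aY NX h o).duration (ENNReal.ofReal NX) :=
        (TwoE.measurable_duration _).comp (measurable_twoE_step EX EY aY NX measurable_const
          measurable_const measurable_id)
      refine le_trans ?_ (add_le_add_right (partialPotential_mono_right (Nat.le_succ M) _) _)
      rw [hsucc, ThreeE.resume_of_ne hs]
      set c := partialPotential (jointLaw α β γ)
        (fun s o => ThreeE.step EX EY EZ aY aZ NX NY s o) (alarmFree A) M 1 (.onZ 0)
      calc _ ≤ 1 + ∫⁻ o, ((s.step EX EY aY NX h o).duration (ENNReal.ofReal NX) + c)
              ∂jointLaw α β γ := by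
            refine add_le_add_right (lintegral_mono fun o => ?_) _
            simp only [ThreeE.step]
            rw [Set.indicator_of_mem (resume_mem_alarmFree hA _ _)]
            exact ih _ _
        _ = 1 + ∫⁻ o, (s.step EX EY aY NX h o).duration (ENNReal.ofReal NX)
              ∂jointLaw α β γ + c := by
            rw [lintegral_add_left hm, lintegral_const, measure_univ, mul_one, add_assoc]
        _ ≤ _ := add_le_add_left (TwoE.one_add_lintegral_duration_le EX EY α β γ hNX h hs) _

theorem potential_resume_le (hNX : 0 ≤ NX) {A : EReal} (hA : 0 ≤ A) (h : EReal) (s : TwoE) :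
    potential (jointLaw α β γ) (fun s o => ThreeE.step EX EY EZ aY aZ NX NY s o)
        (alarmFree A) 1 (.resume h s) ≤
      s.duration (ENNReal.ofReal NX) + potential (jointLaw α β γ)
        (fun s o => ThreeE.step EX EY EZ aY aZ NX NY s o) (alarmFree A) 1 (.onZ 0) :=
  potential_le fun M => (partialPotential_resume_le EX EY EZ α β γ hNX hA M h s).trans
    (add_le_add_right (partialPotential_le_potential M _) _)

theorem potential_onZ_le (haZ : 0 < aZ) {A : EReal} (hA : 0 ≤ A) {d : EReal} (hd : 0 ≤ d) :
    potential μ (fun s o => ThreeE.step EX EY EZ aY aZ NX NY s o) (alarmFree A) 1 (.onZ d) ≤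
      potential μ (fun s o => ThreeE.step EX EY EZ aY aZ NX NY s o) (alarmFree A) 1 (.onZ 0) :=
  potential_le fun M => ((partialPotential_alarmFree_mono EX EY EZ μ haZ hA M).1 0 d hd).trans
    (partialPotential_le_potential M _)

end

/-! ### The worst-case detection delay -/

theorem condLExp_le_of_setLIntegral_le {Ω : Type*} {m mΩ : MeasurableSpace Ω} {Q : Measure Ω}
    [IsFiniteMeasure Q] {X : Ω → ℝ≥0∞} {C : ℝ≥0∞}
    (h : ∀ B, MeasurableSet[m] B → MeasurableSet[mΩ] B → ∫⁻ ω in B, X ω ∂Q ≤ C * Q B) :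
    ∀ᵐ ω ∂Q, condLExp m Q X ω ≤ C := by
  by_cases hm : m ≤ mΩ
  · have : ∀ᵐ ω ∂(Q.trim hm), condLExp m Q X ω ≤ C := by
      refine ae_le_of_forall_setLIntegral_le_of_sigmaFinite (g := fun _ => C)
        (measurable_condLExp m Q X) fun s hs _ => ?_
      rw [setLIntegral_condLExp_trim hm Q X hs, setLIntegral_const, trim_measurableSet_eq hm hs]
      exact h s hs (hm s hs)
    exact ae_of_ae_trim hm this
  -- If `m` is no sub-σ-algebra, the conditional expectation is zero by convention, so measurability
  -- of the information need not be established for an upper bound.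
  · simp [condLExp_of_not_le hm]

section

variable {𝓧 𝓨 𝓩 : Type*} [MeasurableSpace 𝓧] [MeasurableSpace 𝓨] [MeasurableSpace 𝓩]
variable (EX : Experiment 𝓧) (EY : Experiment 𝓨) (EZ : Experiment 𝓩) {aY aZ NX NY : ℝ}

/-- An upper bound for the mean remaining duration of the current execution of the truncated
2E-CUSUM algorithm. -/
def ThreeE.duration (x : ℝ≥0∞) : ThreeE → ℝ≥0∞
  | .onZ _ => 0
  | .below _ s => s.duration x

theorem ThreeE.duration_resume (x : ℝ≥0∞) (h : EReal) (s : TwoE) :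
    (ThreeE.resume h s).duration x = s.duration x := by
  by_cases hs : s = .done
  · subst hs; rfl
  · rw [ThreeE.resume_of_ne hs]; rfl

theorem ThreeE.measurable_duration (x : ℝ≥0∞) : Measurable (ThreeE.duration x) := by
  refine ThreeE.measurable_elim (t := id) measurable_id (F := fun _ s => s.duration x) ?_ ?_
  · exact measurable_const
  · exact (TwoE.measurable_duration x).comp measurable_snd.snd

theorem natCast_le_ofReal_of_lt_ceil {k : ℕ} {N : ℝ} (h : k + 1 ≤ ⌈N⌉₊) :
    (k : ℝ≥0∞) ≤ ENNReal.ofReal N := by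
  have : (k : ℝ) < N := Nat.lt_ceil.1 h
  rw [← ENNReal.ofReal_natCast]
  exact ENNReal.ofReal_le_ofReal this.le

theorem lintegral_uniforms_limitX {N : ℝ} (hN : 0 ≤ N) :
    ∫⁻ q : unitInterval × unitInterval, (randomLimit N q.1 : ℝ≥0∞) = ENNReal.ofReal N := by
  have mr := measurable_natCast_ennreal.comp (measurable_randomLimit N)
  have := (measurePreserving_fst (μ := (volume : Measure unitInterval))
    (ν := (volume : Measure unitInterval))).lintegral_comp mr
  rw [← lintegral_randomLimit hN]
  exact this

theorem lintegral_uniforms_limitY {N : ℝ} (hN : 0 ≤ N) :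
    ∫⁻ q : unitInterval × unitInterval, (randomLimit N q.2 : ℝ≥0∞) = ENNReal.ofReal N := by
  have mr := measurable_natCast_ennreal.comp (measurable_randomLimit N)
  have := (measurePreserving_snd (μ := (volume : Measure unitInterval))
    (ν := (volume : Measure unitInterval))).lintegral_comp mr
  rw [← lintegral_randomLimit hN]
  exact this

/-- Given everything but the uniform variables of the last instant, the mean remaining duration of
the truncated 2E-CUSUM algorithm is at most `N_Y + N_Y N_X`. -/
theorem lintegral_uniforms_duration_step_le (hNX : 0 ≤ NX) (hNY : 0 ≤ NY) {s : ThreeE}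
    (hs : s.Reachable NX NY) (x : 𝓧) (y : 𝓨) (z : 𝓩) :
    ∫⁻ q : unitInterval × unitInterval,
      (s.step EX EY EZ aY aZ NX NY (x, y, z, q)).duration (ENNReal.ofReal NX) ≤
      ENNReal.ofReal NY + ENNReal.ofReal NY * ENNReal.ofReal NX := by
  set x' := ENNReal.ofReal NX with hx'
  set y' := ENNReal.ofReal NY with hy'
  have hp : (volume : Measure (unitInterval × unitInterval)) Set.univ = 1 := measure_univ
  have mY : Measurable fun q : unitInterval × unitInterval => (randomLimit NY q.2 : ℝ≥0∞) :=
    (measurable_natCast_ennreal.comp (measurable_randomLimit NY)).comp measurable_snd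
  cases s with
  | onZ d =>
    calc _ ≤ ∫⁻ q : unitInterval × unitInterval, ((randomLimit NY q.2 : ℝ≥0∞) +
          (randomLimit NY q.2 : ℝ≥0∞) * x') := by
          refine lintegral_mono fun q => ?_
          simp only [ThreeE.step]
          split_ifs with h
          · rw [ThreeE.duration_resume]
            exact TwoE.duration_start_le _ _
          · exact zero_le
      _ = y' + y' * x' := by
          rw [lintegral_add_left mY, lintegral_mul_const _ mY, lintegral_uniforms_limitY hNY]
  | below h s =>
    obtain ⟨hh, hs, hd⟩ := hs
    simp only [ThreeE.step, ThreeE.duration_resume]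
    cases s with
    | onY w k =>
      obtain ⟨hw, hk1, hk⟩ := hs
      -- One observation of `Y` is made in this step. What is left is at most $\lceil
      -- N_Y\rceil-1<N_Y$, so a limit that was rounded up does no harm.
      have hky : ((k - 1 : ℕ) : ℝ≥0∞) ≤ y' := natCast_le_ofReal_of_lt_ceil (by omega)
      calc _ ≤ ∫⁻ q : unitInterval × unitInterval, (((k - 1 : ℕ) : ℝ≥0∞) +
              ((k - 1 - 1 : ℕ) : ℝ≥0∞) * x' +
              if k ≤ 1 then 0 else (randomLimit NX q.1 : ℝ≥0∞)) :=
            lintegral_mono fun q => TwoE.duration_step_onY_le EX EY x' h w k (x, y, z, q)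
        _ = ((k - 1 : ℕ) : ℝ≥0∞) + ((k - 1 : ℕ) : ℝ≥0∞) * x' := by
            rw [lintegral_add_left measurable_const, ← natCast_add_mul_add_ite]
            congr 1
            · rw [lintegral_const, hp, mul_one]
            · split_ifs
              · simp
              · exact lintegral_uniforms_limitX hNX
        _ ≤ y' + y' * x' := by gcongr
    | onX v u j k =>
      obtain ⟨hv, hj1, hj, hk1, hk⟩ := hs
      have hky : (k : ℝ≥0∞) ≤ y' := natCast_le_ofReal_of_lt_ceil hk
      -- The same rounding argument for `X`: after this step at most $\lceil N_X\rceil-1<N_X$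
      -- observations remain in the run.
      have hjx : ((j - 1 : ℕ) : ℝ≥0∞) ≤ x' := natCast_le_ofReal_of_lt_ceil (by omega)
      have hk' : ((k - 1 : ℕ) : ℝ≥0∞) + 1 = k := by
        have : k - 1 + 1 = k := by omega
        exact_mod_cast this
      calc _ ≤ ∫⁻ q : unitInterval × unitInterval, (((j - 1 : ℕ) : ℝ≥0∞) +
              (((k - 1 : ℕ) : ℝ≥0∞) + 1 + ((k - 1 : ℕ) : ℝ≥0∞) * x')) :=
            lintegral_mono fun q => TwoE.duration_step_onX_le EX EY x' h v u j k (x, y, z, q)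
        _ = ((j - 1 : ℕ) : ℝ≥0∞) + (k + ((k - 1 : ℕ) : ℝ≥0∞) * x') := by
            rw [lintegral_const, hp, mul_one, hk']
        _ ≤ x' + (k + ((k - 1 : ℕ) : ℝ≥0∞) * x') := by gcongr
        _ = k + k * x' := by
            rw [add_left_comm]
            nth_rw 3 [← hk']
            rw [add_mul, one_mul, add_comm x']
        _ ≤ y' + y' * x' := by gcongr
    | done => exact absurd rfl hd

theorem seen_congr {A : ℝ} {ω ω' : Path 𝓧 𝓨 𝓩} {k : ℕ}
    (hstate : threeEState EX EY EZ aY aZ NX NY ω k = threeEState EX EY EZ aY aZ NX NY ω' k)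
    (h1 : (ω k).1 = (ω' k).1) (h2 : (ω k).2.1 = (ω' k).2.1) (h3 : (ω k).2.2.1 = (ω' k).2.2.1) :
    (psi3E EX EY EZ A aY aZ NX NY).seen k ω = (psi3E EX EY EZ A aY aZ NX NY).seen k ω' := by
  simp only [Policy.seen, psi3E, hstate, h1, h2, h3]

theorem threeEState_update (ω : Path 𝓧 𝓨 𝓩) {N m : ℕ} (h : m ≤ N) (o : Datum 𝓧 𝓨 𝓩) :
    threeEState EX EY EZ aY aZ NX NY (Function.update ω N o) m =
      threeEState EX EY EZ aY aZ NX NY ω m := by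
  rw [threeEState_eq_chain, threeEState_eq_chain, chain_update _ _ _ h]

/-- Events of the information are functions of what is seen; in particular they do not react to a
change of the uniforms of the last instant or to later data. -/
theorem mem_info_congr {Ψ : Policy 𝓧 𝓨 𝓩} {n : ℕ} {B : Set (Path 𝓧 𝓨 𝓩)}
    (hB : MeasurableSet[Ψ.info n] B) {ω ω' : Path 𝓧 𝓨 𝓩}
    (h : ∀ k < n, Ψ.seen k ω = Ψ.seen k ω') : ω ∈ B ↔ ω' ∈ B := by
  obtain ⟨B', -, rfl⟩ := hB
  have : (fun k : Fin n => Ψ.seen k ω) = fun k : Fin n => Ψ.seen k ω' :=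
    funext fun k => h k k.2
  simp only [Set.mem_preimage, this]

/-- The mean duration of the truncated 2E-CUSUM algorithm after time `n`, on an event that is
known at time `n`. -/
theorem lintegral_info_duration_le {A : ℝ} (haY : 0 < aY) (haZ : 0 < aZ) (hNX : 0 ≤ NX)
    (hNY : 0 ≤ NY) (ν : ℕ∞) (n : ℕ) {B : Set (Path 𝓧 𝓨 𝓩)}
    (hB : MeasurableSet[(psi3E EX EY EZ A aY aZ NX NY).info n] B) (hB' : MeasurableSet B) :
    ∫⁻ ω, B.indicator 1 ω * (threeEState EX EY EZ aY aZ NX NY ω n).duration (ENNReal.ofReal NX)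
      ∂P EX EY EZ ν ≤
    ∫⁻ ω, B.indicator 1 ω * (ENNReal.ofReal NY + ENNReal.ofReal NY * ENNReal.ofReal NX)
      ∂P EX EY EZ ν := by
  cases n with
  | zero => simp [threeEState, ThreeE.duration]
  | succ N =>
    have hstep := measurable_threeE_step EX EY EZ aY aZ NX NY
    have mB : Measurable (B.indicator (1 : Path 𝓧 𝓨 𝓩 → ℝ≥0∞)) := measurable_one.indicator hB'
    have mstate : ∀ n, Measurable fun ω => threeEState EX EY EZ aY aZ NX NY ω n := fun n => by
      simp only [threeEState_eq_chain]
      exact measurable_chain hstep _ n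
    have mΦ : Measurable fun ω => B.indicator (1 : Path 𝓧 𝓨 𝓩 → ℝ≥0∞) ω *
        (threeEState EX EY EZ aY aZ NX NY ω (N + 1)).duration (ENNReal.ofReal NX) :=
      mB.mul ((ThreeE.measurable_duration _).comp (mstate (N + 1)))
    -- The last instant is drawn afresh. The event `B` may depend on its observations but not on its
    -- uniforms, so a limit drawn there can be averaged while the observations are held fixed.
    rw [P, lintegral_resample _ N mΦ,
      lintegral_resample _ N (mB.mul_const _)]
    refine lintegral_mono fun ω => ?_
    have hlaw : ∃ (α : Measure 𝓧) (β : Measure 𝓨) (γ : Measure 𝓩) (_ : IsProbabilityMeasure α)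
        (_ : IsProbabilityMeasure β) (_ : IsProbabilityMeasure γ),
        lawAt EX EY EZ ν N = jointLaw α β γ := by
      unfold lawAt
      split_ifs
      · exact ⟨EX.pre, EY.pre, EZ.pre, inferInstance, inferInstance, inferInstance, rfl⟩
      · exact ⟨EX.post, EY.post, EZ.post, inferInstance, inferInstance, inferInstance, rfl⟩
    obtain ⟨α, β, γ, _, _, _, hlaw⟩ := hlaw
    have mu : Measurable fun o : Datum 𝓧 𝓨 𝓩 => Function.update ω N o := measurable_update ω
    have hBq : ∀ x y z q q', B.indicator (1 : Path 𝓧 𝓨 𝓩 → ℝ≥0∞)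
        (Function.update ω N (x, y, z, q)) =
        B.indicator 1 (Function.update ω N (x, y, z, q')) := by
      intro x y z q q'
      refine indicator_one_congr (mem_info_congr hB fun k hk => ?_)
      refine seen_congr EX EY EZ ?_ ?_ ?_ ?_
      · rw [threeEState_update _ _ _ _ (Nat.le_of_lt_succ hk),
          threeEState_update _ _ _ _ (Nat.le_of_lt_succ hk)]
      all_goals
        rcases eq_or_ne k N with rfl | hkN
        · simp
        · simp [Function.update_of_ne hkN]
    rw [hlaw]
    have hst : ∀ o, threeEState EX EY EZ aY aZ NX NY (Function.update ω N o) (N + 1) =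
        (threeEState EX EY EZ aY aZ NX NY ω N).step EX EY EZ aY aZ NX NY o := by
      intro o
      rw [threeEState, threeEState_update _ _ _ _ le_rfl, Function.update_self]
    simp only [hst]
    refine lintegral_le_of_uniforms α β γ ?_ ?_ ?_ ?_
    · exact (mB.comp mu).mul ((ThreeE.measurable_duration _).comp
        (hstep.comp measurable_prodMk_left))
    · exact (mB.comp mu).mul_const _
    · intro x y z q q'
      rw [hBq x y z q q']
    · intro x y z
      have hm : Measurable fun q : unitInterval × unitInterval =>
          ((threeEState EX EY EZ aY aZ NX NY ω N).step EX EY EZ aY aZ NX NY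
            (x, y, z, q)).duration (ENNReal.ofReal NX) :=
        (ThreeE.measurable_duration _).comp (hstep.comp (measurable_prodMk_left.comp
          (measurable_prodMk_left.comp (measurable_prodMk_left.comp measurable_prodMk_left))))
      simp only [hBq x y z _ (0, 0)]
      rw [lintegral_const_mul _ hm]
      gcongr
      exact lintegral_uniforms_duration_step_le EX EY EZ hNX hNY
        (reachable_threeEState EX EY EZ haY haZ ω N) x y z

/-- With $\nu=n+1$ the delay is $(\tau-n)^+$. The right side counts the instants until the first
alarm after time `n` and forgets earlier alarms; this gives an inequality and a quantity suited to
the Markov property. -/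
theorem alarm_add_one_tsub_le (haY : 0 < aY) (haZ : 0 < aZ) {A : ℝ} (hA : 0 ≤ A)
    (n : ℕ) (ω : Path 𝓧 𝓨 𝓩) :
    ((psi3E EX EY EZ A aY aZ NX NY).alarm ω : ℝ≥0∞) + 1 - ((n + 1 : ℕ) : ℝ≥0∞) ≤
      ∑' m, {ω | ∀ k, n < k → k ≤ n + m →
        chain (fun s o => ThreeE.step EX EY EZ aY aZ NX NY s o) (.onZ 0) ω k ∈
          alarmFree A}.indicator 1 ω := by
  have hp := lt_stat_iff_chain EX EY EZ haY haZ (NX := NX) (NY := NY) (A := (A : EReal))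
    (by exact_mod_cast hA) ω
  have h := firstTime_eq_tsum_indicator (good := alarmFree A) (ThreeE.onZ 0) ω hp
  have h' : ((psi3E EX EY EZ A aY aZ NX NY).alarm ω : ℝ≥0∞) = ((firstTime fun n =>
    (A : EReal) < (threeEState EX EY EZ aY aZ NX NY ω n).stat : ℕ∞) : ℝ≥0∞) := rfl
  rw [h', h, ← Summable.sum_add_tsum_nat_add' (k := n) ENNReal.summable, tsub_le_iff_right, add_comm (∑' _, _),
    Nat.cast_add, Nat.cast_one, add_right_comm]
  have hind : ∀ {s : Set (Path 𝓧 𝓨 𝓩)}, s.indicator (1 : Path 𝓧 𝓨 𝓩 → ℝ≥0∞) ω ≤ 1 := fun {s} => by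
    by_cases hω : ω ∈ s <;> simp [hω]
  refine add_le_add (add_le_add ?_ le_rfl) (ENNReal.tsum_le_tsum fun m => ?_)
  · exact (Finset.sum_le_sum fun i _ => hind).trans (by simp)
  · by_cases hω : ω ∈ {ω | ∀ k, 0 < k → k ≤ 0 + (m + n) →
        chain (fun s o => ThreeE.step EX EY EZ aY aZ NX NY s o) (.onZ 0) ω k ∈ alarmFree A}
    · refine hind.trans (Eq.ge (Set.indicator_of_mem (M := ℝ≥0∞) ?_ _))
      exact fun k hk hk' => hω k (by omega) (by omega)
    · exact (Set.indicator_of_notMem (M := ℝ≥0∞) hω _).trans_le zero_le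

/-- For each $\nu$, conditioning reduces the delay to the post-change mean time from the state at
time $\nu-1$. Level $0$ is the worst state of `Z`; any other state adds the remaining duration of
the current 2E-CUSUM execution. -/
theorem wadd_le (haY : 0 < aY) (haZ : 0 < aZ) (hNX : 0 ≤ NX) (hNY : 0 ≤ NY) {A : ℝ}
    (hA : 0 ≤ A) :
    wadd EX EY EZ (psi3E EX EY EZ A aY aZ NX NY) ≤
      meanAlarm EX EY EZ 1 (psi3E EX EY EZ A aY aZ NX NY) + ENNReal.ofReal (NY + NY * NX) := by
  have hstep := measurable_threeE_step EX EY EZ aY aZ NX NY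
  have hgood := measurableSet_alarmFree (A : EReal)
  have hA' : (0 : EReal) ≤ A := by exact_mod_cast hA
  set F := potential (postLaw EX EY EZ) (fun s o => ThreeE.step EX EY EZ aY aZ NX NY s o)
      (alarmFree A) 1 with hF
  set D := ENNReal.ofReal NY + ENNReal.ofReal NY * ENNReal.ofReal NX with hD
  have hmean : meanAlarm EX EY EZ 1 (psi3E EX EY EZ A aY aZ NX NY) = F (.onZ 0) := by
    rw [meanAlarm, P_one, lintegral_alarm_eq EX EY EZ haY haZ hA]
  have hD' : ENNReal.ofReal (NY + NY * NX) = D := by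
    rw [ENNReal.ofReal_add hNY (mul_nonneg hNY hNX), ENNReal.ofReal_mul hNY]
  rw [hmean, hD']
  refine iSup₂_le fun ν hν => ?_
  obtain ⟨n, rfl⟩ : ∃ n, ν = n + 1 := ⟨ν - 1, by omega⟩
  rw [Nat.add_sub_cancel]
  refine essSup_le_of_ae_le _ (condLExp_le_of_setLIntegral_le fun B hB hB' => ?_)
  have mB : Measurable (B.indicator (1 : Path 𝓧 𝓨 𝓩 → ℝ≥0∞)) := measurable_one.indicator hB'
  have hFs : ∀ s : ThreeE, s.Reachable NX NY →
      F s ≤ F (.onZ 0) + s.duration (ENNReal.ofReal NX) := by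
    intro s hs
    cases s with
    | onZ d => exact (potential_onZ_le EX EY EZ _ haZ hA' hs).trans le_self_add
    | below h s =>
      have := potential_resume_le EX EY EZ (aY := aY) (aZ := aZ) (NY := NY)
        EX.post EY.post EZ.post hNX hA' h s
      rw [ThreeE.resume_of_ne hs.2.2, add_comm] at this
      exact this
  calc ∫⁻ ω in B, (((psi3E EX EY EZ A aY aZ NX NY).alarm ω : ℝ≥0∞) + 1 - ((n + 1 : ℕ) : ℝ≥0∞))
        ∂P EX EY EZ ((n + 1 : ℕ) : ℕ∞)
      = ∫⁻ ω, B.indicator 1 ω * (((psi3E EX EY EZ A aY aZ NX NY).alarm ω : ℝ≥0∞) + 1 -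
          ((n + 1 : ℕ) : ℝ≥0∞)) ∂P EX EY EZ ((n + 1 : ℕ) : ℕ∞) := by
        rw [← lintegral_indicator hB']
        refine lintegral_congr fun ω => ?_
        by_cases h : ω ∈ B <;> simp [h]
    _ ≤ ∫⁻ ω, B.indicator 1 ω * ∑' m, {ω | ∀ k, n < k → k ≤ n + m →
        chain (fun s o => ThreeE.step EX EY EZ aY aZ NX NY s o) (.onZ 0) ω k ∈
          alarmFree A}.indicator 1 ω ∂P EX EY EZ ((n + 1 : ℕ) : ℕ∞) := by
        refine lintegral_mono fun ω => ?_
        gcongr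
        exact alarm_add_one_tsub_le EX EY EZ haY haZ hA n ω
    _ = ∫⁻ ω, B.indicator 1 ω * F (threeEState EX EY EZ aY aZ NX NY ω n)
          ∂P EX EY EZ ((n + 1 : ℕ) : ℕ∞) := by
        simp only [threeEState_eq_chain]
        refine lintegral_chain_tsum hstep hgood (μ := postLaw EX EY EZ) (fun m hm => ?_) mB
          (fun ω N o hN => ?_) _
        · exact lawAt_of_le EX EY EZ (by omega)
        · refine indicator_one_congr (mem_info_congr hB fun k hk => ?_)
          have hkN : k ≠ N := by omega
          refine seen_congr EX EY EZ (threeEState_update EX EY EZ ω (by omega) o) ?_ ?_ ?_ <;>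
            simp [Function.update_of_ne hkN]
    _ ≤ ∫⁻ ω, (B.indicator 1 ω * F (.onZ 0) + B.indicator 1 ω *
          (threeEState EX EY EZ aY aZ NX NY ω n).duration (ENNReal.ofReal NX))
          ∂P EX EY EZ ((n + 1 : ℕ) : ℕ∞) := by
        refine lintegral_mono fun ω => ?_
        rw [← mul_add]
        gcongr
        exact hFs _ (reachable_threeEState EX EY EZ haY haZ ω n)
    _ ≤ ∫⁻ ω, B.indicator 1 ω * F (.onZ 0) ∂P EX EY EZ ((n + 1 : ℕ) : ℕ∞) +
          ∫⁻ ω, B.indicator 1 ω * D ∂P EX EY EZ ((n + 1 : ℕ) : ℕ∞) := by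
        rw [lintegral_add_left (mB.mul_const _)]
        refine add_le_add_right ?_ _
        exact lintegral_info_duration_le EX EY EZ haY haZ hNX hNY _ n hB hB'
    _ = (F (.onZ 0) + D) * P EX EY EZ ((n + 1 : ℕ) : ℕ∞) B := by
        rw [lintegral_mul_const _ mB, lintegral_mul_const _ mB, lintegral_indicator_one hB']
        ring

end

theorem lintegral_le_essSup_condLExp {Ω : Type*} {m mΩ : MeasurableSpace Ω} (hm : m ≤ mΩ)
    {Q : Measure Ω} [IsProbabilityMeasure Q] (X : Ω → ℝ≥0∞) :
    ∫⁻ ω, X ω ∂Q ≤ essSup (condLExp m Q X) Q := by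
  rw [← lintegral_condLExp hm Q X]
  calc _ ≤ ∫⁻ _, essSup (condLExp m Q X) Q ∂Q := lintegral_mono_ae (ENNReal.ae_le_essSup _)
    _ = _ := by simp

theorem one_add_mul_inv_one_sub {ρ : ℝ≥0∞} (h : ρ < 1) : 1 + ρ * (1 - ρ)⁻¹ = (1 - ρ)⁻¹ := by
  have h0 : 1 - ρ ≠ 0 := (tsub_pos_of_lt h).ne'
  have ht : 1 - ρ ≠ ∞ := ENNReal.sub_ne_top ENNReal.one_ne_top
  calc 1 + ρ * (1 - ρ)⁻¹ = (1 - ρ) * (1 - ρ)⁻¹ + ρ * (1 - ρ)⁻¹ := by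
        rw [ENNReal.mul_inv_cancel h0 ht]
    _ = (1 - ρ)⁻¹ := by rw [← add_mul, tsub_add_cancel_of_le h.le, one_mul]

/-! ### CUSUM as a chain -/

section Cusum

variable {𝓦 O : Type*} [MeasurableSpace 𝓦] [MeasurableSpace O] (E : Experiment 𝓦) (π : O → 𝓦)

/-- One step of CUSUM, with the threshold as the first component. -/
def cusumStep (s : EReal × EReal) (o : O) : EReal × EReal := (s.1, max (s.2 + E.llr (π o)) 0)

/-- The pairs of a threshold and a statistic that does not exceed it. -/
def belowThreshold : Set (EReal × EReal) := {p | p.2 ≤ p.1}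

theorem measurableSet_belowThreshold : MeasurableSet belowThreshold :=
  measurableSet_le measurable_snd measurable_fst

@[simp] theorem mk_mem_belowThreshold {h c : EReal} : (h, c) ∈ belowThreshold ↔ c ≤ h := Iff.rfl

variable {π}

theorem measurable_cusumStep (hπ : Measurable π) :
    Measurable (Function.uncurry (cusumStep E π)) :=
  measurable_fst.fst.prodMk
    ((measurable_fst.snd.add (E.measurable_llr.comp (hπ.comp measurable_snd))).max
      measurable_const)

theorem chain_cusumStep (h : EReal) (ω : ℕ → O) (n : ℕ) :
    chain (cusumStep E π) (h, 0) ω n = (h, cusumStat E (fun n => π (ω n)) n) := by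
  induction n with
  | zero => rfl
  | succ n ih => rw [chain, ih, cusumStep, cusumStat]

theorem lintegral_cusumTime {μ : Measure O} [IsProbabilityMeasure μ] (hπ : Measurable π)
    (h : EReal) :
    ∫⁻ ω, (cusumTime E h (fun n => π (ω n)) : ℝ≥0∞) ∂Measure.infinitePi (fun _ : ℕ => μ) =
      potential μ (cusumStep E π) belowThreshold 1 (h, 0) :=
  lintegral_firstTime_chain (measurable_cusumStep E hπ) measurableSet_belowThreshold _
    fun ω k => by rw [chain_cusumStep, mk_mem_belowThreshold, not_le]

end Cusum

/-! ### Comparison of the post-change mean delay with CUSUM for `Z` -/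

section

variable {𝓧 𝓨 𝓩 : Type*} [MeasurableSpace 𝓧] [MeasurableSpace 𝓨] [MeasurableSpace 𝓩]
variable (EX : Experiment 𝓧) (EY : Experiment 𝓨) (EZ : Experiment 𝓩) {aY aZ NX NY : ℝ}

/-- Only $\nu=1$ is used: the essential supremum of the conditional delay dominates its mean, which
is the mean post-change run length of CUSUM. -/
theorem meanAlarm_le_wadd_cusumZ (A : ℝ) :
    potential (postLaw EX EY EZ) (cusumStep EZ fun o : Datum 𝓧 𝓨 𝓩 => o.2.2.1) belowThreshold 1
      ((A : EReal), 0) ≤ wadd EX EY EZ (cusumZ (𝓧 := 𝓧) (𝓨 := 𝓨) EZ A) := by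
  have hm : (cusumZ (𝓧 := 𝓧) (𝓨 := 𝓨) EZ A).info 0 ≤
      (MeasurableSpace.pi : MeasurableSpace (Path 𝓧 𝓨 𝓩)) :=
    (measurable_pi_lambda _ fun k : Fin 0 => k.elim0).comap_le
  rw [wadd]
  refine le_iSup₂_of_le 1 le_rfl ?_
  refine le_trans (le_of_eq ?_) (lintegral_le_essSup_condLExp hm _)
  rw [← lintegral_cusumTime EZ measurable_snd.snd.fst, Nat.cast_one, P_one]
  refine lintegral_congr fun ω => ?_
  rw [Nat.cast_one, ENNReal.add_sub_cancel_right ENNReal.one_ne_top]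
  rfl

theorem lintegral_obsZ_mul_uniform (α : Measure 𝓧) (β : Measure 𝓨) (γ : Measure 𝓩)
    [IsProbabilityMeasure α] [IsProbabilityMeasure β] [IsProbabilityMeasure γ]
    {f : 𝓩 → ℝ≥0∞} {g : unitInterval → ℝ≥0∞} (hf : Measurable f) (hg : Measurable g) :
    ∫⁻ o : Datum 𝓧 𝓨 𝓩, f o.2.2.1 * g o.2.2.2.2 ∂jointLaw α β γ =
      (∫⁻ z, f z ∂γ) * ∫⁻ v, g v := by
  have m : Measurable (Function.uncurry fun (z : 𝓩) (v : unitInterval) => f z * g v) :=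
    (hf.comp measurable_fst).mul (hg.comp measurable_snd)
  rw [lintegral_obsZ_uniform α β γ (g := fun z v => f z * g v) m]
  simp_rw [lintegral_const_mul _ hg]
  exact lintegral_mul_const _ hf

/-- The decay of the mean number of falls below zero after the change, in terms of the statistic
of `Z`. -/
theorem lintegral_fall_le {ρ : ℝ≥0∞} (hρ : EZ.affinity = ρ) (h1 : ρ < 1) {d : EReal}
    (hd : 0 ≤ d) {φ : 𝓩 → ℝ≥0∞} (hφ : ∀ z, φ z ≤ if d + EZ.llr z < 0 then (1 - ρ)⁻¹ else
      (d + EZ.llr z).exp ^ (-(1 / 2) : ℝ) * (ρ * (1 - ρ)⁻¹)) :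
    ∫⁻ z, φ z ∂EZ.post ≤ d.exp ^ (-(1 / 2) : ℝ) * (ρ * (1 - ρ)⁻¹) := by
  have hd0 : d.exp ≠ 0 := by
    rw [Ne, EReal.exp_eq_zero_iff]
    rintro rfl
    simp at hd
  -- One bound serves both cases: after a fall $e^{-(d+\ell)/2}\ge1$, and otherwise
  -- $\rho/(1-\rho)\le1/(1-\rho)$. Its mean brings in the factor $\rho$.
  have hle : ∀ᵐ z ∂EZ.post, φ z ≤
      d.exp ^ (-(1 / 2) : ℝ) * (EZ.llr z).exp ^ (-(1 / 2) : ℝ) * (1 - ρ)⁻¹ := by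
    filter_upwards [EZ.ae_post_llr_ne_bot] with z hz
    have hz0 : (EZ.llr z).exp ≠ 0 := by rwa [Ne, EReal.exp_eq_zero_iff]
    rw [← ENNReal.mul_rpow_of_ne_zero hd0 hz0, ← EReal.exp_add]
    refine (hφ z).trans ?_
    split_ifs with h
    · refine le_mul_of_one_le_left' (ENNReal.one_le_rpow_of_pos_of_le_one_of_neg ?_ ?_ (by norm_num))
      · rw [EReal.exp_add]
        exact pos_iff_ne_zero.2 (mul_ne_zero hd0 hz0)
      · simpa using EReal.exp_monotone h.le
    · refine mul_le_mul_right ?_ _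
      nth_rewrite 2 [← one_add_mul_inv_one_sub h1]
      exact le_add_self
  have m := EZ.measurable_exp_llr.pow_const (-(1 / 2) : ℝ)
  refine (lintegral_mono_ae hle).trans (le_of_eq ?_)
  rw [lintegral_mul_const _ (m.const_mul _), lintegral_const_mul _ m,
    EZ.lintegral_exp_llr_rpow_post, hρ, mul_assoc]

/-- On the same data the `Z` statistic moves like CUSUM, with a 2E-CUSUM execution inserted at each
fall. Here $e^{-d/2}\rho/(1-\rho)$ bounds the mean number of falls from level $d$, uniformly in $A$,
and `D` the mean cost of one. A fall at this step and the later ones add up by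
$1+\rho/(1-\rho)=1/(1-\rho)$. -/
theorem partialPotential_le_cusum (hNX : 0 ≤ NX) (hNY : 0 ≤ NY) {ρ : ℝ≥0∞}
    (hρ : EZ.affinity = ρ) (h1 : ρ < 1) {A : EReal} (hA : 0 ≤ A) (M : ℕ) :
    ∀ d, 0 ≤ d → partialPotential (postLaw EX EY EZ)
        (fun s o => ThreeE.step EX EY EZ aY aZ NX NY s o) (alarmFree A) M 1 (.onZ d) ≤
      potential (postLaw EX EY EZ) (cusumStep EZ fun o : Datum 𝓧 𝓨 𝓩 => o.2.2.1)
          belowThreshold 1 (A, d) +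
        (ENNReal.ofReal NY + ENNReal.ofReal NY * ENNReal.ofReal NX) *
          (d.exp ^ (-(1 / 2) : ℝ) * (ρ * (1 - ρ)⁻¹)) := by
  set D := ENNReal.ofReal NY + ENNReal.ofReal NY * ENNReal.ofReal NX with hD
  have hstep := measurable_threeE_step EX EY EZ aY aZ NX NY
  have hgood := measurableSet_alarmFree A
  have hsucc := partialPotential_succ (μ := postLaw EX EY EZ) hstep hgood
    (measurable_one : Measurable (1 : ThreeE → ℝ≥0∞))
  have mπ : Measurable fun o : Datum 𝓧 𝓨 𝓩 => o.2.2.1 := measurable_snd.snd.fst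
  have mC := measurable_cusumStep EZ mπ
  set C := potential (postLaw EX EY EZ) (cusumStep EZ fun o : Datum 𝓧 𝓨 𝓩 => o.2.2.1)
    belowThreshold 1 with hC
  have mCp : Measurable C := measurable_potential mC measurableSet_belowThreshold measurable_one
  induction M with
  | zero => simp
  | succ M ih =>
    intro d hd
    have mfall : Measurable fun z : 𝓩 => {z | d + EZ.llr z < 0}.indicator (1 : 𝓩 → ℝ≥0∞) z :=
      measurable_one.indicator (measurableSet_lt (EZ.measurable_llr.const_add d) measurable_const)
    set φ : 𝓩 → ℝ≥0∞ := fun z => if d + EZ.llr z < 0 then ρ * (1 - ρ)⁻¹ else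
      (d + EZ.llr z).exp ^ (-(1 / 2) : ℝ) * (ρ * (1 - ρ)⁻¹) with hφ
    have mφ : Measurable φ :=
      Measurable.ite (measurableSet_lt (EZ.measurable_llr.const_add d) measurable_const)
        measurable_const (((EZ.measurable_llr.const_add d).ereal_exp.pow_const _).mul_const _)
    set g : unitInterval → ℝ≥0∞ := fun v =>
      (TwoE.start (randomLimit NY v)).duration (ENNReal.ofReal NX) with hg
    have mg : Measurable g := (TwoE.measurable_duration _).comp
      (measurable_start.comp (measurable_randomLimit NY))
    have hgD : ∫⁻ v, g v ≤ D := by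
      have := lintegral_duration_start_le EX.post EY.post EZ.post hNY (ENNReal.ofReal NX)
      have h2 := lintegral_obsZ_mul_uniform EX.post EY.post EZ.post (f := 1) measurable_one mg
      simp only [Pi.one_apply, one_mul, lintegral_one, measure_univ] at h2
      rwa [← h2]
    have hind : Measurable fun o : Datum 𝓧 𝓨 𝓩 =>
        belowThreshold.indicator C (cusumStep EZ (fun o : Datum 𝓧 𝓨 𝓩 => o.2.2.1) (A, d) o) :=
      (mCp.indicator measurableSet_belowThreshold).comp (mC.comp measurable_prodMk_left)
    calc _ ≤ 1 + ∫⁻ o, (belowThreshold.indicator C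
              (cusumStep EZ (fun o : Datum 𝓧 𝓨 𝓩 => o.2.2.1) (A, d) o) +
            ({z | d + EZ.llr z < 0}.indicator (1 : 𝓩 → ℝ≥0∞) o.2.2.1 * g o.2.2.2.2 +
              D * φ o.2.2.1)) ∂postLaw EX EY EZ := by
          rw [hsucc]
          refine add_le_add_right (lintegral_mono fun o => ?_) _
          simp only [ThreeE.step, cusumStep]
          by_cases h' : d + EZ.llr o.2.2.1 < 0
          · rw [if_pos h', Set.indicator_of_mem (resume_mem_alarmFree hA _ _),
              max_eq_right h'.le, Set.indicator_of_mem (mk_mem_belowThreshold.2 hA),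
              Set.indicator_of_mem (by exact h'), Pi.one_apply, one_mul, hφ]
            simp only [if_pos h']
            refine (partialPotential_resume_le EX EY EZ EX.post EY.post EZ.post hNX hA M _ _).trans ?_
            rw [add_left_comm]
            refine add_le_add_right ?_ _
            simpa [postLaw_eq] using ih 0 le_rfl
          · have h0 := not_lt.1 h'
            rw [if_neg h', max_eq_left h0, Set.indicator_of_notMem (s := {z | _}) (by exact h'),
              zero_mul, zero_add, hφ]
            simp only [if_neg h']
            by_cases hA' : d + EZ.llr o.2.2.1 ≤ A
            · rw [Set.indicator_of_mem (by simpa using hA'), Set.indicator_of_mem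
                (mk_mem_belowThreshold.2 hA')]
              exact ih _ h0
            · rw [Set.indicator_of_notMem (by simpa using hA')]
              exact zero_le
      _ ≤ 1 + (∫⁻ o, belowThreshold.indicator C
              (cusumStep EZ (fun o : Datum 𝓧 𝓨 𝓩 => o.2.2.1) (A, d) o) ∂postLaw EX EY EZ +
            D * (d.exp ^ (-(1 / 2) : ℝ) * (ρ * (1 - ρ)⁻¹))) := by
          refine add_le_add_right ?_ _
          rw [lintegral_add_left hind]
          refine add_le_add_right ?_ _
          have m1 : Measurable fun o : Datum 𝓧 𝓨 𝓩 =>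
              {z | d + EZ.llr z < 0}.indicator (1 : 𝓩 → ℝ≥0∞) o.2.2.1 * g o.2.2.2.2 :=
            (mfall.comp mπ).mul (mg.comp measurable_snd.snd.snd.snd)
          rw [lintegral_add_left m1, postLaw_eq,
            lintegral_obsZ_mul_uniform _ _ _ mfall mg,
            lintegral_obsZ EX.post EY.post EZ.post (g := fun z => D * φ z) (mφ.const_mul D),
            lintegral_const_mul _ mφ, mul_comm]
          calc _ ≤ D * (∫⁻ z, {z | d + EZ.llr z < 0}.indicator (1 : 𝓩 → ℝ≥0∞) z ∂EZ.post) +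
                D * ∫⁻ z, φ z ∂EZ.post := add_le_add_left (mul_le_mul_left hgD _) _
            _ = D * ∫⁻ z, ({z | d + EZ.llr z < 0}.indicator (1 : 𝓩 → ℝ≥0∞) z + φ z)
                  ∂EZ.post := by rw [lintegral_add_left mfall, mul_add]
            _ ≤ _ := by
              refine mul_le_mul_right (lintegral_fall_le EZ hρ h1 hd fun z => ?_) _
              by_cases h' : d + EZ.llr z < 0
              · rw [Set.indicator_of_mem (by exact h'), if_pos h', hφ]
                simp only [if_pos h', Pi.one_apply]
                exact (one_add_mul_inv_one_sub h1).le
              · rw [Set.indicator_of_notMem (by exact h'), if_neg h', hφ]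
                simp only [if_neg h', zero_add]
                exact le_rfl
      _ = _ := by
          rw [← add_assoc, hC, potential_eq mC measurableSet_belowThreshold measurable_one (A, d)]
          rfl

theorem exists_meanAlarm_le_wadd_cusumZ (h : 0 < EZ.kl) (haY : 0 < aY) (haZ : 0 < aZ)
    (hNX : 0 ≤ NX) (hNY : 0 ≤ NY) :
    ∃ K : ℝ≥0, ∀ A : ℝ, 0 < A →
      meanAlarm EX EY EZ 1 (psi3E EX EY EZ A aY aZ NX NY) + ENNReal.ofReal (NY + NY * NX) ≤
        wadd EX EY EZ (cusumZ (𝓧 := 𝓧) (𝓨 := 𝓨) EZ A) + K := by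
  have hρ := EZ.affinity_lt_one h
  set ρ := EZ.affinity with hρ'
  set D := ENNReal.ofReal NY + ENNReal.ofReal NY * ENNReal.ofReal NX with hD
  have hinv : (1 - ρ)⁻¹ ≠ ∞ := ENNReal.inv_ne_top.2 (tsub_pos_of_lt hρ).ne'
  have hD' : ENNReal.ofReal (NY + NY * NX) = D := by
    rw [ENNReal.ofReal_add hNY (mul_nonneg hNY hNX), ENNReal.ofReal_mul hNY]
  have hDt : D ≠ ∞ := hD' ▸ ENNReal.ofReal_ne_top
  -- The first summand is the total cost of the falls from level $0$; the second is the additive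
  -- $N_Y+N_YN_X$ of the claim.
  refine ⟨(D * (ρ * (1 - ρ)⁻¹) + D).toNNReal, fun A hA => ?_⟩
  have hA' : (0 : EReal) ≤ A := by exact_mod_cast hA.le
  rw [ENNReal.coe_toNNReal (by finiteness [hρ.ne_top]), hD', ← add_assoc (wadd EX EY EZ _)]
  refine add_le_add ?_ le_rfl
  rw [meanAlarm, P_one, lintegral_alarm_eq EX EY EZ haY haZ hA.le]
  refine potential_le fun M => ?_
  refine (partialPotential_le_cusum EX EY EZ hNX hNY hρ'.symm hρ hA' M 0 le_rfl).trans ?_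
  rw [EReal.exp_zero, ENNReal.one_rpow, one_mul]
  exact add_le_add (meanAlarm_le_wadd_cusumZ EX EY EZ A) le_rfl

end

/-! ### Long-run averages of renewal type -/

/-- Here `F n` is the mean reward earned at time `n`, `r n` the mean reward still to come in the
current cycle, `e n` the probability that the cycle ends in that step, and `R` the reward of a full
cycle. The equations telescope. -/
theorem sum_add_eq_of_cycle {F r e : ℕ → ℝ≥0∞} {R : ℝ≥0∞} (h0 : r 0 = R)
    (h : ∀ n, F n + r (n + 1) = r n + e n * R) (n : ℕ) :
    ∑ k ∈ Finset.range n, F k + r n = R * (1 + ∑ k ∈ Finset.range n, e k) := by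
  induction n with
  | zero => simp [h0]
  | succ n ih =>
    rw [Finset.sum_range_succ, Finset.sum_range_succ, add_assoc, h, ← add_assoc, ih]
    ring

theorem limsup_eq_of_near {u v : ℕ → ℝ≥0∞} {q : ℝ≥0∞} (hq : q ≠ ∞) (hv : Tendsto v atTop (nhds 0))
    (h1 : ∀ᶠ n in atTop, u n ≤ q + v n) (h2 : ∀ᶠ n in atTop, q ≤ u n + v n) :
    limsup u atTop = q := by
  refine le_antisymm ?_ ?_
  · calc limsup u atTop ≤ limsup (fun n => q + v n) atTop := limsup_le_limsup h1
      _ = q := by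
        have : Tendsto (fun n => q + v n) atTop (nhds (q + 0)) := tendsto_const_nhds.add hv
        rw [this.limsup_eq, add_zero]
  · have : Tendsto (fun n => q - v n) atTop (nhds (q - 0)) :=
      ENNReal.Tendsto.sub tendsto_const_nhds hv (Or.inl hq)
    rw [tsub_zero] at this
    rw [← this.limsup_eq]
    exact limsup_le_limsup (h2.mono fun n hn => tsub_le_iff_right.2 hn)

/-- The common cycle count `c` is eliminated between the identity for the reward and the one for the
time. The unfinished cycles are bounded by `C` and disappear on division by `n`, so the average
actually converges. -/
theorem limsup_average_eq {F r t c : ℕ → ℝ≥0∞} {R T C : ℝ≥0∞} (hR : R ≠ ∞) (hT : T ≠ ∞)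
    (hC : C ≠ ∞) (hr : ∀ n, r n ≤ C) (ht : ∀ n, t n ≤ C)
    (hF : ∀ n, ∑ k ∈ Finset.range n, F k + r n = R * c n)
    (hn : ∀ n : ℕ, (n : ℝ≥0∞) + t n = T * c n) :
    limsup (fun n : ℕ => (∑ k ∈ Finset.range (n - 1), F k) / (n : ℝ≥0∞)) atTop = R / T := by
  have hT0 : T ≠ 0 := by
    rintro rfl
    have := hn 1
    simp at this
  have hm : ∀ n, (∑ k ∈ Finset.range n, F k) * T + r n * T = R * (n + t n) := fun n => by
    rw [hn, ← add_mul, hF]; ring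
  set q := R / T with hq
  have hqT : q * T = R := ENNReal.div_mul_cancel hT0 hT
  have hqt : q ≠ ∞ := ENNReal.div_ne_top hR hT0
  have hup : ∀ n, ∑ k ∈ Finset.range n, F k ≤ q * n + q * C := fun n => by
    have : (∑ k ∈ Finset.range n, F k) * T ≤ (q * n + q * C) * T := by
      calc _ ≤ R * (n + t n) := hm n ▸ le_self_add
        _ ≤ R * (n + C) := mul_le_mul_right (add_le_add_right (ht n) _) _
        _ = _ := by rw [← hqT]; ring
    exact (ENNReal.mul_le_mul_iff_left hT0 hT).1 this
  have hlow : ∀ n : ℕ, q * n ≤ ∑ k ∈ Finset.range n, F k + C := fun n => by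
    have : q * n * T ≤ (∑ k ∈ Finset.range n, F k + C) * T := by
      calc q * n * T = R * n := by rw [← hqT]; ring
        _ ≤ R * (n + t n) := mul_le_mul_right le_self_add _
        _ ≤ _ := by
          rw [← hm n, add_mul]
          exact add_le_add_right (mul_le_mul_left (hr n) _) _
    exact (ENNReal.mul_le_mul_iff_left hT0 hT).1 this
  -- In the numerator, `q * C` and `C` bound the unfinished cycle in the upper and lower estimate,
  -- and the final `q` accounts for summing only to `n - 1`.
  refine limsup_eq_of_near hqt (v := fun n => (q * C + C + q) / (n : ℝ≥0∞)) ?_ ?_ ?_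
  · exact ENNReal.Tendsto.const_div ENNReal.tendsto_nat_nhds_top (Or.inr (by finiteness)) |>.trans
      (by simp)
  · filter_upwards [eventually_ge_atTop 1] with n hn1
    have hn0 : (n : ℝ≥0∞) ≠ 0 := by simpa using (by omega : n ≠ 0)
    rw [← ENNReal.mul_le_mul_iff_left hn0 (ENNReal.natCast_ne_top n), add_mul,
      ENNReal.div_mul_cancel hn0 (ENNReal.natCast_ne_top n),
      ENNReal.div_mul_cancel hn0 (ENNReal.natCast_ne_top n)]
    refine (hup (n - 1)).trans ?_
    refine add_le_add (mul_le_mul_right (by exact_mod_cast Nat.sub_le n 1) _) ?_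
    rw [add_assoc]
    exact le_self_add
  · filter_upwards [eventually_ge_atTop 1] with n hn1
    have hn0 : (n : ℝ≥0∞) ≠ 0 := by simpa using (by omega : n ≠ 0)
    rw [← ENNReal.mul_le_mul_iff_left hn0 (ENNReal.natCast_ne_top n), add_mul,
      ENNReal.div_mul_cancel hn0 (ENNReal.natCast_ne_top n),
      ENNReal.div_mul_cancel hn0 (ENNReal.natCast_ne_top n)]
    have : (n : ℝ≥0∞) = ((n - 1 : ℕ) : ℝ≥0∞) + 1 := by
      have : n = n - 1 + 1 := by omega
      exact_mod_cast this
    calc q * n = q * (n - 1 : ℕ) + q := by rw [this]; simp [mul_add]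
      _ ≤ ∑ k ∈ Finset.range (n - 1), F k + C + q := add_le_add_left (hlow _) _
      _ ≤ _ := by
        rw [add_assoc]
        refine add_le_add_right ?_ _
        rw [add_assoc]
        exact le_add_self

/-! ### Cycles of the 3E-CUSUM algorithm -/

/-- The random walk with increments the log-likelihood ratios of `Z`. -/
def walkStep {𝓧 𝓨 𝓩 : Type*} [MeasurableSpace 𝓩] (EZ : Experiment 𝓩) (d : EReal)
    (o : Datum 𝓧 𝓨 𝓩) : EReal :=
  d + EZ.llr o.2.2.1

section

variable {𝓧 𝓨 𝓩 : Type*} [MeasurableSpace 𝓧] [MeasurableSpace 𝓨] [MeasurableSpace 𝓩]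
variable (EX : Experiment 𝓧) (EY : Experiment 𝓨) (EZ : Experiment 𝓩) {aY aZ NX NY : ℝ}

theorem measurable_walkStep :
    Measurable (Function.uncurry (walkStep (𝓧 := 𝓧) (𝓨 := 𝓨) EZ)) :=
  measurable_fst.add (EZ.measurable_llr.comp measurable_snd.snd.snd.fst)

theorem measurable_walkStep_left (d : EReal) :
    Measurable (walkStep (𝓧 := 𝓧) (𝓨 := 𝓨) EZ d) :=
  (measurable_walkStep EZ).comp measurable_prodMk_left

/-- The mean of a function of the undershoot, if the walk falls below zero at the next step. -/
def fallMean (φ : EReal → ℝ≥0∞) (d : EReal) : ℝ≥0∞ :=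
  ∫⁻ o, (Set.Iio 0).indicator φ (walkStep EZ d o) ∂preLaw EX EY EZ

/-- The mean of a reward that is collected by the truncated 2E-CUSUM algorithm, when it is started
at the level `aZ x`. -/
def startMean (aZ NY : ℝ) (R : EReal → TwoE → ℝ≥0∞) (x : EReal) : ℝ≥0∞ :=
  ∫⁻ v, R (-((aZ : EReal) * x)) (TwoE.start (randomLimit NY v))

/-- The mean total reward in one descent of the walk below zero. -/
def walkPotential (ψ : EReal → ℝ≥0∞) : EReal → ℝ≥0∞ :=
  potential (preLaw EX EY EZ) (walkStep EZ) (Set.Ici 0) ψ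

/-- The mean reward until the end of the current cycle, if each observation of `Z` earns `c` and
`R` is the mean reward until the truncated 2E-CUSUM algorithm stops. -/
def cycleReward (aZ NY : ℝ) (c : ℝ≥0∞) (R : EReal → TwoE → ℝ≥0∞) : ThreeE → ℝ≥0∞
  | .onZ d => walkPotential EX EY EZ (fun d => c + fallMean EX EY EZ (startMean aZ NY R) d) d
  | .below h s => R h s

/-- The probability that the current cycle ends at the next instant. -/
def cycleEnd (aY NX NY : ℝ) : ThreeE → ℝ≥0∞
  | .onZ d => ∫⁻ o, (Set.Iio (0 : EReal)).indicator 1 (walkStep EZ d o) *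
      {s | s = .done}.indicator 1 (TwoE.start (randomLimit NY o.2.2.2.2)) ∂preLaw EX EY EZ
  | .below h s => ∫⁻ o, {s | s = .done}.indicator 1 (s.step EX EY aY NX h o) ∂preLaw EX EY EZ

variable {R : EReal → TwoE → ℝ≥0∞}

theorem measurable_fallMean {φ : EReal → ℝ≥0∞} (hφ : Measurable φ) :
    Measurable (fallMean EX EY EZ φ) :=
  ((hφ.indicator measurableSet_Iio).comp (measurable_walkStep EZ)).lintegral_prod_right'

theorem measurable_reward_start (hR : Measurable (Function.uncurry R)) :
    Measurable fun p : EReal × unitInterval =>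
      R (-((aZ : EReal) * p.1)) (TwoE.start (randomLimit NY p.2)) :=
  hR.comp ((measurable_fst.const_mul _).neg.prodMk
    ((measurable_start.comp (measurable_randomLimit NY)).comp measurable_snd))

theorem measurable_startMean (hR : Measurable (Function.uncurry R)) :
    Measurable (startMean aZ NY R) :=
  (measurable_reward_start hR).lintegral_prod_right'

theorem measurable_walkPotential {ψ : EReal → ℝ≥0∞} (hψ : Measurable ψ) :
    Measurable (walkPotential EX EY EZ ψ) :=
  measurable_potential (measurable_walkStep EZ) measurableSet_Ici hψ

theorem measurable_cycleReward (c : ℝ≥0∞) (hR : Measurable (Function.uncurry R)) :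
    Measurable (cycleReward EX EY EZ aZ NY c R) := by
  refine ThreeE.measurable_elim (t := id) measurable_id
    (F := fun _ s => cycleReward EX EY EZ aZ NY c R s) ?_ ?_
  · exact (measurable_walkPotential EX EY EZ
      ((measurable_fallMean EX EY EZ (measurable_startMean hR)).const_add c)).comp measurable_snd
  · exact hR.comp measurable_snd

/-- The limit for `Y` is drawn with a uniform of the instant of the fall, independent of the `Z`
observation, so it may be averaged for a given undershoot. -/
theorem fallMean_startMean (hR : Measurable (Function.uncurry R)) (d : EReal) :
    fallMean EX EY EZ (startMean aZ NY R) d = ∫⁻ o : Datum 𝓧 𝓨 𝓩,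
      (Set.Iio (0 : EReal)).indicator 1 (walkStep EZ d o) *
        R (-((aZ : EReal) * walkStep EZ d o)) (TwoE.start (randomLimit NY o.2.2.2.2))
      ∂preLaw EX EY EZ := by
  have m1 : Measurable fun z => d + EZ.llr z := EZ.measurable_llr.const_add d
  have m2 : Measurable fun z => (Set.Iio (0 : EReal)).indicator (1 : EReal → ℝ≥0∞)
      (d + EZ.llr z) := (measurable_one.indicator measurableSet_Iio).comp m1
  have m3 := measurable_reward_start (aZ := aZ) (NY := NY) hR
  have m4 : Measurable (Function.uncurry fun (z : 𝓩) (v : unitInterval) =>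
      (Set.Iio (0 : EReal)).indicator (1 : EReal → ℝ≥0∞) (d + EZ.llr z) *
        R (-((aZ : EReal) * (d + EZ.llr z))) (TwoE.start (randomLimit NY v))) :=
    (m2.comp measurable_fst).mul (m3.comp ((m1.comp measurable_fst).prodMk measurable_snd))
  have m5 : Measurable fun z => (Set.Iio (0 : EReal)).indicator (startMean aZ NY R)
      (d + EZ.llr z) := ((measurable_startMean hR).indicator measurableSet_Iio).comp m1
  have h1 := lintegral_obsZ_uniform EX.pre EY.pre EZ.pre m4
  have h2 := lintegral_obsZ EX.pre EY.pre EZ.pre m5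
  rw [fallMean, preLaw_eq]
  simp only [walkStep]
  rw [h1, h2]
  refine lintegral_congr fun z => ?_
  by_cases hz : d + EZ.llr z < 0
  · rw [Set.indicator_of_mem (by exact hz), Set.indicator_of_mem (by exact hz)]
    simp [startMean]
  · rw [Set.indicator_of_notMem (by exact hz), Set.indicator_of_notMem (by exact hz)]
    simp

theorem cycleReward_resume (c : ℝ≥0∞) (hdone : ∀ h, R h .done = 0) (h : EReal) (s : TwoE) :
    cycleReward EX EY EZ aZ NY c R (.resume h s) = R h s +
      {s | s = .done}.indicator 1 s * cycleReward EX EY EZ aZ NY c R (.onZ 0) := by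
  by_cases hs : s = .done
  · subst hs; simp [hdone]
  · rw [ThreeE.resume_of_ne hs, Set.indicator_of_notMem (by exact hs), zero_mul, add_zero]
    rfl

/-- The chain goes on after the end of a cycle, and the state reached then already carries the
reward of the next cycle: this excess is the `cycleEnd` term. From a state of `Z` the cycle can end
at once only through a drawn `Y` limit of $0$. -/
theorem cycleReward_onZ (c : ℝ≥0∞) (hR : Measurable (Function.uncurry R))
    (hdone : ∀ h, R h .done = 0) (d : EReal) :
    c + ∫⁻ o, cycleReward EX EY EZ aZ NY c R (ThreeE.step EX EY EZ aY aZ NX NY (.onZ d) o)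
        ∂preLaw EX EY EZ =
      cycleReward EX EY EZ aZ NY c R (.onZ d) +
        cycleEnd EX EY EZ aY NX NY (.onZ d) * cycleReward EX EY EZ aZ NY c R (.onZ 0) := by
  set R₀ := cycleReward EX EY EZ aZ NY c R (.onZ 0) with hR₀
  set ψ := fun d => c + fallMean EX EY EZ (startMean aZ NY R) d with hψ
  have mψ : Measurable ψ := (measurable_fallMean EX EY EZ (measurable_startMean hR)).const_add c
  have mw := measurable_walkStep_left (𝓧 := 𝓧) (𝓨 := 𝓨) EZ d
  have mI : Measurable fun o : Datum 𝓧 𝓨 𝓩 =>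
      (Set.Iio (0 : EReal)).indicator (1 : EReal → ℝ≥0∞) (walkStep EZ d o) :=
    (measurable_one.indicator measurableSet_Iio).comp mw
  have m1 : Measurable fun o : Datum 𝓧 𝓨 𝓩 => (Set.Ici 0).indicator (walkPotential EX EY EZ ψ)
      (walkStep EZ d o) := ((measurable_walkPotential EX EY EZ mψ).indicator measurableSet_Ici).comp mw
  have m2 : Measurable fun o : Datum 𝓧 𝓨 𝓩 =>
      (Set.Iio (0 : EReal)).indicator (1 : EReal → ℝ≥0∞) (walkStep EZ d o) *
        R (-((aZ : EReal) * walkStep EZ d o)) (TwoE.start (randomLimit NY o.2.2.2.2)) :=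
    mI.mul ((measurable_reward_start hR).comp (mw.prodMk measurable_snd.snd.snd.snd))
  have m3 : Measurable fun o : Datum 𝓧 𝓨 𝓩 =>
      (Set.Iio (0 : EReal)).indicator (1 : EReal → ℝ≥0∞) (walkStep EZ d o) *
        {s | s = .done}.indicator (1 : TwoE → ℝ≥0∞) (TwoE.start (randomLimit NY o.2.2.2.2)) :=
    mI.mul ((measurable_one.indicator TwoE.measurableSet_done).comp
      ((measurable_start.comp (measurable_randomLimit NY)).comp measurable_snd.snd.snd.snd))
  have hpt : ∀ o : Datum 𝓧 𝓨 𝓩, cycleReward EX EY EZ aZ NY c R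
      (ThreeE.step EX EY EZ aY aZ NX NY (.onZ d) o) =
      (Set.Ici 0).indicator (walkPotential EX EY EZ ψ) (walkStep EZ d o) +
      ((Set.Iio (0 : EReal)).indicator 1 (walkStep EZ d o) *
        R (-((aZ : EReal) * walkStep EZ d o)) (TwoE.start (randomLimit NY o.2.2.2.2)) +
      (Set.Iio (0 : EReal)).indicator 1 (walkStep EZ d o) *
        {s | s = .done}.indicator 1 (TwoE.start (randomLimit NY o.2.2.2.2)) * R₀) := by
    intro o
    simp only [ThreeE.step]
    by_cases h : d + EZ.llr o.2.2.1 < 0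
    · have h' : walkStep EZ d o ∈ Set.Iio (0 : EReal) := h
      rw [if_pos h, cycleReward_resume EX EY EZ c hdone, Set.indicator_of_mem h',
        Set.indicator_of_notMem (s := Set.Ici (0 : EReal)) (by simpa using h')]
      simp only [Pi.one_apply, one_mul, zero_add]
      rfl
    · have h' : walkStep EZ d o ∉ Set.Iio (0 : EReal) := h
      rw [if_neg h, Set.indicator_of_notMem h', Set.indicator_of_mem (by simpa using h')]
      simp only [zero_mul, add_zero]
      rfl
  rw [lintegral_congr hpt, lintegral_add_left m1, lintegral_add_left m2, lintegral_mul_const _ m3,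
    ← fallMean_startMean EX EY EZ hR]
  have hpot : cycleReward EX EY EZ aZ NY c R (.onZ d) = ψ d + ∫⁻ o,
      (Set.Ici 0).indicator (walkPotential EX EY EZ ψ) (walkStep EZ d o) ∂preLaw EX EY EZ :=
    potential_eq (μ := preLaw EX EY EZ) (good := Set.Ici 0) (measurable_walkStep EZ)
      measurableSet_Ici mψ d
  rw [hpot, cycleEnd]
  simp only [hψ]
  ring

theorem cycleReward_below (c : ℝ≥0∞) (hR : Measurable (Function.uncurry R))
    (hdone : ∀ h, R h .done = 0) {h : EReal} {s : TwoE} {f : ℝ≥0∞}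
    (heq : f + ∫⁻ o : Datum 𝓧 𝓨 𝓩, R h (s.step EX EY aY NX h o) ∂preLaw EX EY EZ = R h s) :
    f + ∫⁻ o, cycleReward EX EY EZ aZ NY c R (ThreeE.step EX EY EZ aY aZ NX NY (.below h s) o)
        ∂preLaw EX EY EZ =
      cycleReward EX EY EZ aZ NY c R (.below h s) +
        cycleEnd EX EY EZ aY NX NY (.below h s) * cycleReward EX EY EZ aZ NY c R (.onZ 0) := by
  have ms : Measurable fun o : Datum 𝓧 𝓨 𝓩 => s.step EX EY aY NX h o :=
    measurable_twoE_step EX EY aY NX measurable_const measurable_const measurable_id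
  have m1 : Measurable fun o : Datum 𝓧 𝓨 𝓩 => R h (s.step EX EY aY NX h o) :=
    hR.comp (measurable_const.prodMk ms)
  have m2 : Measurable fun o : Datum 𝓧 𝓨 𝓩 =>
      {s | s = .done}.indicator (1 : TwoE → ℝ≥0∞) (s.step EX EY aY NX h o) :=
    (measurable_one.indicator TwoE.measurableSet_done).comp ms
  simp only [ThreeE.step, cycleReward_resume EX EY EZ c hdone]
  rw [lintegral_add_left m1, lintegral_mul_const _ m2, ← add_assoc, heq]
  rfl

end

theorem potential_add {S O : Type*} [MeasurableSpace S] [MeasurableSpace O] {μ : Measure O}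
    [SFinite μ] {step : S → O → S} {good : Set S} {f g : S → ℝ≥0∞}
    (hstep : Measurable (Function.uncurry step)) (hgood : MeasurableSet good)
    (hf : Measurable f) (s : S) :
    potential μ step good (f + g) s = potential μ step good f s + potential μ step good g s := by
  have : ∀ m, (killed μ step good)^[m] (f + g) =
      (killed μ step good)^[m] f + (killed μ step good)^[m] g := by
    intro m
    induction m with
    | zero => rfl
    | succ m ih =>
      rw [Function.iterate_succ_apply', ih, Function.iterate_succ_apply',
        Function.iterate_succ_apply']
      funext s
      exact killed_add hstep hgood (measurable_iterate_killed hstep hgood hf m) s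
  simp only [potential, this, Pi.add_apply]
  exact ENNReal.tsum_add

theorem partialPotential_one_le {S O : Type*} [MeasurableSpace S] [MeasurableSpace O]
    {μ : Measure O} [IsProbabilityMeasure μ] {step : S → O → S} {good : Set S} (M : ℕ) (s : S) :
    partialPotential μ step good M 1 s ≤ M := by
  induction M with
  | zero => simp
  | succ M ih =>
    refine (partialPotential_succ_le M s).trans ?_
    rw [Nat.cast_succ, add_comm]
    exact add_le_add_left ih _

section

variable {𝓧 𝓨 𝓩 : Type*} [MeasurableSpace 𝓧] [MeasurableSpace 𝓨] [MeasurableSpace 𝓩]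
variable (EX : Experiment 𝓧) (EY : Experiment 𝓨) (EZ : Experiment 𝓩) {aY aZ NX NY : ℝ}

/-! ### The walk with experiment `Z` -/

theorem lintegral_exp_rpow_walkStep (d : EReal) :
    ∫⁻ o : Datum 𝓧 𝓨 𝓩, (walkStep EZ d o).exp ^ (1 / 2 : ℝ) ∂preLaw EX EY EZ =
      d.exp ^ (1 / 2 : ℝ) * EZ.affinity := by
  have m := EZ.measurable_exp_llr.pow_const (1 / 2 : ℝ)
  simp_rw [walkStep, EReal.exp_add, ENNReal.mul_rpow_of_nonneg _ _ (show (0 : ℝ) ≤ 1 / 2 by norm_num)]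
  rw [preLaw_eq, lintegral_obsZ EX.pre EY.pre EZ.pre
    (g := fun z => d.exp ^ (1 / 2 : ℝ) * (EZ.llr z).exp ^ (1 / 2 : ℝ)) (m.const_mul _),
    lintegral_const_mul _ m, EZ.lintegral_exp_llr_rpow_pre]

theorem one_le_exp_rpow {d : EReal} (hd : 0 ≤ d) : 1 ≤ d.exp ^ (1 / 2 : ℝ) :=
  ENNReal.one_le_rpow (by simpa using EReal.exp_monotone hd) (by norm_num)

/-- A multiple of $e^{d/2}$ is a supersolution: one step multiplies it by $\rho$ on average, and as
$e^{d/2}\ge1$ for $d\ge0$ the decrease pays for the reward `C`. -/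
theorem walkPotential_le (h1 : EZ.affinity < 1) {ψ : EReal → ℝ≥0∞} (hψ : Measurable ψ)
    {C : ℝ≥0∞} (hC : ∀ d, ψ d ≤ C) {d : EReal} (hd : 0 ≤ d) :
    walkPotential EX EY EZ ψ d ≤ C * (1 - EZ.affinity)⁻¹ * d.exp ^ (1 / 2 : ℝ) := by
  refine potential_le fun M => ?_
  refine partialPotential_le_of_super (u := fun d => C * (1 - EZ.affinity)⁻¹ * d.exp ^ (1 / 2 : ℝ))
    (measurable_walkStep EZ) measurableSet_Ici hψ (T := Set.Ici 0) (fun _ _ _ h => h) ?_ M d hd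
  intro d hd
  have m : Measurable fun o : Datum 𝓧 𝓨 𝓩 => (walkStep EZ d o).exp ^ (1 / 2 : ℝ) :=
    (measurable_walkStep_left EZ d).ereal_exp.pow_const _
  calc _ ≤ C * d.exp ^ (1 / 2 : ℝ) + ∫⁻ o : Datum 𝓧 𝓨 𝓩, C * (1 - EZ.affinity)⁻¹ *
        (walkStep EZ d o).exp ^ (1 / 2 : ℝ) ∂preLaw EX EY EZ := by
        refine add_le_add ((hC d).trans (le_mul_of_one_le_right' (one_le_exp_rpow hd)))
          (lintegral_mono fun o => Set.indicator_le_self _ _ _)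
    _ = _ := by
      rw [lintegral_const_mul _ m, lintegral_exp_rpow_walkStep]
      calc _ = C * (1 + EZ.affinity * (1 - EZ.affinity)⁻¹) * d.exp ^ (1 / 2 : ℝ) := by ring
        _ = _ := by rw [one_add_mul_inv_one_sub h1]

/-- A weight that controls the mean reward until the end of a cycle. -/
def ThreeE.weight : ThreeE → ℝ≥0∞
  | .onZ d => d.exp ^ (1 / 2 : ℝ)
  | .below _ _ => 1

theorem ThreeE.weight_resume (h : EReal) (s : TwoE) : (ThreeE.resume h s).weight = 1 := by
  cases s <;> simp [ThreeE.resume, ThreeE.weight]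

theorem ThreeE.measurable_weight : Measurable ThreeE.weight := by
  refine ThreeE.measurable_elim (t := id) measurable_id (F := fun _ s => s.weight) ?_ ?_
  · exact (measurable_snd.ereal_exp.pow_const _)
  · exact measurable_const

theorem lintegral_weight_step_le (s : ThreeE) :
    ∫⁻ o : Datum 𝓧 𝓨 𝓩, (ThreeE.step EX EY EZ aY aZ NX NY s o).weight ∂preLaw EX EY EZ ≤
      s.weight * EZ.affinity + 1 := by
  cases s with
  | onZ d =>
    calc _ ≤ ∫⁻ o : Datum 𝓧 𝓨 𝓩, ((walkStep EZ d o).exp ^ (1 / 2 : ℝ) + 1) ∂preLaw EX EY EZ := by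
          refine lintegral_mono fun o => ?_
          simp only [ThreeE.step]
          split_ifs
          · rw [ThreeE.weight_resume]; exact le_add_self
          · exact le_self_add
      _ = _ := by
        rw [lintegral_add_right _ measurable_const, lintegral_exp_rpow_walkStep]
        simp [ThreeE.weight]
  | below h s =>
    simp only [ThreeE.step, ThreeE.weight_resume]
    simp

/-- The drift inequality $E\,w'\le\rho w+1$ has $(1-\rho)^{-1}$ as fixed point. This bounds the
unfinished cycle uniformly in time. -/
theorem lintegral_weight_le (h1 : EZ.affinity < 1) (n : ℕ) :
    ∫⁻ ω, (threeEState EX EY EZ aY aZ NX NY ω n).weight ∂P EX EY EZ ⊤ ≤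
      (1 - EZ.affinity)⁻¹ := by
  have hstep := measurable_threeE_step EX EY EZ aY aZ NX NY
  simp only [threeEState_eq_chain, P_top]
  induction n with
  | zero =>
    simp only [chain, ThreeE.weight, EReal.exp_zero, ENNReal.one_rpow, lintegral_one, measure_univ]
    exact ENNReal.one_le_inv.2 tsub_le_self
  | succ n ih =>
    have m : Measurable fun ω => (chain (fun s o => ThreeE.step EX EY EZ aY aZ NX NY s o)
      (.onZ 0) ω n).weight := ThreeE.measurable_weight.comp (measurable_chain hstep _ n)
    rw [lintegral_chain_succ hstep _ _ ThreeE.measurable_weight]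
    refine (lintegral_mono fun ω => lintegral_weight_step_le EX EY EZ _).trans ?_
    rw [lintegral_add_right _ measurable_const, lintegral_mul_const _ m]
    calc _ ≤ (1 - EZ.affinity)⁻¹ * EZ.affinity + 1 := by
          refine add_le_add (mul_le_mul_left ih _) (by simp)
      _ = _ := by rw [add_comm, mul_comm, one_add_mul_inv_one_sub h1]

/-! ### Rewards in a cycle -/

variable {R : EReal → TwoE → ℝ≥0∞} {c C : ℝ≥0∞}

theorem fallMean_startMean_le (haZ : 0 < aZ)
    (hC : ∀ h s, 0 ≤ h → s.Reachable NX NY h → R h s ≤ C) (d : EReal) :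
    fallMean EX EY EZ (startMean aZ NY R) d ≤ C := by
  calc _ ≤ ∫⁻ _ : Datum 𝓧 𝓨 𝓩, C ∂preLaw EX EY EZ := by
        refine lintegral_mono fun o => ?_
        by_cases hx : walkStep EZ d o < 0
        swap
        · exact (Set.indicator_of_notMem (s := Set.Iio (0 : EReal)) hx _).trans_le zero_le
        refine (Set.indicator_of_mem (s := Set.Iio (0 : EReal)) hx _).trans_le ?_
        have hh := (neg_coe_mul_pos haZ hx).le
        calc startMean aZ NY R _ ≤ ∫⁻ _ : unitInterval, C := lintegral_mono fun v =>
              hC _ _ hh (TwoE.reachable_start hh (randomLimit_le _ _))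
          _ = C := by simp
    _ = C := by simp

theorem cycleReward_onZ_le (h1 : EZ.affinity < 1) (haZ : 0 < aZ)
    (hR : Measurable (Function.uncurry R))
    (hC : ∀ h s, 0 ≤ h → s.Reachable NX NY h → R h s ≤ C) {s : ThreeE} (hs : s.Reachable NX NY) :
    cycleReward EX EY EZ aZ NY c R s ≤ (c + C) * (1 - EZ.affinity)⁻¹ * s.weight := by
  cases s with
  | onZ d =>
    exact walkPotential_le EX EY EZ h1
      ((measurable_fallMean EX EY EZ (measurable_startMean hR)).const_add c)
      (fun d => add_le_add_right (fallMean_startMean_le EX EY EZ haZ hC d) _) hs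
  | below h s =>
    refine (hC h s hs.1 hs.2.1).trans ?_
    rw [ThreeE.weight, mul_one]
    refine le_trans le_add_self (le_mul_of_one_le_right' (ENNReal.one_le_inv.2 tsub_le_self))

/-- The bracket is the mean number of cycles begun by time `n`. It does not involve `f`, so the
identities for two rewards can be divided. -/
theorem sum_lintegral_reward {f Q : ThreeE → ℝ≥0∞} (haY : 0 < aY) (haZ : 0 < aZ)
    (hf : Measurable f) (hQ : Measurable Q) (hQ0 : Q (.onZ 0) ≠ ∞)
    (h : ∀ s : ThreeE, s.Reachable NX NY →
      f s + ∫⁻ o, Q (ThreeE.step EX EY EZ aY aZ NX NY s o) ∂preLaw EX EY EZ =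
        Q s + cycleEnd EX EY EZ aY NX NY s * Q (.onZ 0)) (n : ℕ) :
    ∑ k ∈ Finset.range n, ∫⁻ ω, f (threeEState EX EY EZ aY aZ NX NY ω k) ∂P EX EY EZ ⊤ +
        ∫⁻ ω, Q (threeEState EX EY EZ aY aZ NX NY ω n) ∂P EX EY EZ ⊤ =
      Q (.onZ 0) * (1 + ∑ k ∈ Finset.range n,
        ∫⁻ ω, cycleEnd EX EY EZ aY NX NY (threeEState EX EY EZ aY aZ NX NY ω k)
          ∂P EX EY EZ ⊤) := by
  have hstep := measurable_threeE_step EX EY EZ aY aZ NX NY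
  refine sum_add_eq_of_cycle
    (F := fun k => ∫⁻ ω, f (threeEState EX EY EZ aY aZ NX NY ω k) ∂P EX EY EZ ⊤)
    (r := fun n => ∫⁻ ω, Q (threeEState EX EY EZ aY aZ NX NY ω n) ∂P EX EY EZ ⊤)
    (by simp [threeEState]) (fun n => ?_) n
  have hr := fun ω => h _ (reachable_threeEState EX EY EZ haY haZ (NX := NX) (NY := NY) ω n)
  simp only [threeEState_eq_chain] at hr ⊢
  have mc := measurable_chain hstep (.onZ 0) n
  have mQ : Measurable fun ω => Q (chain (fun s o => ThreeE.step EX EY EZ aY aZ NX NY s o)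
    (.onZ 0) ω n) := hQ.comp mc
  have mf : Measurable fun ω => f (chain (fun s o => ThreeE.step EX EY EZ aY aZ NX NY s o)
    (.onZ 0) ω n) := hf.comp mc
  rw [← lintegral_mul_const' _ _ hQ0, ← lintegral_add_left mQ, P_top,
    lintegral_chain_succ hstep _ _ hQ, ← lintegral_add_left mf]
  exact lintegral_congr hr

theorem lintegral_cycleReward_le (h1 : EZ.affinity < 1) (haY : 0 < aY) (haZ : 0 < aZ)
    (hR : Measurable (Function.uncurry R))
    (hC : ∀ h s, 0 ≤ h → s.Reachable NX NY h → R h s ≤ C) (n : ℕ) :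
    ∫⁻ ω, cycleReward EX EY EZ aZ NY c R (threeEState EX EY EZ aY aZ NX NY ω n)
      ∂P EX EY EZ ⊤ ≤ (c + C) * (1 - EZ.affinity)⁻¹ * (1 - EZ.affinity)⁻¹ := by
  have m : Measurable fun ω => (threeEState EX EY EZ aY aZ NX NY ω n).weight := by
    simp only [threeEState_eq_chain]
    exact ThreeE.measurable_weight.comp
      (measurable_chain (measurable_threeE_step EX EY EZ aY aZ NX NY) _ n)
  refine (lintegral_mono fun ω => cycleReward_onZ_le EX EY EZ h1 haZ hR hC
    (reachable_threeEState EX EY EZ haY haZ ω n)).trans ?_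
  rw [lintegral_const_mul _ m]
  exact mul_le_mul_right (lintegral_weight_le EX EY EZ h1 n) _

theorem measurable_labelReward (i : Label) :
    Measurable fun s : ThreeE => if s.label = i then (1 : ℝ≥0∞) else 0 := by
  refine ThreeE.measurable_elim (t := id) measurable_id
    (F := fun _ s => if s.label = i then (1 : ℝ≥0∞) else 0)
    (by by_cases h : Label.Z = i <;> simp [ThreeE.label, h]) ?_
  refine TwoE.measurable_elim measurable_snd.snd (F := fun (p : ThreeE × EReal × TwoE) s =>
    if (ThreeE.below p.2.1 s).label = i then (1 : ℝ≥0∞) else 0)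
    ?_ ?_ ?_
  · by_cases h : Label.Y = i <;> simp [ThreeE.label, h]
  · by_cases h : Label.X = i <;> simp [ThreeE.label, h]
  · by_cases h : Label.Z = i <;> simp [ThreeE.label, h]

theorem por_eq_limsup (A : ℝ) (i : Label) :
    por EX EY EZ (psi3E EX EY EZ A aY aZ NX NY) i =
      limsup (fun n : ℕ => (∑ k ∈ Finset.range (n - 1), ∫⁻ ω,
        (if (threeEState EX EY EZ aY aZ NX NY ω k).label = i then 1 else 0) ∂P EX EY EZ ⊤) /
          (n : ℝ≥0∞)) atTop := by
  have m : ∀ k, Measurable fun ω : Path 𝓧 𝓨 𝓩 =>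
      if (threeEState EX EY EZ aY aZ NX NY ω k).label = i then (1 : ℝ≥0∞) else 0 := by
    intro k
    simp only [threeEState_eq_chain]
    exact (measurable_labelReward i).comp
      (measurable_chain (measurable_threeE_step EX EY EZ aY aZ NX NY) _ k)
  unfold por
  congr 1
  funext n
  simp only [div_eq_mul_inv]
  change ∫⁻ ω, (∑ k ∈ Finset.range (n - 1),
    if (threeEState EX EY EZ aY aZ NX NY ω k).label = i then (1 : ℝ≥0∞) else 0) *
      (n : ℝ≥0∞)⁻¹ ∂P EX EY EZ ⊤ = _
  rw [lintegral_mul_const _ (Finset.measurable_fun_sum _ fun k _ => m k),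
    lintegral_finsetSum _ fun k _ => m k]

/-- The renewal theorem for the 3E-CUSUM algorithm, where `R` and `R'` are mean rewards until the
truncated 2E-CUSUM algorithm stops, if the reward is earned by the experiment `i`, or by all
experiments. -/
theorem por_eq_div (h1 : EZ.affinity < 1) (haY : 0 < aY) (haZ : 0 < aZ) (A : ℝ) (i : Label)
    {R' : EReal → TwoE → ℝ≥0∞} (hR : Measurable (Function.uncurry R))
    (hR' : Measurable (Function.uncurry R')) (hC' : C ≠ ∞)
    (hC : ∀ h s, 0 ≤ h → s.Reachable NX NY h → R h s ≤ C)
    (hC'' : ∀ h s, 0 ≤ h → s.Reachable NX NY h → R' h s ≤ C)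
    (hdone : ∀ h, R h .done = 0) (hdone' : ∀ h, R' h .done = 0)
    (heq : ∀ h s, 0 ≤ h → s.Reachable NX NY h → s ≠ .done →
      (if (ThreeE.below h s).label = i then 1 else 0) +
        ∫⁻ o : Datum 𝓧 𝓨 𝓩, R h (s.step EX EY aY NX h o) ∂preLaw EX EY EZ = R h s)
    (heq' : ∀ h s, 0 ≤ h → s.Reachable NX NY h → s ≠ .done →
      1 + ∫⁻ o : Datum 𝓧 𝓨 𝓩, R' h (s.step EX EY aY NX h o) ∂preLaw EX EY EZ = R' h s) :
    por EX EY EZ (psi3E EX EY EZ A aY aZ NX NY) i =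
      cycleReward EX EY EZ aZ NY (if .Z = i then 1 else 0) R (.onZ 0) /
        cycleReward EX EY EZ aZ NY 1 R' (.onZ 0) := by
  set c : ℝ≥0∞ := if Label.Z = i then 1 else 0 with hc
  have hc1 : c ≤ 1 := by rw [hc]; split_ifs <;> simp
  have hκ : (1 - EZ.affinity)⁻¹ ≠ ∞ := ENNReal.inv_ne_top.2 (tsub_pos_of_lt h1).ne'
  have h00 : (ThreeE.onZ 0).Reachable NX NY := le_rfl
  have hfin : ∀ {c' : ℝ≥0∞} {R'' : EReal → TwoE → ℝ≥0∞}, c' ≤ 1 →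
      Measurable (Function.uncurry R'') →
      (∀ h s, 0 ≤ h → s.Reachable NX NY h → R'' h s ≤ C) →
      cycleReward EX EY EZ aZ NY c' R'' (.onZ 0) ≠ ∞ := by
    intro c' R'' hc' hm hb
    have := cycleReward_onZ_le EX EY EZ (c := c') h1 haZ hm hb h00
    rw [ThreeE.weight, EReal.exp_zero, ENNReal.one_rpow, mul_one] at this
    refine ne_top_of_le_ne_top ?_ this
    have := ne_top_of_le_ne_top ENNReal.one_ne_top hc'
    finiteness
  have hbd : ∀ {c' : ℝ≥0∞} {R'' : EReal → TwoE → ℝ≥0∞}, c' ≤ 1 →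
      Measurable (Function.uncurry R'') →
      (∀ h s, 0 ≤ h → s.Reachable NX NY h → R'' h s ≤ C) → ∀ n,
      ∫⁻ ω, cycleReward EX EY EZ aZ NY c' R'' (threeEState EX EY EZ aY aZ NX NY ω n)
        ∂P EX EY EZ ⊤ ≤ (1 + C) * (1 - EZ.affinity)⁻¹ * (1 - EZ.affinity)⁻¹ := by
    intro c' R'' hc' hm hb n
    refine (lintegral_cycleReward_le EX EY EZ h1 haY haZ hm hb n).trans ?_
    exact mul_le_mul_left (mul_le_mul_left (add_le_add_left hc' _) _) _
  rw [por_eq_limsup]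
  refine limsup_average_eq (hfin hc1 hR hC) (hfin le_rfl hR' hC'') (C := (1 + C) *
    (1 - EZ.affinity)⁻¹ * (1 - EZ.affinity)⁻¹) (by finiteness) (hbd hc1 hR hC)
    (hbd le_rfl hR' hC'') (fun n => sum_lintegral_reward EX EY EZ haY haZ
      (measurable_labelReward i) (measurable_cycleReward EX EY EZ c hR) (hfin hc1 hR hC) ?_ n)
    (fun n => ?_)
  · rintro (d | ⟨h, s⟩) hs
    · exact cycleReward_onZ EX EY EZ c hR hdone d
    · exact cycleReward_below EX EY EZ c hR hdone (heq h s hs.1 hs.2.1 hs.2.2)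
  · rw [← sum_lintegral_reward EX EY EZ haY haZ (f := 1) measurable_one
      (measurable_cycleReward EX EY EZ 1 hR') (hfin le_rfl hR' hC'') ?_ n]
    · simp
    · rintro (d | ⟨h, s⟩) hs
      · exact cycleReward_onZ EX EY EZ 1 hR' hdone' d
      · exact cycleReward_below EX EY EZ 1 hR' hdone' (heq' h s hs.1 hs.2.1 hs.2.2)

end

section

variable {𝓧 𝓨 𝓩 : Type*} [MeasurableSpace 𝓧] [MeasurableSpace 𝓨] [MeasurableSpace 𝓩]
variable (EX : Experiment 𝓧) (EY : Experiment 𝓨) (EZ : Experiment 𝓩) {aY aZ NX NY : ℝ}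

/-! ### The mean duration of the truncated 2E-CUSUM algorithm -/

/-- One step of the truncated 2E-CUSUM algorithm, with the threshold as the first component. -/
def twoEStep (aY NX : ℝ) (p : EReal × TwoE) (o : Datum 𝓧 𝓨 𝓩) : EReal × TwoE :=
  (p.1, p.2.step EX EY aY NX p.1 o)

theorem measurable_twoEStep :
    Measurable (Function.uncurry (twoEStep (𝓩 := 𝓩) EX EY aY NX)) :=
  measurable_fst.fst.prodMk
    (measurable_twoE_step EX EY aY NX measurable_fst.fst measurable_fst.snd measurable_snd)

/-- The indicator that the truncated 2E-CUSUM algorithm is running. -/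
def running : EReal × TwoE → ℝ≥0∞ := {p | p.2 ≠ .done}.indicator 1

theorem measurable_running : Measurable running :=
  measurable_one.indicator (measurable_snd TwoE.measurableSet_done).compl

theorem running_of_ne (h : EReal) {s : TwoE} (hs : s ≠ .done) : running (h, s) = 1 :=
  Set.indicator_of_mem (s := {p : EReal × TwoE | p.2 ≠ .done}) hs _

theorem running_done (h : EReal) : running (h, .done) = 0 :=
  Set.indicator_of_notMem (s := {p : EReal × TwoE | p.2 ≠ .done}) (by simp) _

/-- The mean number of observations until the truncated 2E-CUSUM algorithm stops. -/
def meanRemaining (aY NX : ℝ) (h : EReal) (s : TwoE) : ℝ≥0∞ :=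
  potential (preLaw EX EY EZ) (twoEStep EX EY aY NX) Set.univ running (h, s)

theorem measurable_meanRemaining :
    Measurable (Function.uncurry (meanRemaining EX EY EZ aY NX)) :=
  measurable_potential (measurable_twoEStep EX EY) MeasurableSet.univ measurable_running

theorem meanRemaining_eq (h : EReal) (s : TwoE) :
    meanRemaining EX EY EZ aY NX h s = running (h, s) +
      ∫⁻ o : Datum 𝓧 𝓨 𝓩, meanRemaining EX EY EZ aY NX h (s.step EX EY aY NX h o)
        ∂preLaw EX EY EZ := by
  have := potential_eq (μ := preLaw EX EY EZ) (good := Set.univ)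
    (measurable_twoEStep (𝓩 := 𝓩) EX EY (aY := aY) (NX := NX)) MeasurableSet.univ
    measurable_running (h, s)
  rw [meanRemaining, this, killed]
  simp only [Set.indicator_univ]
  rfl

theorem meanRemaining_le (hNX : 0 ≤ NX) (h : EReal) (s : TwoE) :
    meanRemaining EX EY EZ aY NX h s ≤ s.duration (ENNReal.ofReal NX) := by
  refine potential_le fun M => ?_
  refine partialPotential_le_of_super (u := fun p => p.2.duration (ENNReal.ofReal NX))
    (measurable_twoEStep EX EY) MeasurableSet.univ measurable_running (T := Set.univ)
    (fun _ _ _ _ => trivial) ?_ M (h, s) trivial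
  rintro ⟨h, s⟩ -
  simp only [killed, Set.indicator_univ]
  by_cases hs : s = .done
  · subst hs
    simp [running_done, twoEStep, TwoE.step, TwoE.duration]
  · rw [running_of_ne h hs]
    exact TwoE.one_add_lintegral_duration_le EX EY EX.pre EY.pre EZ.pre hNX h hs

theorem meanRemaining_done (hNX : 0 ≤ NX) (h : EReal) :
    meanRemaining EX EY EZ aY NX h .done = 0 :=
  le_antisymm (meanRemaining_le EX EY EZ hNX h .done) zero_le

theorem TwoE.duration_le_of_reachable {h : EReal} {s : TwoE} (hs : s.Reachable NX NY h)
    (x : ℝ≥0∞) : s.duration x ≤ ⌈NX⌉₊ + (⌈NY⌉₊ + ⌈NY⌉₊ * x) := by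
  have hk : ∀ {k : ℕ}, 1 ≤ k → k ≤ ⌈NY⌉₊ →
      ((k - 1 : ℕ) : ℝ≥0∞) + 1 + ((k - 1 : ℕ) : ℝ≥0∞) * x ≤ ⌈NY⌉₊ + ⌈NY⌉₊ * x := by
    intro k h1 hk
    refine add_le_add ?_ (mul_le_mul_left ?_ _)
    · exact_mod_cast (by omega : k - 1 + 1 ≤ ⌈NY⌉₊)
    · exact_mod_cast (by omega : k - 1 ≤ ⌈NY⌉₊)
  cases s with
  | onY w k => exact (hk hs.2.1 hs.2.2).trans le_add_self
  | onX v u j k =>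
    obtain ⟨-, h1, h2, h3, h4⟩ := hs
    refine add_le_add ?_ (hk h3 (by omega))
    exact_mod_cast (by omega : j - 1 + 1 ≤ ⌈NX⌉₊)
  | done => exact zero_le

/-! ### The mean number of observations of `Y` -/

/-- The mean number of observations of `Y` until the truncated 2E-CUSUM algorithm stops: while
experiment `Y` is performed, the statistic is that of a truncated CUSUM. -/
def meanCountY (h : EReal) : TwoE → ℝ≥0∞
  | .onY w k => partialPotential (preLaw EX EY EZ) (cusumStep EY fun o => o.2.1)
      belowThreshold k 1 (h, w)
  | .onX _ _ _ k => partialPotential (preLaw EX EY EZ) (cusumStep EY fun o => o.2.1)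
      belowThreshold k 1 (h, 0)
  | .done => 0

theorem measurable_meanCountY : Measurable (Function.uncurry (meanCountY EX EY EZ)) := by
  have m : ∀ k, Measurable (partialPotential (preLaw EX EY EZ)
      (cusumStep EY fun o : Datum 𝓧 𝓨 𝓩 => o.2.1) belowThreshold k 1) := fun k =>
    measurable_partialPotential (measurable_cusumStep EY measurable_snd.fst)
      measurableSet_belowThreshold measurable_one k
  have m' : Measurable fun p : (EReal × EReal) × ℕ => partialPotential (preLaw EX EY EZ)
      (cusumStep EY fun o : Datum 𝓧 𝓨 𝓩 => o.2.1) belowThreshold p.2 1 p.1 :=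
    measurable_from_prod_countable_left m
  refine TwoE.measurable_elim (t := Prod.snd) measurable_snd
    (F := fun (p : EReal × TwoE) s => meanCountY EX EY EZ p.1 s) ?_ ?_ ?_
  · exact m'.comp ((measurable_fst.fst.prodMk measurable_snd.fst).prodMk measurable_snd.snd)
  · exact m'.comp ((measurable_fst.fst.prodMk measurable_const).prodMk measurable_snd.snd.snd.snd)
  · exact measurable_const

theorem meanCountY_start (h : EReal) (k : ℕ) :
    meanCountY EX EY EZ h (TwoE.start k) = partialPotential (preLaw EX EY EZ)
      (cusumStep EY fun o => o.2.1) belowThreshold k 1 (h, 0) := by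
  unfold TwoE.start
  split_ifs with hk
  · subst hk; simp [meanCountY]
  · rfl

theorem meanCountY_le {h : EReal} {s : TwoE} (hs : s.Reachable NX NY h) :
    meanCountY EX EY EZ h s ≤ ⌈NY⌉₊ := by
  cases s with
  | onY w k => exact (partialPotential_one_le k _).trans (by exact_mod_cast hs.2.2)
  | onX v u j k =>
    exact (partialPotential_one_le k _).trans (by exact_mod_cast (Nat.le_succ k).trans hs.2.2.2.2)
  | done => exact zero_le

/-- A fall of `Y` below its start level leads, with or without an `X` run, back to height $0$. Seen
through its `Y` observations the height follows $w\mapsto\max(w+\ell_Y,0)$, a CUSUM whose horizon is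
the number of observations left. -/
theorem meanCountY_onY {h : EReal} (hh : 0 ≤ h) (w : EReal) {k : ℕ} (hk : 1 ≤ k) :
    1 + ∫⁻ o : Datum 𝓧 𝓨 𝓩, meanCountY EX EY EZ h ((TwoE.onY w k).step EX EY aY NX h o)
        ∂preLaw EX EY EZ = meanCountY EX EY EZ h (.onY w k) := by
  obtain ⟨k, rfl⟩ : ∃ n, k = n + 1 := ⟨k - 1, by omega⟩
  rw [meanCountY, partialPotential_succ (measurable_cusumStep EY measurable_snd.fst)
    measurableSet_belowThreshold measurable_one, killed]
  congr 1
  refine lintegral_congr fun o => ?_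
  simp only [TwoE.step, cusumStep, Nat.add_sub_cancel]
  by_cases h1 : h < w + EY.llr o.2.1
  · rw [if_pos (Or.inl h1), Set.indicator_of_notMem]
    · rfl
    · rw [mk_mem_belowThreshold, not_le]
      exact h1.trans_le (le_max_left _ _)
  rw [Set.indicator_of_mem (mk_mem_belowThreshold.2 (max_le (not_lt.1 h1) hh))]
  by_cases hk0 : k = 0
  · subst hk0
    simp [meanCountY]
  · rw [if_neg (by rintro (h2 | h2); exacts [h1 h2, hk0 (by omega)])]
    split_ifs with h2 h3
    · rw [max_eq_right h2.le]; rfl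
    · rw [max_eq_right h2.le]; rfl
    · rw [max_eq_left (not_lt.1 h2)]; rfl

theorem meanCountY_onX (h v u : EReal) (j k : ℕ) :
    ∫⁻ o : Datum 𝓧 𝓨 𝓩, meanCountY EX EY EZ h ((TwoE.onX v u j k).step EX EY aY NX h o)
        ∂preLaw EX EY EZ = meanCountY EX EY EZ h (.onX v u j k) := by
  have : ∀ o : Datum 𝓧 𝓨 𝓩, meanCountY EX EY EZ h ((TwoE.onX v u j k).step EX EY aY NX h o) =
      meanCountY EX EY EZ h (.onX v u j k) := by
    intro o
    simp only [TwoE.step]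
    split_ifs <;> rfl
  simp [this]

/-! ### The observation ratios -/

/-- The mean number of observations of `Z` in a cycle. -/
def meanDescent : ℝ≥0∞ := walkPotential EX EY EZ 1 0

/-- The mean number of observations in a cycle that are not of `Z`. -/
def meanBelow (aY aZ NX NY : ℝ) : ℝ≥0∞ :=
  walkPotential EX EY EZ
    (fallMean EX EY EZ (startMean aZ NY (meanRemaining EX EY EZ aY NX))) 0

/-- The mean number of observations of `Y` in a cycle. -/
def meanBelowY (aZ NY : ℝ) : ℝ≥0∞ :=
  walkPotential EX EY EZ (fallMean EX EY EZ (startMean aZ NY (meanCountY EX EY EZ))) 0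

theorem cycleReward_meanRemaining :
    cycleReward EX EY EZ aZ NY 1 (meanRemaining EX EY EZ aY NX) (.onZ 0) =
      meanDescent EX EY EZ + meanBelow EX EY EZ aY aZ NX NY :=
  potential_add (measurable_walkStep EZ) measurableSet_Ici measurable_one 0

theorem por_Z_eq (h1 : EZ.affinity < 1) (haY : 0 < aY) (haZ : 0 < aZ) (hNX : 0 ≤ NX) (A : ℝ) :
    por EX EY EZ (psi3E EX EY EZ A aY aZ NX NY) .Z = meanDescent EX EY EZ /
      (meanDescent EX EY EZ + meanBelow EX EY EZ aY aZ NX NY) := by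
  rw [por_eq_div EX EY EZ (R := fun _ _ => 0) (R' := meanRemaining EX EY EZ aY NX)
    (C := ⌈NX⌉₊ + (⌈NY⌉₊ + ⌈NY⌉₊ * ENNReal.ofReal NX)) h1 haY haZ A .Z measurable_const
    (measurable_meanRemaining EX EY EZ) (by finiteness) (fun _ _ _ _ => zero_le)
    (fun h s _ hs => (meanRemaining_le EX EY EZ hNX h s).trans
      (TwoE.duration_le_of_reachable hs _)) (fun _ => rfl) (meanRemaining_done EX EY EZ hNX) ?_ ?_,
    cycleReward_meanRemaining]
  · congr 1
    have : fallMean EX EY EZ (startMean aZ NY fun _ _ => 0) = 0 := by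
      funext d
      have : startMean aZ NY (fun _ _ => 0) = 0 := by funext x; simp [startMean]
      simp [fallMean, this]
    simp only [cycleReward, this, if_true, Pi.zero_apply, add_zero]
    rfl
  · intro h s _ _ hs
    cases s with
    | onY w k => simp [ThreeE.label]
    | onX v u j k => simp [ThreeE.label]
    | done => exact absurd rfl hs
  · intro h s _ _ hs
    rw [meanRemaining_eq EX EY EZ h s, running_of_ne h hs]

theorem por_Y_eq (h1 : EZ.affinity < 1) (haY : 0 < aY) (haZ : 0 < aZ) (hNX : 0 ≤ NX) (A : ℝ) :
    por EX EY EZ (psi3E EX EY EZ A aY aZ NX NY) .Y = meanBelowY EX EY EZ aZ NY /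
      (meanDescent EX EY EZ + meanBelow EX EY EZ aY aZ NX NY) := by
  rw [por_eq_div EX EY EZ (R := meanCountY EX EY EZ) (R' := meanRemaining EX EY EZ aY NX)
    (C := ⌈NX⌉₊ + (⌈NY⌉₊ + ⌈NY⌉₊ * ENNReal.ofReal NX)) h1 haY haZ A .Y
    (measurable_meanCountY EX EY EZ)
    (measurable_meanRemaining EX EY EZ) (by finiteness)
    (fun h s _ hs => (meanCountY_le EX EY EZ hs).trans (le_add_left le_self_add))
    (fun h s _ hs => (meanRemaining_le EX EY EZ hNX h s).trans
      (TwoE.duration_le_of_reachable hs _)) (fun _ => rfl) (meanRemaining_done EX EY EZ hNX) ?_ ?_,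
    cycleReward_meanRemaining]
  · congr 1
    simp [cycleReward, meanBelowY]
  · intro h s hh hr hs
    cases s with
    | onY w k =>
      simp only [ThreeE.label, if_true]
      exact meanCountY_onY EX EY EZ hh w hr.2.1
    | onX v u j k => simpa [ThreeE.label] using meanCountY_onX EX EY EZ h v u j k
    | done => exact absurd rfl hs
  · intro h s _ _ hs
    rw [meanRemaining_eq EX EY EZ h s, running_of_ne h hs]

theorem meanDescent_lt_top (h1 : EZ.affinity < 1) : meanDescent EX EY EZ < ∞ := by
  have hκ : (1 - EZ.affinity)⁻¹ ≠ ∞ := ENNReal.inv_ne_top.2 (tsub_pos_of_lt h1).ne'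
  refine (walkPotential_le EX EY EZ h1 measurable_one (C := 1) (fun _ => le_rfl) le_rfl).trans_lt ?_
  rw [EReal.exp_zero, ENNReal.one_rpow, mul_one, one_mul]
  exact hκ.lt_top

theorem meanBelow_lt_top (h1 : EZ.affinity < 1) (haZ : 0 < aZ) (hNX : 0 ≤ NX) :
    meanBelow EX EY EZ aY aZ NX NY < ∞ := by
  have hκ : (1 - EZ.affinity)⁻¹ ≠ ∞ := ENNReal.inv_ne_top.2 (tsub_pos_of_lt h1).ne'
  refine (walkPotential_le EX EY EZ h1
    (measurable_fallMean EX EY EZ (measurable_startMean (measurable_meanRemaining EX EY EZ)))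
    (C := ⌈NX⌉₊ + (⌈NY⌉₊ + ⌈NY⌉₊ * ENNReal.ofReal NX)) (fun d =>
      fallMean_startMean_le EX EY EZ (NX := NX) haZ (fun h s _ hs =>
        (meanRemaining_le EX EY EZ hNX h s).trans (TwoE.duration_le_of_reachable hs _)) d)
    le_rfl).trans_lt ?_
  rw [EReal.exp_zero, ENNReal.one_rpow, mul_one]
  finiteness

end

/-! ### Times as sums of indicators -/

theorem tsum_ite_lt (t : ℕ∞) : ∑' m : ℕ, (if (m : ℕ∞) < t then (1 : ℝ≥0∞) else 0) = t := by
  induction t using ENat.recTopCoe with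
  | top => simp
  | coe n =>
    rw [tsum_eq_sum (s := Finset.range n) (fun m hm => by simpa using hm)]
    rw [Finset.sum_congr rfl (g := fun _ => (1 : ℝ≥0∞))
      fun m hm => if_pos (by exact_mod_cast Finset.mem_range.1 hm)]
    simp

theorem min_natCast_eq_sum (t : ℕ∞) (k : ℕ) :
    ((min t (k : ℕ∞) : ℕ∞) : ℝ≥0∞) =
      ∑ m ∈ Finset.range k, (if (m : ℕ∞) < t then (1 : ℝ≥0∞) else 0) := by
  rw [← tsum_ite_lt, tsum_eq_sum (s := Finset.range k) (fun m hm => ?_)]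
  · refine Finset.sum_congr rfl fun m hm => ?_
    have : (m : ℕ∞) < k := by exact_mod_cast Finset.mem_range.1 hm
    simp [this]
  · have : ¬ (m : ℕ∞) < k := by simpa using hm
    simp [this]

theorem lt_firstTime_iff {p : ℕ → Prop} {m : ℕ} :
    (m : ℕ∞) < firstTime p ↔ ∀ k, 1 ≤ k → k ≤ m → ¬ p k := by
  constructor
  · intro h k hk hkm hp
    have : firstTime p ≤ k := iInf₂_le k ⟨hk, hp⟩
    exact absurd (h.trans_le this) (not_lt.2 (by exact_mod_cast hkm))
  · intro h
    have : ((m + 1 : ℕ) : ℕ∞) ≤ firstTime p := le_iInf₂ fun n hn => by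
      by_contra hc
      have : n < m + 1 := by exact_mod_cast not_le.1 hc
      exact h n hn.1 (by omega) hn.2
    exact lt_of_lt_of_le (by exact_mod_cast Nat.lt_succ_self m) this

theorem exists_firstTime_eq {p : ℕ → Prop} (h : firstTime p ≠ ⊤) :
    ∃ n : ℕ, firstTime p = (n + 1 : ℕ) ∧ p (n + 1) ∧ ∀ k, 1 ≤ k → k ≤ n → ¬ p k := by
  classical
  have hex : ∃ n, 1 ≤ n ∧ p n := by
    by_contra hc
    push Not at hc
    refine h (top_unique (le_iInf₂ fun n hn => absurd hn.2 (hc n hn.1)))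
  have hN := Nat.find_spec hex
  obtain ⟨n, hn⟩ : ∃ n, Nat.find hex = n + 1 := ⟨Nat.find hex - 1, by omega⟩
  have hmin : ∀ k, 1 ≤ k → k ≤ n → ¬ p k := fun k hk hkn hp =>
    Nat.find_min hex (by omega) ⟨hk, hp⟩
  rw [hn] at hN
  refine ⟨n, le_antisymm (iInf₂_le (n + 1) hN) ?_, hN.2, hmin⟩
  have := lt_firstTime_iff.2 hmin
  rw [Nat.cast_succ]
  exact Order.add_one_le_of_lt this

theorem measurable_firstTime {α : Type*} [MeasurableSpace α] {p : α → ℕ → Prop}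
    (hp : ∀ n, MeasurableSet {a | p a n}) : Measurable fun a => firstTime (p a) := by
  have hlt : ∀ m : ℕ, MeasurableSet {a | (m : ℕ∞) < firstTime (p a)} := fun m => by
    have : {a | (m : ℕ∞) < firstTime (p a)} =
        ⋂ k, ⋂ (_ : 1 ≤ k), ⋂ (_ : k ≤ m), {a | p a k}ᶜ := by
      ext a; simp [lt_firstTime_iff]
    rw [this]
    exact MeasurableSet.iInter fun k => MeasurableSet.iInter fun _ => MeasurableSet.iInter fun _ =>
      (hp k).compl
  refine measurable_to_countable' fun t => ?_
  induction t using ENat.recTopCoe with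
  | top =>
    have : (fun a => firstTime (p a)) ⁻¹' {⊤} = ⋂ m : ℕ, {a | (m : ℕ∞) < firstTime (p a)} := by
      ext a
      simp only [Set.mem_preimage, Set.mem_singleton_iff, Set.mem_iInter, Set.mem_ofPred_eq]
      exact ENat.eq_top_iff_forall_gt
    rw [this]
    exact MeasurableSet.iInter hlt
  | coe n =>
    have : (fun a => firstTime (p a)) ⁻¹' {(n : ℕ∞)} =
        (⋂ m : ℕ, ⋂ (_ : m < n), {a | (m : ℕ∞) < firstTime (p a)}) ∩
          {a | (n : ℕ∞) < firstTime (p a)}ᶜ := by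
      ext a
      simp only [Set.mem_preimage, Set.mem_singleton_iff, Set.mem_inter_iff, Set.mem_iInter,
        Set.mem_ofPred_eq, Set.mem_compl_iff, not_lt]
      refine ⟨fun h => ⟨fun m hm => by rw [h]; exact_mod_cast hm, h.le⟩, fun h => ?_⟩
      refine le_antisymm h.2 ?_
      cases n with
      | zero => simp
      | succ n =>
        rw [Nat.cast_succ]
        exact Order.add_one_le_of_lt (h.1 n (Nat.lt_succ_self n))
    rw [this]
    exact (MeasurableSet.iInter fun m => MeasurableSet.iInter fun _ => hlt m).inter (hlt n).compl

theorem measurable_toENNReal : Measurable fun t : ℕ∞ => (t : ℝ≥0∞) := measurable_of_countable _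

section

variable {𝓧 𝓨 𝓩 : Type*} [MeasurableSpace 𝓧] [MeasurableSpace 𝓨] [MeasurableSpace 𝓩]
variable (EX : Experiment 𝓧) (EY : Experiment 𝓨) (EZ : Experiment 𝓩) {aY aZ NX NY : ℝ}

/-! ### The undershoot of the walk -/

theorem walkZ_eq_chain (ω : Path 𝓧 𝓨 𝓩) (n : ℕ) : walkZ EZ ω n = chain (walkStep EZ) 0 ω n := by
  induction n with
  | zero => rfl
  | succ n ih =>
    rw [chain, ← ih, walkStep]
    exact Finset.sum_range_succ _ _

theorem meanSigmaZ_eq : meanSigmaZ EX EY EZ = meanDescent EX EY EZ := by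
  rw [meanSigmaZ, P_top]
  refine lintegral_firstTime_chain (measurable_walkStep EZ) measurableSet_Ici 0 fun ω k => ?_
  rw [walkZ_eq_chain, Set.mem_Ici, not_le]

theorem measurable_walkZ (n : ℕ) : Measurable fun ω : Path 𝓧 𝓨 𝓩 => walkZ EZ ω n := by
  simp only [walkZ_eq_chain]
  exact measurable_chain (measurable_walkStep EZ) 0 n

theorem measurable_sigmaZ : Measurable fun ω : Path 𝓧 𝓨 𝓩 => sigmaZ EZ ω :=
  measurable_firstTime fun n => measurableSet_lt (measurable_walkZ EZ n) measurable_const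

theorem measurable_undershootZ : Measurable fun ω : Path 𝓧 𝓨 𝓩 => undershootZ EZ ω := by
  have h : Measurable fun p : Path 𝓧 𝓨 𝓩 × ℕ => walkZ EZ p.1 p.2 :=
    measurable_from_prod_countable_left (f := fun p : Path 𝓧 𝓨 𝓩 × ℕ => walkZ EZ p.1 p.2)
      fun n => measurable_walkZ EZ n
  have h2 : Measurable fun t : ℕ∞ => t.toNat := measurable_of_countable _
  have h3 : Measurable fun ω : Path 𝓧 𝓨 𝓩 => (ω, (sigmaZ EZ ω).toNat) :=
    measurable_id.prodMk (h2.comp (measurable_sigmaZ EZ))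
  have h4 := h.comp h3
  simp only [Function.comp_def] at h4
  convert h4 using 2
  rw [undershootZ]

theorem undershootZ_congr {ω ω' : Path 𝓧 𝓨 𝓩} (h : ∀ n, (ω n).2.2.1 = (ω' n).2.2.1) :
    undershootZ EZ ω = undershootZ EZ ω' := by
  have : walkZ EZ ω = walkZ EZ ω' := by
    funext n
    simp [walkZ, h]
  rw [undershootZ, undershootZ, sigmaZ, sigmaZ, this]

/-- Split according to $\sigma^Z=n+1$: the walk survives `n` steps and falls at the next one, whose
datum is integrated out first. -/
theorem lintegral_undershootZ (h1 : EZ.affinity < 1) {φ : EReal → ℝ≥0∞} (hφ : Measurable φ) :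
    ∫⁻ ω, φ (undershootZ EZ ω) ∂P EX EY EZ ⊤ =
      walkPotential EX EY EZ (fallMean EX EY EZ φ) 0 := by
  have hw := measurable_walkStep (𝓧 := 𝓧) (𝓨 := 𝓨) EZ
  have mχ : Measurable ((Set.Iio (0 : EReal)).indicator φ) := hφ.indicator measurableSet_Iio
  -- A finite mean excludes $\sigma^Z=\infty$, where the undershoot would be a default value.
  have hfin : ∀ᵐ ω ∂P EX EY EZ ⊤, (sigmaZ EZ ω : ℝ≥0∞) < ∞ :=
    ae_lt_top (measurable_toENNReal.comp (measurable_sigmaZ EZ))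
      (meanSigmaZ_eq EX EY EZ ▸ meanDescent_lt_top EX EY EZ h1).ne
  have hpt : ∀ᵐ ω ∂P EX EY EZ ⊤, φ (undershootZ EZ ω) = ∑' n,
      {ω | ∀ k, 1 ≤ k → k ≤ n → chain (walkStep EZ) 0 ω k ∈ Set.Ici 0}.indicator 1 ω *
        (Set.Iio 0).indicator φ (chain (walkStep EZ) 0 ω (n + 1)) := by
    filter_upwards [hfin] with ω hω
    have hσ : sigmaZ EZ ω ≠ ⊤ := fun hc => by simp [hc] at hω
    obtain ⟨n, hn, hp, hmin⟩ := exists_firstTime_eq hσ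
    simp only [walkZ_eq_chain, not_lt] at hp hmin
    rw [tsum_eq_single n fun m hm => ?_]
    · rw [Set.indicator_of_mem (by exact hmin), Pi.one_apply, one_mul,
        Set.indicator_of_mem (by exact hp), undershootZ, sigmaZ, hn, ← walkZ_eq_chain]
      rfl
    · rcases lt_or_gt_of_ne hm with hlt | hgt
      · rw [Set.indicator_of_notMem (s := Set.Iio (0 : EReal)), mul_zero]
        exact not_lt.2 (hmin (m + 1) (by omega) (by omega))
      · rw [Set.indicator_of_notMem, zero_mul]
        exact fun hc => absurd (hc (n + 1) (by omega) (by omega)) (not_le.2 hp)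
  have mst : ∀ n, Measurable ({ω : Path 𝓧 𝓨 𝓩 | ∀ k, 1 ≤ k → k ≤ n →
      chain (walkStep EZ) 0 ω k ∈ Set.Ici 0}.indicator (1 : Path 𝓧 𝓨 𝓩 → ℝ≥0∞)) := fun n => by
    have := measurableSet_stay (O := Datum 𝓧 𝓨 𝓩) hw (measurableSet_Ici (a := (0 : EReal))) 0 0 n
    simp only [zero_add] at this
    exact measurable_one.indicator this
  have mprod : ∀ n, Measurable fun ω : Path 𝓧 𝓨 𝓩 =>
      {ω | ∀ k, 1 ≤ k → k ≤ n → chain (walkStep EZ) 0 ω k ∈ Set.Ici 0}.indicator 1 ω *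
        (Set.Iio 0).indicator φ (chain (walkStep EZ) 0 ω (n + 1)) := fun n =>
    (mst n).mul (mχ.comp (measurable_chain hw 0 (n + 1)))
  rw [lintegral_congr_ae hpt, lintegral_tsum fun n => (mprod n).aemeasurable, P_top,
    walkPotential, potential]
  congr 1
  funext n
  rw [← lintegral_chain_iterate_zero hw measurableSet_Ici 0 n (measurable_fallMean EX EY EZ hφ)]
  refine lintegral_eval (fun _ => preLaw EX EY EZ) n (Φ := fun ω o =>
    {ω | ∀ k, 1 ≤ k → k ≤ n → chain (walkStep EZ) 0 ω k ∈ Set.Ici 0}.indicator 1 ω *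
      (Set.Iio 0).indicator φ (walkStep EZ (chain (walkStep EZ) 0 ω n) o)) ?_ ?_ |>.trans ?_
  · exact ((mst n).comp measurable_fst).mul (mχ.comp (hw.comp
      (((measurable_chain hw 0 n).comp measurable_fst).prodMk measurable_snd)))
  · intro ω o o'
    rw [chain_update _ _ _ le_rfl]
    congr 1
    refine indicator_one_congr ?_
    simp only [Set.mem_ofPred_eq]
    refine forall_congr' fun k => forall_congr' fun _ => forall_congr' fun hk => ?_
    rw [chain_update _ _ _ hk]
  · refine lintegral_congr fun ω => ?_
    rw [lintegral_const_mul]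
    · rfl
    · exact mχ.comp (measurable_walkStep_left EZ _)

/-! ### Independence of the undershoot and of the data of `X` and `Y` -/

/-- The undershoot and the algorithm read one and the same path, but disjoint coordinates of it:
`Z`, the uniform for the `Y` limit, and the remaining data. Two independent paths are merged
coordinatewise, first to free the undershoot, then to free the limit. -/
theorem lintegral_decouple {Φ : EReal → unitInterval → Path 𝓧 𝓨 𝓩 → ℝ≥0∞}
    (hΦ : Measurable fun p : EReal × unitInterval × Path 𝓧 𝓨 𝓩 => Φ p.1 p.2.1 p.2.2)
    (hcongr : ∀ x v (ω ω' : Path 𝓧 𝓨 𝓩), (∀ n, (ω n).1 = (ω' n).1) →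
      (∀ n, (ω n).2.1 = (ω' n).2.1) → (∀ n, (ω n).2.2.2.1 = (ω' n).2.2.2.1) →
      Φ x v ω = Φ x v ω') :
    ∫⁻ ω, Φ (undershootZ EZ ω) (ω 0).2.2.2.2 ω ∂P EX EY EZ ⊤ =
      ∫⁻ ω, (∫⁻ v, ∫⁻ ω', Φ (undershootZ EZ ω) v ω' ∂P EX EY EZ ⊤) ∂P EX EY EZ ⊤ := by
  have hund := measurable_undershootZ (𝓧 := 𝓧) (𝓨 := 𝓨) EZ
  have mu : Measurable fun ω : Path 𝓧 𝓨 𝓩 => (ω 0).2.2.2.2 :=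
    (measurable_pi_apply 0).snd.snd.snd.snd
  have hg1 : Measurable (Function.uncurry fun o o' : Datum 𝓧 𝓨 𝓩 =>
      ((o'.1, o'.2.1, o.2.2.1, o'.2.2.2) : Datum 𝓧 𝓨 𝓩)) :=
    measurable_snd.fst.prodMk (measurable_snd.snd.fst.prodMk
      (measurable_fst.snd.snd.fst.prodMk measurable_snd.snd.snd.snd))
  have hg2 : Measurable (Function.uncurry fun o o' : Datum 𝓧 𝓨 𝓩 =>
      ((o.1, o.2.1, o.2.2.1, o.2.2.2.1, o'.2.2.2.2) : Datum 𝓧 𝓨 𝓩)) :=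
    measurable_fst.fst.prodMk (measurable_fst.snd.fst.prodMk
      (measurable_fst.snd.snd.fst.prodMk (measurable_fst.snd.snd.snd.fst.prodMk
        measurable_snd.snd.snd.snd.snd)))
  have e1 := map_combine_infinitePi (μ := preLaw EX EY EZ) hg1
    (map_combine_obsZ EX.pre EY.pre EZ.pre)
  have e2 := map_combine_infinitePi (μ := preLaw EX EY EZ) hg2
    (map_combine_uniform EX.pre EY.pre EZ.pre)
  set Q := Measure.infinitePi fun _ : ℕ => preLaw EX EY EZ with hQ
  have m1 : Measurable fun (p : Path 𝓧 𝓨 𝓩 × Path 𝓧 𝓨 𝓩) (n : ℕ) =>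
      (((p.2 n).1, (p.2 n).2.1, (p.1 n).2.2.1, (p.2 n).2.2.2) : Datum 𝓧 𝓨 𝓩) :=
    measurable_pi_lambda _ fun n => hg1.comp (f := fun p : Path 𝓧 𝓨 𝓩 × Path 𝓧 𝓨 𝓩 =>
      (p.1 n, p.2 n)) (((measurable_pi_apply n).comp measurable_fst).prodMk
        ((measurable_pi_apply n).comp measurable_snd))
  have m2 : Measurable fun (p : Path 𝓧 𝓨 𝓩 × Path 𝓧 𝓨 𝓩) (n : ℕ) =>
      (((p.1 n).1, (p.1 n).2.1, (p.1 n).2.2.1, (p.1 n).2.2.2.1, (p.2 n).2.2.2.2) :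
        Datum 𝓧 𝓨 𝓩) :=
    measurable_pi_lambda _ fun n => hg2.comp (f := fun p : Path 𝓧 𝓨 𝓩 × Path 𝓧 𝓨 𝓩 =>
      (p.1 n, p.2 n)) (((measurable_pi_apply n).comp measurable_fst).prodMk
        ((measurable_pi_apply n).comp measurable_snd))
  have mF : Measurable fun ω : Path 𝓧 𝓨 𝓩 => Φ (undershootZ EZ ω) (ω 0).2.2.2.2 ω :=
    hΦ.comp (hund.prodMk (mu.prodMk measurable_id))
  have inner : ∀ x, ∫⁻ ω, Φ x (ω 0).2.2.2.2 ω ∂Q = ∫⁻ v, ∫⁻ ω, Φ x v ω ∂Q := by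
    intro x
    have mx : Measurable fun ω : Path 𝓧 𝓨 𝓩 => Φ x (ω 0).2.2.2.2 ω :=
      hΦ.comp (measurable_const.prodMk (mu.prodMk measurable_id))
    have mxp : Measurable fun p : Path 𝓧 𝓨 𝓩 × Path 𝓧 𝓨 𝓩 => Φ x (p.2 0).2.2.2.2 p.1 :=
      hΦ.comp (measurable_const.prodMk ((mu.comp measurable_snd).prodMk measurable_fst))
    have mxs : Measurable fun p : Path 𝓧 𝓨 𝓩 × unitInterval => Φ x p.2 p.1 :=
      hΦ.comp (measurable_const.prodMk (measurable_snd.prodMk measurable_fst))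
    have hp : MeasurePreserving (fun ω : Path 𝓧 𝓨 𝓩 => (ω 0).2.2.2.2) Q volume :=
      (measurePreserving_snd.comp (measurePreserving_uniforms EX.pre EY.pre EZ.pre)).comp
        (measurePreserving_eval_infinitePi (fun _ => preLaw EX EY EZ) 0)
    conv_lhs => rw [← e2]
    rw [lintegral_map mx m2]
    trans ∫⁻ p : Path 𝓧 𝓨 𝓩 × Path 𝓧 𝓨 𝓩, Φ x (p.2 0).2.2.2.2 p.1 ∂Q.prod Q
    · refine lintegral_congr fun p => ?_
      exact hcongr _ _ _ _ (fun _ => rfl) (fun _ => rfl) (fun _ => rfl)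
    calc ∫⁻ p : Path 𝓧 𝓨 𝓩 × Path 𝓧 𝓨 𝓩, Φ x (p.2 0).2.2.2.2 p.1 ∂Q.prod Q = ∫⁻ ω, (∫⁻ v, Φ x v ω) ∂Q := by
          rw [lintegral_prod _ mxp.aemeasurable]
          refine lintegral_congr fun ω => ?_
          exact hp.lintegral_comp (f := fun v => Φ x v ω) (mxs.comp measurable_prodMk_left)
      _ = _ := lintegral_lintegral_swap mxs.aemeasurable
  rw [P_top, ← hQ]
  conv_lhs => rw [← e1]
  rw [lintegral_map mF m1]
  have mp : Measurable fun p : Path 𝓧 𝓨 𝓩 × Path 𝓧 𝓨 𝓩 =>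
      Φ (undershootZ EZ p.1) (p.2 0).2.2.2.2 p.2 :=
    hΦ.comp ((hund.comp measurable_fst).prodMk ((mu.comp measurable_snd).prodMk measurable_snd))
  calc _ = ∫⁻ p, Φ (undershootZ EZ p.1) (p.2 0).2.2.2.2 p.2 ∂Q.prod Q :=
        lintegral_congr fun p => by
          rw [undershootZ_congr EZ (ω' := p.1) fun n => rfl]
          exact hcongr _ _ _ _ (fun _ => rfl) (fun _ => rfl) (fun _ => rfl)
    _ = _ := by
        rw [lintegral_prod _ mp.aemeasurable]
        exact lintegral_congr fun ω => inner (undershootZ EZ ω)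

/-! ### The mean duration of the truncated 2E-CUSUM algorithm -/

theorem measurable_chain_prod {S O : Type*} [MeasurableSpace S] [MeasurableSpace O]
    {step : S → O → S} (hstep : Measurable (Function.uncurry step)) (m : ℕ) :
    Measurable fun p : S × (ℕ → O) => chain step p.1 p.2 m := by
  induction m with
  | zero => exact measurable_fst
  | succ m ih => exact hstep.comp (ih.prodMk ((measurable_pi_apply m).comp measurable_snd))

theorem twoEStep_congr (p : EReal × TwoE) {o o' : Datum 𝓧 𝓨 𝓩} (h1 : o.1 = o'.1)
    (h2 : o.2.1 = o'.2.1) (h3 : o.2.2.2.1 = o'.2.2.2.1) :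
    twoEStep EX EY aY NX p o = twoEStep EX EY aY NX p o' := by
  obtain ⟨h, s⟩ := p
  cases s <;> simp only [twoEStep, TwoE.step, h1, h2, h3]

theorem chain_twoEStep_congr (p : EReal × TwoE) {ω ω' : Path 𝓧 𝓨 𝓩}
    (h1 : ∀ n, (ω n).1 = (ω' n).1) (h2 : ∀ n, (ω n).2.1 = (ω' n).2.1)
    (h3 : ∀ n, (ω n).2.2.2.1 = (ω' n).2.2.2.1) (m : ℕ) :
    chain (twoEStep EX EY aY NX) p ω m = chain (twoEStep EX EY aY NX) p ω' m := by
  induction m with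
  | zero => rfl
  | succ m ih => rw [chain, chain, ih, twoEStep_congr EX EY _ (h1 m) (h2 m) (h3 m)]

theorem chain_twoEStep (h : EReal) (ω : Path 𝓧 𝓨 𝓩) (n : ℕ) :
    chain (twoEStep EX EY aY NX) (h, TwoE.start (randomLimit NY (ω 0).2.2.2.2)) ω n =
      (h, twoEState EX EY aY NX NY h ω n) := by
  induction n with
  | zero => rfl
  | succ n ih => rw [chain, ih, twoEState, twoEStep]

/-- The state `done` is absorbing, so whether the time exceeds `m` can be read off from the state
after `m` steps. -/
theorem lt_twoETime_iff (b : EReal) (ω : Path 𝓧 𝓨 𝓩) (m : ℕ) :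
    (m : ℕ∞) < twoETime EX EY b aY NX NY ω ↔ twoEState EX EY aY NX NY (0 - b) ω m ≠ .done := by
  constructor
  · intro h hd
    exact absurd (iInf₂_le m hd) (not_le.2 h)
  · intro h
    have hmono : ∀ n, n ≤ m → twoEState EX EY aY NX NY (0 - b) ω n ≠ .done := by
      intro n hn hd
      refine h (Nat.le_induction hd (fun k _ hk => ?_) m hn)
      rw [twoEState, hk]
      rfl
    have : ((m + 1 : ℕ) : ℕ∞) ≤ twoETime EX EY b aY NX NY ω := le_iInf₂ fun n hn => by
      by_contra hc
      have : n < m + 1 := by exact_mod_cast not_le.1 hc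
      exact hmono n (by omega) hn
    exact lt_of_lt_of_le (by exact_mod_cast Nat.lt_succ_self m) this

theorem twoETime_eq_tsum (x : EReal) (ω : Path 𝓧 𝓨 𝓩) :
    (twoETime EX EY ((aZ : EReal) * x) aY NX NY ω : ℝ≥0∞) =
      ∑' m, running (chain (twoEStep EX EY aY NX)
        (-((aZ : EReal) * x), TwoE.start (randomLimit NY (ω 0).2.2.2.2)) ω m) := by
  rw [← tsum_ite_lt]
  refine tsum_congr fun m => ?_
  rw [chain_twoEStep]
  have h := lt_twoETime_iff EX EY (aY := aY) (NX := NX) (NY := NY) ((aZ : EReal) * x) ω m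
  rw [sub_eq_add_neg, zero_add] at h
  by_cases hd : twoEState EX EY aY NX NY (-((aZ : EReal) * x)) ω m = .done
  · rw [if_neg (by rw [h]; exact not_not.2 hd), hd, running_done]
  · rw [if_pos (h.2 hd), running_of_ne _ hd]

theorem meanTwoE_eq (h1 : EZ.affinity < 1) :
    meanTwoE EX EY EZ aY aZ NX NY = meanBelow EX EY EZ aY aZ NX NY := by
  have hstep := measurable_twoEStep (𝓩 := 𝓩) EX EY (aY := aY) (NX := NX)
  rw [meanTwoE]
  simp only [twoETime_eq_tsum]
  have mr : ∀ m, Measurable fun p : EReal × unitInterval × Path 𝓧 𝓨 𝓩 =>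
      running (chain (twoEStep EX EY aY NX)
        (-((aZ : EReal) * p.1), TwoE.start (randomLimit NY p.2.1)) p.2.2 m) := fun m =>
    measurable_running.comp ((measurable_chain_prod hstep m).comp
      (((measurable_fst.const_mul _).neg.prodMk
        ((measurable_start.comp (measurable_randomLimit NY)).comp measurable_snd.fst)).prodMk
          measurable_snd.snd))
  rw [lintegral_decouple EX EY EZ (Φ := fun x v ω => ∑' m, running (chain (twoEStep EX EY aY NX)
      (-((aZ : EReal) * x), TwoE.start (randomLimit NY v)) ω m))
    (Measurable.tsum mr) (fun x v ω ω' e1 e2 e3 => tsum_congr fun m => by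
      rw [chain_twoEStep_congr EX EY _ e1 e2 e3]), meanBelow,
    ← lintegral_undershootZ EX EY EZ h1 (measurable_startMean (measurable_meanRemaining EX EY EZ))]
  refine lintegral_congr fun ω => lintegral_congr fun v => ?_
  have mrun : ∀ p m, Measurable fun ω : Path 𝓧 𝓨 𝓩 =>
      running (chain (twoEStep EX EY aY NX) p ω m) := fun p m =>
    measurable_running.comp (measurable_chain hstep p m)
  rw [lintegral_tsum fun m => (mrun _ m).aemeasurable,
    meanRemaining, potential, P_top]
  refine tsum_congr fun m => ?_
  rw [← lintegral_chain_iterate_zero hstep MeasurableSet.univ _ m measurable_running]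
  simp

/-! ### The mean number of observations of `Y` -/

/-- As $E\min(\tau,k)=\sum_{m<k}P(\tau>m)$, truncating the time at `k` means cutting the potential
at horizon `k`. -/
theorem lintegral_min_cusumTime (h : EReal) (k : ℕ) :
    ∫⁻ ω, ((min (cusumTime EY h fun n => (ω n).2.1) (k : ℕ∞) : ℕ∞) : ℝ≥0∞) ∂P EX EY EZ ⊤ =
      partialPotential (preLaw EX EY EZ) (cusumStep EY fun o => o.2.1) belowThreshold k 1
        (h, 0) := by
  have hstep := measurable_cusumStep EY (π := fun o : Datum 𝓧 𝓨 𝓩 => o.2.1) measurable_snd.fst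
  have hst : ∀ (m : ℕ) (ω : Path 𝓧 𝓨 𝓩),
      (if (m : ℕ∞) < cusumTime EY h fun n => (ω n).2.1 then (1 : ℝ≥0∞) else 0) =
      {ω | ∀ k, 1 ≤ k → k ≤ m → chain (cusumStep EY fun o : Datum 𝓧 𝓨 𝓩 => o.2.1) (h, 0) ω k ∈
        belowThreshold}.indicator 1 ω := by
    intro m ω
    have : ((m : ℕ∞) < cusumTime EY h fun n => (ω n).2.1) ↔ ω ∈ {ω | ∀ k, 1 ≤ k → k ≤ m →
        chain (cusumStep EY fun o : Datum 𝓧 𝓨 𝓩 => o.2.1) (h, 0) ω k ∈ belowThreshold} := by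
      rw [cusumTime, lt_firstTime_iff]
      simp only [Set.mem_ofPred_eq, chain_cusumStep, mk_mem_belowThreshold, not_lt]
    by_cases hm : (m : ℕ∞) < cusumTime EY h fun n => (ω n).2.1
    · rw [if_pos hm, Set.indicator_of_mem (this.1 hm)]; rfl
    · rw [if_neg hm, Set.indicator_of_notMem fun hc => hm (this.2 hc)]
  simp only [min_natCast_eq_sum, hst]
  rw [lintegral_finsetSum, partialPotential, P_top]
  · refine Finset.sum_congr rfl fun m _ => ?_
    rw [← lintegral_chain_iterate_zero hstep measurableSet_belowThreshold _ m measurable_one]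
    simp
  · intro m _
    have := measurableSet_stay hstep measurableSet_belowThreshold (h, 0) 0 m
    simp only [zero_add] at this
    exact measurable_one.indicator this

theorem measurable_cusumTime : Measurable fun p : EReal × Path 𝓧 𝓨 𝓩 =>
    cusumTime EY p.1 fun n => (p.2 n).2.1 := by
  refine measurable_firstTime fun n => measurableSet_lt measurable_fst ?_
  have := (measurable_chain (measurable_cusumStep EY (π := fun o : Datum 𝓧 𝓨 𝓩 => o.2.1)
    measurable_snd.fst) (0, 0) n).snd
  simp only [chain_cusumStep] at this
  exact this.comp measurable_snd

theorem meanTruncCusumY_eq (h1 : EZ.affinity < 1) :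
    meanTruncCusumY EX EY EZ aZ NY = meanBelowY EX EY EZ aZ NY := by
  have m : Measurable fun p : EReal × unitInterval × Path 𝓧 𝓨 𝓩 =>
      ((min (cusumTime EY (-((aZ : EReal) * p.1)) fun n => (p.2.2 n).2.1)
        (randomLimit NY p.2.1 : ℕ∞) : ℕ∞) : ℝ≥0∞) :=
    (measurable_of_countable fun q : ℕ∞ × ℕ => ((min q.1 (q.2 : ℕ∞) : ℕ∞) : ℝ≥0∞)).comp
      (((measurable_cusumTime EY).comp
        ((measurable_fst.const_mul _).neg.prodMk measurable_snd.snd)).prodMk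
          ((measurable_randomLimit NY).comp measurable_snd.fst))
  rw [meanTruncCusumY, lintegral_decouple EX EY EZ (Φ := fun x v ω =>
      ((min (cusumTime EY (-((aZ : EReal) * x)) fun n => (ω n).2.1)
        (randomLimit NY v : ℕ∞) : ℕ∞) : ℝ≥0∞)) m (fun x v ω ω' _ e2 _ => by simp only [e2]),
    meanBelowY, ← lintegral_undershootZ EX EY EZ h1
      (measurable_startMean (measurable_meanCountY EX EY EZ))]
  refine lintegral_congr fun ω => lintegral_congr fun v => ?_
  rw [lintegral_min_cusumTime, meanCountY_start]

end

/-! ### Choice of the parameters for prescribed observation ratios -/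

theorem potential_mono {S O : Type*} [MeasurableSpace S] [MeasurableSpace O] {μ : Measure O}
    {step : S → O → S} {good : Set S} {f g : S → ℝ≥0∞} (h : ∀ s, f s ≤ g s) (s : S) :
    potential μ step good f s ≤ potential μ step good g s := by
  have : ∀ m s, (killed μ step good)^[m] f s ≤ (killed μ step good)^[m] g s := by
    intro m
    induction m with
    | zero => exact h
    | succ m ih =>
      intro s
      rw [Function.iterate_succ_apply', Function.iterate_succ_apply']
      exact killed_mono (fun s _ => ih s) s
  exact ENNReal.tsum_le_tsum fun m => this m s

theorem randomLimit_natCast (n : ℕ) (u : unitInterval) : randomLimit n u = n := by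
  have : ¬ (u : ℝ) < (n : ℝ) - (n : ℝ) := by rw [sub_self]; exact not_lt.2 u.2.1
  simp only [randomLimit, Nat.floor_natCast, if_neg this]

/-- The pointwise form of Markov's inequality that charges an `X` run for crossing its threshold
early. -/
theorem one_le_exp_mul_exp_neg {u v : EReal} (hu : 0 ≤ u) (h : u < v) :
    1 ≤ v.exp * (-u).exp := by
  have ht : u ≠ ⊤ := (h.trans_le le_top).ne
  have hb : u ≠ ⊥ := fun hc => by simp [hc] at hu
  calc (1 : ℝ≥0∞) = (u + -u).exp := by
        rw [← sub_eq_add_neg, EReal.sub_self ht hb, EReal.exp_zero]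
    _ = u.exp * (-u).exp := EReal.exp_add _ _
    _ ≤ _ := mul_le_mul_left (EReal.exp_monotone h.le) _

section

variable {𝓧 𝓨 𝓩 : Type*} [MeasurableSpace 𝓧] [MeasurableSpace 𝓨] [MeasurableSpace 𝓩]
variable (EX : Experiment 𝓧) (EY : Experiment 𝓨) (EZ : Experiment 𝓩) {aY aZ NX NY : ℝ}

theorem measurable_meanRemaining_step (h : EReal) (s : TwoE) :
    Measurable fun o : Datum 𝓧 𝓨 𝓩 =>
      meanRemaining EX EY EZ aY NX h (s.step EX EY aY NX h o) := by
  have ms : Measurable fun o : Datum 𝓧 𝓨 𝓩 => (h, s.step EX EY aY NX h o) :=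
    measurable_const.prodMk
      (measurable_twoE_step EX EY aY NX measurable_const measurable_const measurable_id)
  exact (measurable_meanRemaining EX EY EZ).comp ms

theorem lintegral_exp_max_le {v : EReal} (hv : 0 ≤ v) :
    ∫⁻ o : Datum 𝓧 𝓨 𝓩, (max (v + EX.llr o.1) 0).exp ∂preLaw EX EY EZ ≤ 2 * v.exp := by
  have m := EX.measurable_exp_llr
  have m' : Measurable fun x => v.exp * (EX.llr x).exp := m.const_mul _
  calc _ ≤ ∫⁻ o : Datum 𝓧 𝓨 𝓩, (v.exp * (EX.llr o.1).exp + v.exp) ∂preLaw EX EY EZ := by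
        refine lintegral_mono fun o => ?_
        rcases max_cases (v + EX.llr o.1) 0 with h | h
        · rw [h.1, EReal.exp_add]; exact le_self_add
        · rw [h.1]; exact (EReal.exp_monotone hv).trans le_add_self
    _ = v.exp * (∫⁻ x, (EX.llr x).exp ∂EX.pre) + v.exp := by
        rw [lintegral_add_right _ measurable_const, preLaw_eq, lintegral_obsX EX.pre EY.pre EZ.pre
          (g := fun x => v.exp * (EX.llr x).exp) m', lintegral_const_mul _ m]
        simp
    _ ≤ v.exp * 1 + v.exp :=
        add_le_add_left (mul_le_mul_right EX.lintegral_exp_llr_pre_le _) _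
    _ = _ := by rw [mul_one, two_mul]

/-- A CUSUM for `X` with a high threshold is likely to use all observations that are allowed. -/
theorem exists_le_meanRemaining_onX (j : ℕ) :
    ∃ a : ℕ, ∀ (aY NX : ℝ) (h v u : EReal) (k : ℕ), 0 ≤ v → 0 ≤ u →
      (j : ℝ≥0∞) ≤ meanRemaining EX EY EZ aY NX h (.onX v u j k) + a * (v.exp * (-u).exp) := by
  induction j with
  | zero => exact ⟨0, fun _ _ _ _ _ _ _ _ => by simp⟩
  | succ j ih =>
    obtain ⟨a, ha⟩ := ih
    -- A crossing at this step forfeits at most `j` further observations and later crossings are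
    -- covered by `a`; the factor `2` is the possible growth of the mean of $e^{v}$ in one CUSUM
    -- step.
    refine ⟨2 * (a + j), fun aY NX h v u k hv hu => ?_⟩
    rw [meanRemaining_eq, running_of_ne h (by simp)]
    have mm := measurable_meanRemaining_step EX EY EZ (aY := aY) (NX := NX) h (.onX v u (j + 1) k)
    have me : Measurable fun o : Datum 𝓧 𝓨 𝓩 => (max (v + EX.llr o.1) 0).exp :=
      (((EX.measurable_llr.comp measurable_fst).const_add v).max measurable_const).ereal_exp
    have hpt : ∀ o : Datum 𝓧 𝓨 𝓩, (j : ℝ≥0∞) ≤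
        meanRemaining EX EY EZ aY NX h ((TwoE.onX v u (j + 1) k).step EX EY aY NX h o) +
          (a + j) * (-u).exp * (max (v + EX.llr o.1) 0).exp := by
      intro o
      simp only [TwoE.step, Nat.add_sub_cancel]
      split_ifs with hc
      · refine le_trans ?_ le_add_self
        rcases hc with hc | hc
        · calc (j : ℝ≥0∞) ≤ a + j := le_add_self
            _ ≤ (a + j) * ((max (v + EX.llr o.1) 0).exp * (-u).exp) :=
              le_mul_of_one_le_right' (one_le_exp_mul_exp_neg hu hc)
            _ = _ := by ring
        · have : j = 0 := by omega
          subst this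
          simp
      · refine (ha aY NX h _ u k (le_max_right _ _) hu).trans (add_le_add_right ?_ _)
        calc _ = (a : ℝ≥0∞) * (-u).exp * (max (v + EX.llr o.1) 0).exp := by ring
          _ ≤ _ := mul_le_mul_left (mul_le_mul_left le_self_add _) _
    have hint : (j : ℝ≥0∞) ≤ ∫⁻ o : Datum 𝓧 𝓨 𝓩,
        meanRemaining EX EY EZ aY NX h ((TwoE.onX v u (j + 1) k).step EX EY aY NX h o)
          ∂preLaw EX EY EZ + (a + j) * (-u).exp * (2 * v.exp) := by
      calc (j : ℝ≥0∞) = ∫⁻ _ : Datum 𝓧 𝓨 𝓩, (j : ℝ≥0∞) ∂preLaw EX EY EZ := by simp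
        _ ≤ _ := lintegral_mono hpt
        _ ≤ _ := by
          rw [lintegral_add_left mm, lintegral_const_mul _ me]
          exact add_le_add_right (mul_le_mul_right (lintegral_exp_max_le EX EY EZ hv) _) _
    calc ((j + 1 : ℕ) : ℝ≥0∞) = 1 + j := by push_cast; ring
      _ ≤ _ := add_le_add_right hint _
      _ = _ := by push_cast; ring

theorem exists_pre_llr_le_pos (E : Experiment 𝓨) (h : 0 < E.kl) :
    ∃ c : ℝ, 0 < c ∧ 0 < E.pre {y | E.llr y ≤ (-c : ℝ)} := by
  by_contra hc
  push Not at hc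
  have hsub : {y | E.llr y < 0} ⊆ ⋃ n : ℕ, {y | E.llr y ≤ (-(1 / ((n : ℝ) + 1)) : ℝ)} := by
    intro y hy
    obtain ⟨q, hq1, hq2⟩ := EReal.lt_iff_exists_real_btwn.1 (show E.llr y < 0 from hy)
    have hq0 : q < 0 := by exact_mod_cast hq2
    obtain ⟨n, hn⟩ := exists_nat_one_div_lt (show 0 < -q by linarith)
    refine Set.mem_iUnion.2 ⟨n, hq1.le.trans ?_⟩
    exact_mod_cast (by linarith : q ≤ -(1 / ((n : ℝ) + 1)))
  refine (E.pre_llr_neg_pos h).ne' (measure_mono_null hsub (measure_iUnion_null fun n => ?_))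
  exact le_antisymm (hc _ (by positivity)) zero_le

/-- With two `Y` observations allowed, the first can start an `X` run. It falls by at least some
$c>0$ with probability $p>0$ whatever the stopping threshold; a large $a_Y$ then puts the zero level
of `X` so low that almost the whole allowance is used. -/
theorem exists_le_meanRemaining_start (h : 0 < EY.kl) {L : ℝ≥0∞} (hL : L ≠ ∞) :
    ∃ aY NX : ℝ, 0 < aY ∧ 0 < NX ∧ ∀ x : EReal, 0 ≤ x →
      L ≤ meanRemaining EX EY EZ aY NX x (TwoE.start 2) := by
  obtain ⟨c, hc, hp⟩ := exists_pre_llr_le_pos EY h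
  set p := EY.pre {y | EY.llr y ≤ (-c : ℝ)} with hpdef
  obtain ⟨n, hn⟩ := ENNReal.exists_nat_mul_gt hp.ne' hL
  have ms : MeasurableSet {y | EY.llr y ≤ (-c : ℝ)} :=
    measurableSet_le EY.measurable_llr measurable_const
  obtain ⟨a, ha⟩ := exists_le_meanRemaining_onX EX EY EZ (n + 1)
  have hac : 0 < ((a : ℝ) + 1) / c := by positivity
  -- The choice $a_Y=(a+1)/c$ bounds the error term by $a\,e^{-(a+1)}\le1$; one extra observation in
  -- $N_X=n+1$ absorbs it, leaving $n$ with $np>L$.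
  refine ⟨((a : ℝ) + 1) / c, (n + 1 : ℕ), hac, by positivity, fun x hx => ?_⟩
  have hexp : ∀ w : EReal, w ≤ (-c : ℝ) →
      (a : ℝ≥0∞) * (- -(((((a : ℝ) + 1) / c : ℝ) : EReal) * w)).exp ≤ 1 := by
    intro w hw
    have h2 : ((((a : ℝ) + 1) / c : ℝ) : EReal) * w ≤ ((-((a : ℝ) + 1) : ℝ) : EReal) := by
      calc _ ≤ ((((a : ℝ) + 1) / c : ℝ) : EReal) * ((-c : ℝ) : EReal) :=
            mul_le_mul_of_nonneg_left hw (by exact_mod_cast hac.le)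
        _ = _ := by
          rw [← EReal.coe_mul]
          congr 1
          field_simp
    rw [neg_neg]
    calc _ ≤ (a : ℝ≥0∞) * ENNReal.ofReal (Real.exp (-((a : ℝ) + 1))) := by
          refine mul_le_mul_right ?_ _
          rw [← EReal.exp_coe]
          exact EReal.exp_monotone h2
      _ = ENNReal.ofReal (a * Real.exp (-((a : ℝ) + 1))) := by
          rw [ENNReal.ofReal_mul (by positivity), ENNReal.ofReal_natCast]
      _ ≤ 1 := by
          refine ENNReal.ofReal_le_one.2 ?_
          rw [Real.exp_neg, ← div_eq_mul_inv, div_le_one (Real.exp_pos _)]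
          linarith [Real.add_one_le_exp ((a : ℝ) + 1)]
  have hpt : ∀ o : Datum 𝓧 𝓨 𝓩, {y | EY.llr y ≤ (-c : ℝ)}.indicator (fun _ => (n : ℝ≥0∞)) o.2.1 ≤
      meanRemaining EX EY EZ (((a : ℝ) + 1) / c) (n + 1 : ℕ) x
        ((TwoE.start 2).step EX EY (((a : ℝ) + 1) / c) (n + 1 : ℕ) x o) := by
    intro o
    by_cases ho : EY.llr o.2.1 ≤ (-c : ℝ)
    · have hneg : EY.llr o.2.1 < 0 := ho.trans_lt (by exact_mod_cast (by linarith : -c < 0))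
      have hlim := randomLimit_natCast (n + 1) o.2.2.2.1
      have hst : (TwoE.start 2).step EX EY (((a : ℝ) + 1) / c) (n + 1 : ℕ) x o =
          .onX 0 (-(((((a : ℝ) + 1) / c : ℝ) : EReal) * EY.llr o.2.1)) (n + 1) 1 := by
        simp only [TwoE.start, OfNat.ofNat_ne_zero, if_false, TwoE.step, zero_add, hlim]
        rw [if_neg (by rintro (h' | h'); exacts [absurd (h'.trans hneg) (not_lt.2 hx), by omega]),
          if_pos hneg, if_neg (Nat.succ_ne_zero n)]
      have := ha (((a : ℝ) + 1) / c) (n + 1 : ℕ) x 0 _ 1 le_rfl (neg_coe_mul_pos hac hneg).le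
      rw [EReal.exp_zero, one_mul] at this
      rw [Set.indicator_of_mem (by exact ho), hst]
      have h3 := this.trans (add_le_add_right (hexp _ ho) _)
      rw [Nat.cast_succ] at h3
      exact (ENNReal.add_le_add_iff_right ENNReal.one_ne_top).1 h3
    · rw [Set.indicator_of_notMem (by exact ho)]
      exact zero_le
  calc L ≤ n * p := hn.le
    _ = ∫⁻ o : Datum 𝓧 𝓨 𝓩, {y | EY.llr y ≤ (-c : ℝ)}.indicator (fun _ => (n : ℝ≥0∞)) o.2.1
          ∂preLaw EX EY EZ := by
        rw [preLaw_eq, lintegral_obsY EX.pre EY.pre EZ.pre (measurable_const.indicator ms),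
          lintegral_indicator_const ms]
    _ ≤ _ := lintegral_mono hpt
    _ ≤ _ := by
        rw [meanRemaining_eq EX EY EZ x (TwoE.start 2)]
        exact le_add_self

theorem exists_le_meanBelow (h : 0 < EY.kl) (h1 : EZ.affinity < 1) {L : ℝ≥0∞} (hL : L ≠ ∞) :
    ∃ aY NX : ℝ, 0 < aY ∧ 0 < NX ∧ L ≤ meanBelow EX EY EZ aY 1 NX 2 := by
  obtain ⟨aY, NX, haY, hNX, hle⟩ := exists_le_meanRemaining_start EX EY EZ h hL
  refine ⟨aY, NX, haY, hNX, ?_⟩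
  calc L = ∫⁻ _, L ∂P EX EY EZ ⊤ := by simp
    _ = walkPotential EX EY EZ (fallMean EX EY EZ fun _ => L) 0 :=
      -- The walk falls almost surely, so a constant reward at the fall has mean `L`.
      lintegral_undershootZ EX EY EZ h1 (φ := fun _ => L) measurable_const
    _ ≤ _ := potential_mono (fun d => lintegral_mono fun o => ?_) 0
  by_cases hx : walkStep EZ d o < 0
  · rw [Set.indicator_of_mem (s := Set.Iio (0 : EReal)) hx,
      Set.indicator_of_mem (s := Set.Iio (0 : EReal)) hx]
    calc L = ∫⁻ _ : unitInterval, L := by simp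
      _ ≤ _ := lintegral_mono fun v => by
        have h2 : randomLimit 2 v = 2 := by exact_mod_cast randomLimit_natCast 2 v
        rw [h2]
        exact hle _ (neg_coe_mul_pos one_pos hx).le
  · rw [Set.indicator_of_notMem (s := Set.Iio (0 : EReal)) hx]
    exact zero_le

theorem meanBelowY_le (h1 : EZ.affinity < 1) : meanBelowY EX EY EZ aZ 2 ≤ 2 := by
  rw [← meanTruncCusumY_eq EX EY EZ h1, meanTruncCusumY]
  calc _ ≤ ∫⁻ _, 2 ∂P EX EY EZ ⊤ := lintegral_mono fun ω => by
        have h2 : randomLimit 2 (ω 0).2.2.2.2 = 2 := by exact_mod_cast randomLimit_natCast 2 _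
        rw [h2]
        exact (ENat.toENNReal_le.2 (min_le_right _ _)).trans (by simp)
    _ = 2 := by simp

theorem div_add_le_ofReal {s b L : ℝ≥0∞} {β : ℝ} (hβ : 0 < β)
    (hL : L / ENNReal.ofReal β ≤ b) : L / (s + b) ≤ ENNReal.ofReal β := by
  have h0 : ENNReal.ofReal β ≠ 0 := by simpa using hβ
  refine ENNReal.div_le_of_le_mul ?_
  calc L = ENNReal.ofReal β * (L / ENNReal.ofReal β) :=
        (ENNReal.mul_div_cancel h0 ENNReal.ofReal_ne_top).symm
    _ ≤ _ := mul_le_mul_right (hL.trans le_add_self) _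

/-- The numerators stay bounded, by $E_\infty[\sigma^Z]$ for `Z` and by $2$ for `Y`, while the time
below zero can be made arbitrarily long. The bound required of it is
$E_\infty[\sigma^Z]/\beta_Z+2/\beta_Y$, one summand for each constraint. -/
theorem exists_por_le (hY : 0 < EY.kl) (hZ : 0 < EZ.kl) {βY βZ : ℝ} (hβY : 0 < βY)
    (hβZ : 0 < βZ) :
    ∃ aY aZ NX NY : ℝ, 0 < aY ∧ 0 < aZ ∧ 0 < NX ∧ 0 < NY ∧ ∀ A : ℝ, 0 < A →
      por EX EY EZ (psi3E EX EY EZ A aY aZ NX NY) .Z ≤ ENNReal.ofReal βZ ∧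
      por EX EY EZ (psi3E EX EY EZ A aY aZ NX NY) .Y ≤ ENNReal.ofReal βY := by
  have h1 := EZ.affinity_lt_one hZ
  have hZ0 : ENNReal.ofReal βZ ≠ 0 := by simpa using hβZ
  have hY0 : ENNReal.ofReal βY ≠ 0 := by simpa using hβY
  have hS := (meanDescent_lt_top EX EY EZ h1).ne
  have hL : meanDescent EX EY EZ / ENNReal.ofReal βZ + 2 / ENNReal.ofReal βY ≠ ∞ :=
    ENNReal.add_ne_top.2 ⟨ENNReal.div_ne_top hS hZ0, ENNReal.div_ne_top (by simp) hY0⟩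
  obtain ⟨aY, NX, haY, hNX, hle⟩ := exists_le_meanBelow EX EY EZ hY h1 hL
  refine ⟨aY, 1, NX, 2, haY, one_pos, hNX, two_pos, fun A _ => ⟨?_, ?_⟩⟩
  · rw [por_Z_eq EX EY EZ h1 haY one_pos hNX.le]
    exact div_add_le_ofReal hβZ (le_self_add.trans hle)
  · rw [por_Y_eq EX EY EZ h1 haY one_pos hNX.le]
    refine le_trans ?_ (div_add_le_ofReal (s := meanDescent EX EY EZ) hβY (L := 2) (le_add_self.trans hle))
    exact mul_le_mul_left (meanBelowY_le EX EY EZ h1) _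

end

end QCD

end

theorem theorem2 {𝓧 𝓨 𝓩 : Type*} [MeasurableSpace 𝓧] [MeasurableSpace 𝓨] [MeasurableSpace 𝓩]
    (EX : Experiment 𝓧) (EY : Experiment 𝓨) (EZ : Experiment 𝓩)
    (hX : 0 < EX.kl) (hXY : EX.kl ≤ EY.kl) (hYZ : EY.kl ≤ EZ.kl) (hZ : EZ.kl < ∞) :
    -- (1) false alarms
    (∀ aY aZ NX NY γ : ℝ, 0 < aY → 0 < aZ → 0 < NX → 0 < NY → 0 < γ →
      ENNReal.ofReal γ ≤ arlfa EX EY EZ (psi3E EX EY EZ (Real.log γ) aY aZ NX NY)) ∧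
    -- (2) observation ratios
    (∀ A aY aZ NX NY : ℝ, 0 < A → 0 < aY → 0 < aZ → 0 < NX → 0 < NY →
      meanSigmaZ EX EY EZ < ∞ ∧ meanTwoE EX EY EZ aY aZ NX NY < ∞ ∧
      por EX EY EZ (psi3E EX EY EZ A aY aZ NX NY) .Z =
        meanSigmaZ EX EY EZ / (meanSigmaZ EX EY EZ + meanTwoE EX EY EZ aY aZ NX NY) ∧
      por EX EY EZ (psi3E EX EY EZ A aY aZ NX NY) .Y =
        meanTruncCusumY EX EY EZ aZ NY /
          (meanSigmaZ EX EY EZ + meanTwoE EX EY EZ aY aZ NX NY)) ∧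
    (∀ βY βZ : ℝ, 0 < βY → βY < 1 → 0 < βZ → βZ < 1 →
      ∃ aY aZ NX NY : ℝ, 0 < aY ∧ 0 < aZ ∧ 0 < NX ∧ 0 < NY ∧ ∀ A : ℝ, 0 < A →
        por EX EY EZ (psi3E EX EY EZ A aY aZ NX NY) .Z ≤ ENNReal.ofReal βZ ∧
        por EX EY EZ (psi3E EX EY EZ A aY aZ NX NY) .Y ≤ ENNReal.ofReal βY) ∧
    -- (3) detection delay
    (∀ aY aZ NX NY : ℝ, 0 < aY → 0 < aZ → 0 < NX → 0 < NY →
      (∀ A : ℝ, 0 < A →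
        wadd EX EY EZ (psi3E EX EY EZ A aY aZ NX NY) ≤
          meanAlarm EX EY EZ 1 (psi3E EX EY EZ A aY aZ NX NY) + ENNReal.ofReal (NY + NY * NX)) ∧
      ∃ K : ℝ≥0, ∀ A : ℝ, 0 < A →
        meanAlarm EX EY EZ 1 (psi3E EX EY EZ A aY aZ NX NY) + ENNReal.ofReal (NY + NY * NX) ≤
          wadd EX EY EZ (cusumZ (𝓧 := 𝓧) (𝓨 := 𝓨) EZ A) + K ∧
        wadd EX EY EZ (psi3E EX EY EZ A aY aZ NX NY) ≤
          wadd EX EY EZ (cusumZ (𝓧 := 𝓧) (𝓨 := 𝓨) EZ A) + K) := by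
  have hY0 : 0 < EY.kl := hX.trans_le hXY
  have hZ0 : 0 < EZ.kl := hY0.trans_le hYZ
  have h1 := EZ.affinity_lt_one hZ0
  refine ⟨fun aY aZ NX NY γ haY haZ _ _ _ => ofReal_le_arlfa EX EY EZ haY haZ,
    fun A aY aZ NX NY _ haY haZ hNX _ => ?_,
    fun βY βZ hβY _ hβZ _ => exists_por_le EX EY EZ hY0 hZ0 hβY hβZ,
    fun aY aZ NX NY haY haZ hNX hNY => ?_⟩
  · rw [meanSigmaZ_eq, meanTwoE_eq EX EY EZ h1, meanTruncCusumY_eq EX EY EZ h1]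
    exact ⟨meanDescent_lt_top EX EY EZ h1, meanBelow_lt_top EX EY EZ h1 haZ hNX.le,
      por_Z_eq EX EY EZ h1 haY haZ hNX.le A, por_Y_eq EX EY EZ h1 haY haZ hNX.le A⟩
  · have hw := fun A : ℝ => fun hA : 0 < A =>
      wadd_le EX EY EZ haY haZ hNX.le hNY.le (A := A) hA.le
    obtain ⟨K, hK⟩ := exists_meanAlarm_le_wadd_cusumZ EX EY EZ hZ0 haY haZ hNX.le hNY.le
    exact ⟨hw, K, fun A hA => ⟨hK A hA, (hw A hA).trans (hK A hA)⟩⟩
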